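/- **Notation.** Let $D$ be a positive square-free integer and $C\ge 1$ a divisor of $D$. For a function $g$ on the upper half plane $\mathcal H$ and $\gamma=\begin{pmatrix}a&b\\c&d\end{pmatrix}\in \mathrm{GL}_2^+(\mathbb R)$ put $(g|\gamma)(z)=\det(\gamma)(cz+d)^{-2}g(\gamma z)$, and write $q=e^{2\pi i z}$. For $x=(x_1,x_2)\in(\mathbb Q/\mathbb Z)^2$ let $\phi_x$ be Hecke's function $$\phi_x(z)=-\delta(x)\frac{i}{2\pi(z-\bar z)}+\tfrac12B_2(x_1)-P_x(z)-P_{-x}(z),\qquad P_x(z)=\sum_{k\in\mathbb Q_{>0},\,k\equiv x_1 (1)}k\sum_{m\ge1}e^{2\pi i m(kz+x_2)},$$ where $B_2(t)=\langle t\rangle^2-\langle t\rangle+\frac16$ with $\langle t\rangle$ the fractional part of $t$, and $\delta(x)=1$ if $x=0$, $\delta(x)=0$ otherwise. The functions $\phi_x$ with $x\ne0$ span the space of weight two Eisenstein series of all levels; $\mathcal E_2(\Gamma_0(N),\mathbb C)$ is the space of those weight two modular forms for $\Gamma_0(N)$ that lie in this span. For a prime $\ell$, the Hecke operator $\mathcal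 T_\ell^{\Gamma_0(N)}$ is $$\mathcal T_\ell^{\Gamma_0(N)}(g)=\sum_{k=0}^{\ell-1}g\Big|\begin{pmatrix}1&k\\0&\ell\end{pmatrix}+g\Big|\begin{pmatrix}\ell&0\\0&1\end{pmatrix},$$ where the last term is omitted if $\ell\mid N$. Let $\chi$ be a primitive Dirichlet character of conductor $f_\chi$ (with $\chi(n)=\chi^{-1}(n)=0$ if $(n,f_\chi)\neq1$), with Gauss sum $g(\chi)=\sum_{a\bmod f_\chi}\chi(a)e^{2\pi i a/f_\chi}$. For a prime $p\nmid f_\chi$ put $\gamma_p=\begin{pmatrix}p&0\\0&1\end{pmatrix}$ and $$[p]_\chi^+(g)=g-\chi(p)\,g|\gamma_p,\qquad [p]_\chi^-(g)=g-p^{-1}\chi^{-1}(p)\,g|\gamma_p ;$$ for a square-free integer $n\ge 1$ prime to $f_\chi$, let $[n]_\chi^{\pm}$ be the composite of the (commuting) operators $[p]_\chi^\pm$ over the primes $p\mid n$. Put $$E_\chi=-\frac1{2g(\chi)}\sum_{a\in(\mathbb Z/f_\chi)^\times}\ \sum_{b\in(\mathbb Z/f_\chi^2)^\times}\chi(a)\chi(b)\,\phi_{(a/f_\chi,\;b/f_\chi^2)}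 .$$ Let $\mathcal H(DC)$ be the set of triples $(M,L,\chi)$ where $M,L\ge1$ divide $D$, $M\ne1$, $D\mid ML\mid DC$, and $\chi$ is a primitive Dirichlet character with $f_\chi\mid\gcd(M,L)$. For such a triple put $E_{M,L,\chi}=[L/f_\chi]^-_\chi\circ[M/f_\chi]^+_\chi(E_\chi)$. **Proposition 3.7.** 1. For every $(M,L,\chi)\in\mathcal H(DC)$, $E_{M,L,\chi}$ is normalized: the coefficient of $q$ in its Fourier expansion at $\infty$ is $1$. 2. For every $(M,L,\chi)\in\mathcal H(DC)$ and every prime $\ell$, $$\mathcal T_\ell^{\Gamma_0(DC)}(E_{M,L,\chi})=\begin{cases}(\chi^{-1}(\ell)+\ell\chi(\ell))\,E_{M,L,\chi}&\text{if }\ell\nmid D,\\ \chi^{-1}(\ell)\,E_{M,L,\chi}&\text{if }\ell\mid M/\gcd(M,L),\\ \ell\chi(\ell)\,E_{M,L,\chi}&\text{if }\ell\mid L/\gcd(M,L),\\ 0&\text{if }\ell\mid\gcd(M,L).\end{cases}$$ 3. $\mathcal E_2(\Gamma_0(DC),\mathbb C)=\bigoplus_{(M,L,\chi)\in\mathcal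 H(DC)}\mathbb C\cdot E_{M,L,\chi}$; that is, the $E_{M,L,\chi}$ form a basis of $\mathcal E_2(\Gamma_0(DC),\mathbb C)$. -/

import Mathlib

open scoped UpperHalfPlane ModularForm MatrixGroups

noncomputable section

namespace EisBasis

/-- The invertible matrix with rows `(a, b)` and `(0, d)`, for positive integers `a`, `d`
(by convention it is the identity matrix if `a * d = 0`; this case is never used). -/
def upperMat (a b d : ℕ) : GL (Fin 2) ℝ :=
  if h : (!![(a : ℝ), (b : ℝ); 0, (d : ℝ)]).det ≠ 0 then
    Matrix.GeneralLinearGroup.mkOfDetNeZero !![(a : ℝ), (b : ℝ); 0, (d : ℝ)] h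
  else 1

/-- The congruence subgroup `Γ₀(N)`, as a subgroup of `GL₂(ℝ)`. -/
abbrev Gamma0GL (N : ℕ) : Subgroup (GL (Fin 2) ℝ) :=
  (CongruenceSubgroup.Gamma0 N).map (Matrix.SpecialLinearGroup.mapGL ℝ)

/-! ### Hecke's functions `φ_x` -/

/-- `P_x(z) = ∑_{k ∈ ℚ, k > 0, k ≡ x₁ mod 1} k ∑_{m ≥ 1} exp(2πi m (k z + x₂))`. -/
def heckeP (x₁ x₂ : ℚ) (z : ℍ) : ℂ :=
  ∑' k : {k : ℚ // 0 < k ∧ ∃ n : ℤ, k = x₁ + n},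
    ((k : ℚ) : ℂ) * ∑' m : ℕ+,
      Complex.exp (2 * Real.pi * Complex.I * (m : ℂ) * (((k : ℚ) : ℂ) * (z : ℂ) + (x₂ : ℂ)))

/-- `x = 0` in `(ℚ/ℤ)²`. -/
def IsIntegral (x₁ x₂ : ℚ) : Prop := (∃ n : ℤ, x₁ = n) ∧ ∃ n : ℤ, x₂ = n

/-- The second Bernoulli function `⟨t⟩² - ⟨t⟩ + 1/6`, where `⟨t⟩` is the fractional part. -/
def bernoulliTwo (t : ℚ) : ℚ := Int.fract t ^ 2 - Int.fract t + 1 / 6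

open scoped Classical in
/-- Hecke's weight two function `φ_x` on the upper half plane, for `x = (x₁, x₂)`;
it depends only on the class of `x` in `(ℚ/ℤ)²`. It is given by
`φ_x(z) + δ(x) i / (2π (z - z̄)) = B₂(x₁) / 2 - P_x(z) - P_{-x}(z)`,
with `δ(x) = 1` if `x = 0` in `(ℚ/ℤ)²` and `δ(x) = 0` otherwise. -/
def heckePhi (x₁ x₂ : ℚ) (z : ℍ) : ℂ :=
  ((bernoulliTwo x₁ : ℚ) : ℂ) / 2 - heckeP x₁ x₂ z - heckeP (-x₁) (-x₂) z
    - (if IsIntegral x₁ x₂ then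
        Complex.I / (2 * Real.pi * ((z : ℂ) - (starRingEnd ℂ) (z : ℂ))) else 0)

/-! ### The space of Eisenstein series -/

/-- The space of weight two Eisenstein series of all levels: the span of the `φ_x` with
`x ≠ 0` in `(ℚ/ℤ)²`. -/
def eisensteinAll : Submodule ℂ (ℍ → ℂ) :=
  Submodule.span ℂ {g | ∃ x₁ x₂ : ℚ, ¬ IsIntegral x₁ x₂ ∧ g = heckePhi x₁ x₂}

/-- The space `𝓔₂(Γ₀(N), ℂ)` of Eisenstein series of weight two and level `Γ₀(N)`:
the weight two modular forms for `Γ₀(N)` (seen as functions on the upper half plane)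
which are Eisenstein series. -/
def eisensteinSpace (N : ℕ) : Submodule ℂ (ℍ → ℂ) where
  carrier := {g | (∃ F : ModularForm (Gamma0GL N) 2, (F : ℍ → ℂ) = g) ∧ g ∈ eisensteinAll}
  add_mem' := by
    rintro _ _ ⟨⟨F, rfl⟩, hF⟩ ⟨⟨G, rfl⟩, hG⟩
    exact ⟨⟨F + G, by ext z; simp⟩, add_mem hF hG⟩
  zero_mem' := ⟨⟨0, by ext z; simp⟩, zero_mem _⟩
  smul_mem' := by
    rintro c _ ⟨⟨F, rfl⟩, hF⟩
    exact ⟨⟨c • F, by ext z; simp⟩, Submodule.smul_mem _ c hF⟩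

/-! ### Hecke operators -/

/-- The Hecke operator `T_ℓ` (`ℓ` prime) of weight two and level `Γ₀(N)`:
`g ↦ ∑_{0 ≤ k < ℓ} g | (1, k; 0, ℓ) + g | (ℓ, 0; 0, 1)`, where the last term is left out
if `ℓ ∣ N`. The slash action is `(g | γ)(z) = det(γ) (c z + d)⁻² g(γ z)`. -/
def heckeT (N ℓ : ℕ) (g : ℍ → ℂ) : ℍ → ℂ :=
  ∑ k ∈ Finset.range ℓ, g ∣[(2 : ℤ)] upperMat 1 k ℓ
    + if ℓ ∣ N then 0 else g ∣[(2 : ℤ)] upperMat ℓ 0 1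

/-! ### The operators `[M]^±_χ` -/

/-- `[p]⁺_χ g = g - χ(p) g | γ_p`, where `γ_p = (p, 0; 0, 1)`. -/
def primePlus {f : ℕ} (χ : DirichletCharacter ℂ f) (p : ℕ) (g : ℍ → ℂ) : ℍ → ℂ :=
  g - χ (p : ZMod f) • (g ∣[(2 : ℤ)] upperMat p 0 1)

/-- `[p]⁻_χ g = g - p⁻¹ χ⁻¹(p) g | γ_p`, where `γ_p = (p, 0; 0, 1)`. -/
def primeMinus {f : ℕ} (χ : DirichletCharacter ℂ f) (p : ℕ) (g : ℍ → ℂ) : ℍ → ℂ :=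
  g - ((p : ℂ)⁻¹ * χ⁻¹ (p : ZMod f)) • (g ∣[(2 : ℤ)] upperMat p 0 1)

/-- `[M]⁺_χ`, the composite of the (commuting) operators `[p]⁺_χ` over the primes `p ∣ M`,
for square-free `M`. -/
def bracketPlus {f : ℕ} (χ : DirichletCharacter ℂ f) (M : ℕ) (g : ℍ → ℂ) : ℍ → ℂ :=
  M.primeFactorsList.foldr (primePlus χ) g

/-- `[M]⁻_χ`, the composite of the (commuting) operators `[p]⁻_χ` over the primes `p ∣ M`,
for square-free `M`. -/
def bracketMinus {f : ℕ} (χ : DirichletCharacter ℂ f) (M : ℕ) (g : ℍ → ℂ) : ℍ → ℂ :=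
  M.primeFactorsList.foldr (primeMinus χ) g

/-! ### The Eisenstein series `E_{M, L, χ}` -/

/-- `E_χ = -1 / (2 g(χ)) ∑_{a ∈ (ℤ/f)ˣ} ∑_{b ∈ (ℤ/f²)ˣ} χ(a) χ(b) φ_{(a/f, b/f²)}` for a
(primitive) Dirichlet character `χ` modulo `f`, where `g(χ)` is the Gauss sum of `χ`. -/
def eisChi {f : ℕ} [NeZero f] (χ : DirichletCharacter ℂ f) : ℍ → ℂ :=
  (-1 / (2 * gaussSum χ ZMod.stdAddChar)) •
    ∑ a : (ZMod f)ˣ, ∑ b : (ZMod (f ^ 2))ˣ,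
      (χ (a : ZMod f) * χ (((b : ZMod (f ^ 2)).val : ℕ) : ZMod f)) •
        heckePhi (((a : ZMod f).val : ℚ) / (f : ℚ))
          (((b : ZMod (f ^ 2)).val : ℚ) / (f : ℚ) ^ 2)

/-- The set `𝓗(DC)` of triples `(M, L, χ)` where `M, L ∣ D`, `M ≠ 1`, `D ∣ M L ∣ D C` and `χ`
is a primitive Dirichlet character whose conductor `f` divides `(M, L)`. -/
structure Triple (D C : ℕ) where
  /-- The first divisor of `D`. -/
  M : ℕ
  /-- The second divisor of `D`. -/
  L : ℕ
  /-- The conductor of the character. -/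
  f : ℕ
  /-- The character. -/
  χ : DirichletCharacter ℂ f
  M_dvd : M ∣ D
  L_dvd : L ∣ D
  M_ne_one : M ≠ 1
  dvd_mul : D ∣ M * L
  mul_dvd : M * L ∣ D * C
  f_pos : 0 < f
  f_dvd : f ∣ Nat.gcd M L
  primitive : χ.IsPrimitive

instance {D C : ℕ} (t : Triple D C) : NeZero t.f := ⟨t.f_pos.ne'⟩

/-- `E_{M, L, χ} = [L/f]⁻_χ ([M/f]⁺_χ (E_χ))`. -/
def eisSeries {D C : ℕ} (t : Triple D C) : ℍ → ℂ :=
  bracketMinus t.χ (t.L / t.f) (bracketPlus t.χ (t.M / t.f) (eisChi t.χ))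

end EisBasis

end

/-!
The proof rests on two expansions of Hecke's functions. As double series,
`P_x(z) = ∑ k exp(2πi m (k z + x₂))` gives the Fourier expansions, holomorphy and growth at infinity.
As lattice sums, `4π² φ_x(z) = ∑_c ∑_d exp(2πi (c x₂ - d x₁)) (c z + d)⁻²` (`hasSum_rows`, for
non-integral `x`), and exchanging the order of summation gives `φ_x | γ = φ_{xγ}` for
`γ ∈ SL₂(ℤ)` (`heckePhi_slash`); the function `φ_0` is a multiple of the completed Eisenstein series
`E₂`. In particular a `Γ₀(N)`-invariant element of `eisensteinAll` is automatically a modular form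
(`mem_eisensteinSpace_iff`).

*Eigenvalues and normalization.* Evaluating the Gauss sums, the non-constant part of `E_χ` is
`∑_{j, m ≥ 1} j χ(j) χ⁻¹(m) q^{jm}` (`exists_eisChi_eq`), whence
`U_ℓ E_χ = (χ⁻¹(ℓ) + ℓ χ(ℓ)) E_χ - χ(ℓ) χ⁻¹(ℓ) E_χ | γ_ℓ` (`opU_eisChi`). An operator `[p]^±_χ` with
`p ≠ ℓ` commutes with `U_ℓ`, while those with `p = ℓ` remove one or both of the eigenvalues
`ℓ χ(ℓ)` and `χ⁻¹(ℓ)` (`HeckeEig.eulerOp_first`, `HeckeEig.eulerOp_second`). None of them changes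
the coefficient of `q`. Linear independence follows since the eigenvalues determine `(M, L, χ)`.

*Spanning.* Let `g` be an Eisenstein series for `Γ₀(N)`. Write `g` as a combination of the `φ_x` with
`x ∈ (n⁻¹ℤ/ℤ)²` and `N ∣ n`, and average over matrices of `Γ₀(N)` congruent to `diag(α, α⁻¹)` modulo
`n`: by orthogonality `g` becomes a combination of sums `∑ ψ(α) ψ(β) φ_{(aα/n, bβ/n)}`, with `ψ` a
character modulo `n`. Inverting over divisors (`charSum_mem`) and using the distribution relations
of `φ`, one finds that some `g | γ_t` is a combination of the functions `E_χ | γ_s`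
(`mem_eisVSat`). As `g` is invariant under translation, the operators `U_p` remove the factor `t`
(`mem_eisVSpan_of_periodic`), so `g` itself is such a combination. The functions `E_χ | γ_s` are
linearly independent, and `z ↦ -1 / z` exchanges `E_χ | γ_s` and `E_χ | γ_r` up to the factor
`f² s r` in the argument; the translation invariance of `(g | S) | γ_N` then forces `f² s ∣ N` for
each pair `(χ, s)` that occurs (`mem_span_eisV`).

For `N = DC` the condition `f² s ∣ DC` means `D = f D₀`, `C = f C₀` and `s ∣ D₀ C₀`, and a separate
computation at each prime of `D₀` rewrites `E_χ | γ_s` in terms of the `E_{M, L, χ}`, including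
the excluded `M = 1` (`opV_mem_eulerSpan`). The latter occurs only for `E_{1, D, 1}`, whose `1 / y`
term is not zero (`exists_eisMod_excluded`), so that it does not contribute to `g`.
-/

open scoped UpperHalfPlane ModularForm MatrixGroups

noncomputable section

namespace EisBasis

open Filter Topology UpperHalfPlane
open scoped Manifold

/-! ### Degeneracy operators and their relations -/

lemma upperMat_val {a d : ℕ} (b : ℕ) (ha : 0 < a) (hd : 0 < d) :
    (upperMat a b d).val = !![(a : ℝ), (b : ℝ); 0, (d : ℝ)] := by
  have h : (!![(a : ℝ), (b : ℝ); 0, (d : ℝ)]).det ≠ 0 := by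
    rw [Matrix.det_fin_two_of]
    have : (0 : ℝ) < a := by exact_mod_cast ha
    have : (0 : ℝ) < d := by exact_mod_cast hd
    nlinarith [mul_pos ‹(0 : ℝ) < a› ‹(0 : ℝ) < d›]
  rw [upperMat, dif_pos h]
  rfl

lemma upperMat_det {a d : ℕ} (b : ℕ) (ha : 0 < a) (hd : 0 < d) :
    (upperMat a b d).det.val = (a * d : ℝ) := by
  rw [Matrix.GeneralLinearGroup.val_det_apply, upperMat_val b ha hd, Matrix.det_fin_two_of]
  ring

lemma upperMat_det_pos (a b d : ℕ) : 0 < (upperMat a b d).det.val := by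
  by_cases h : 0 < a ∧ 0 < d
  · rw [upperMat_det b h.1 h.2]
    have : (0 : ℝ) < a := by exact_mod_cast h.1
    have : (0 : ℝ) < d := by exact_mod_cast h.2
    positivity
  · have h0 : ¬ (!![(a : ℝ), (b : ℝ); 0, (d : ℝ)]).det ≠ 0 := by
      rw [Matrix.det_fin_two_of]
      rcases Nat.eq_zero_or_pos a with h1 | h1
      · simp [h1]
      · have : d = 0 := by
          by_contra h2
          exact h ⟨h1, Nat.pos_of_ne_zero h2⟩
        simp [this]
    rw [upperMat, dif_neg h0]
    simp

lemma coe_upperMat_smul {a d : ℕ} (b : ℕ) (ha : 0 < a) (hd : 0 < d) (z : ℍ) :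
    ((upperMat a b d • z : ℍ) : ℂ) = (a * z + b) / d := by
  rw [UpperHalfPlane.coe_smul_of_det_pos (upperMat_det_pos a b d)]
  simp [UpperHalfPlane.num, UpperHalfPlane.denom, upperMat_val b ha hd]

lemma slash_upperMat_apply {a d : ℕ} (b : ℕ) (ha : 0 < a) (hd : 0 < d) (g : ℍ → ℂ) (z : ℍ) :
    (g ∣[(2 : ℤ)] upperMat a b d) z = (a / d : ℂ) * g (upperMat a b d • z) := by
  have hd' : (d : ℂ) ≠ 0 := by exact_mod_cast hd.ne'
  rw [ModularForm.slash_apply, upperMat_det b ha hd]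
  have h1 : UpperHalfPlane.denom (upperMat a b d) z = d := by
    simp [UpperHalfPlane.denom, upperMat_val b ha hd]
  have h2 : |(a * d : ℝ)| = a * d := abs_of_nonneg (by positivity)
  rw [h1, h2, UpperHalfPlane.σ, if_pos (upperMat_det_pos a b d)]
  simp
  field_simp

lemma smul_slash_of_det_pos {A : GL (Fin 2) ℝ} (hA : 0 < A.det.val) (c : ℂ) (g : ℍ → ℂ) :
    (c • g) ∣[(2 : ℤ)] A = c • (g ∣[(2 : ℤ)] A) := by
  rw [ModularForm.smul_slash, UpperHalfPlane.σ, if_pos hA]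
  rfl

/-- The slash action of a matrix of positive determinant, as a linear map. -/
def slashLin (A : GL (Fin 2) ℝ) (hA : 0 < A.det.val) : (ℍ → ℂ) →ₗ[ℂ] (ℍ → ℂ) where
  toFun g := g ∣[(2 : ℤ)] A
  map_add' _ _ := SlashAction.add_slash _ _ _ _
  map_smul' c g := smul_slash_of_det_pos hA c g

/-- The degeneracy operator `g ↦ g | (d, 0; 0, 1)`, that is `(V_d g)(z) = d g(d z)`. -/
def opV (d : ℕ) : (ℍ → ℂ) →ₗ[ℂ] (ℍ → ℂ) := slashLin (upperMat d 0 1) (upperMat_det_pos _ _ _)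

/-- The operator `U_ℓ`, that is `(U_ℓ g)(z) = ℓ⁻¹ ∑_{k < ℓ} g((z + k) / ℓ)`. -/
def opU (l : ℕ) : (ℍ → ℂ) →ₗ[ℂ] (ℍ → ℂ) :=
  ∑ k ∈ Finset.range l, slashLin (upperMat 1 k l) (upperMat_det_pos _ _ _)

lemma opV_def (d : ℕ) (g : ℍ → ℂ) : opV d g = g ∣[(2 : ℤ)] upperMat d 0 1 := rfl

lemma opU_def (l : ℕ) (g : ℍ → ℂ) :
    opU l g = ∑ k ∈ Finset.range l, g ∣[(2 : ℤ)] upperMat 1 k l := by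
  simp [opU, slashLin, LinearMap.sum_apply]

/-- The point `d z` of the upper half plane. -/
def dil (d : ℕ) (z : ℍ) : ℍ := upperMat d 0 1 • z

lemma coe_dil {d : ℕ} (hd : 0 < d) (z : ℍ) : (dil d z : ℂ) = d * z := by
  rw [dil, coe_upperMat_smul 0 hd one_pos]; simp

lemma im_dil {d : ℕ} (hd : 0 < d) (z : ℍ) : (dil d z).im = d * z.im := by
  have := congrArg Complex.im (coe_dil hd z)
  simpa using this

lemma opV_apply {d : ℕ} (hd : 0 < d) (g : ℍ → ℂ) (z : ℍ) : opV d g z = d * g (dil d z) := by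
  rw [opV_def, slash_upperMat_apply 0 hd one_pos]
  simp [dil]

lemma opU_apply {l : ℕ} (hl : 0 < l) (g : ℍ → ℂ) (z : ℍ) :
    opU l g z = (l : ℂ)⁻¹ * ∑ k ∈ Finset.range l, g (upperMat 1 k l • z) := by
  rw [opU_def, Finset.sum_apply, Finset.mul_sum]
  refine Finset.sum_congr rfl fun k _ => ?_
  rw [slash_upperMat_apply k one_pos hl]
  simp

lemma opV_one (g : ℍ → ℂ) : opV 1 g = g := by
  ext z
  rw [opV_apply one_pos]
  have : dil 1 z = z := by ext; simp [coe_dil]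
  simp [this]

lemma opV_opV {d e : ℕ} (hd : 0 < d) (he : 0 < e) (g : ℍ → ℂ) :
    opV d (opV e g) = opV (e * d) g := by
  ext z
  rw [opV_apply hd, opV_apply he, opV_apply (Nat.mul_pos he hd)]
  have : dil e (dil d z) = dil (e * d) z := by
    ext
    rw [coe_dil he, coe_dil hd, coe_dil (Nat.mul_pos he hd)]; push_cast; ring
  rw [this]; push_cast; ring

lemma opV_comm {d e : ℕ} (hd : 0 < d) (he : 0 < e) (g : ℍ → ℂ) :
    opV d (opV e g) = opV e (opV d g) := by
  rw [opV_opV hd he, opV_opV he hd, mul_comm]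

/-- Invariance under the translation `z ↦ z + 1`. -/
def IsPeriodic (g : ℍ → ℂ) : Prop := ∀ z w : ℍ, (w : ℂ) = z + 1 → g w = g z

lemma IsPeriodic.nat {g : ℍ → ℂ} (hg : IsPeriodic g) (n : ℕ) :
    ∀ z w : ℍ, (w : ℂ) = z + n → g w = g z := by
  induction n with
  | zero => intro z w h; congr 1; ext; simpa using h
  | succ n ih =>
    intro z w h
    have him : 0 < ((z : ℂ) + n).im := by simpa using z.im_pos
    rw [← ih z ⟨(z : ℂ) + n, him⟩ rfl]
    refine hg _ _ ?_
    rw [h]; push_cast; simp [add_assoc]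

lemma IsPeriodic.sub {g h : ℍ → ℂ} (hg : IsPeriodic g) (hh : IsPeriodic h) :
    IsPeriodic (g - h) := fun z w e => by simp [hg z w e, hh z w e]

lemma IsPeriodic.smul {g : ℍ → ℂ} (c : ℂ) (hg : IsPeriodic g) :
    IsPeriodic (c • g) := fun z w e => by simp [hg z w e]

lemma IsPeriodic.opV {g : ℍ → ℂ} (hg : IsPeriodic g) {d : ℕ} (hd : 0 < d) :
    IsPeriodic (opV d g) := fun z w e => by
  rw [opV_apply hd, opV_apply hd]
  congr 1
  refine hg.nat d _ _ ?_
  rw [coe_dil hd, coe_dil hd, e]; ring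

lemma opU_opV_self {l : ℕ} (hl : 0 < l) {g : ℍ → ℂ} (hg : IsPeriodic g) :
    opU l (opV l g) = (l : ℂ) • g := by
  ext z
  have hl' : (l : ℂ) ≠ 0 := by exact_mod_cast hl.ne'
  rw [opU_apply hl]
  have : ∀ k ∈ Finset.range l, opV l g (upperMat 1 k l • z) = l * g z := by
    intro k _
    rw [opV_apply hl]
    congr 1
    refine hg.nat k _ _ ?_
    rw [coe_dil hl, coe_upperMat_smul k one_pos hl]
    field_simp; simp
  rw [Finset.sum_congr rfl this]
  simp
  field_simp

lemma opU_opV_of_coprime {l p : ℕ} (hl : 0 < l) (hp : 0 < p) (h : Nat.Coprime l p) {g : ℍ → ℂ}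
    (hg : IsPeriodic g) : opU l (opV p g) = opV p (opU l g) := by
  ext z
  have hl' : (l : ℂ) ≠ 0 := by exact_mod_cast hl.ne'
  rw [opU_apply hl, opV_apply hp, opU_apply hl, mul_left_comm]
  congr 1
  rw [Finset.mul_sum]
  -- multiplication by `p` permutes the residues modulo `l`
  refine Finset.sum_bij' (fun k _ => (p * k) % l)
    (fun k _ => ((((ZMod.unitOfCoprime p h.symm)⁻¹ : (ZMod l)ˣ) : ZMod l) * (k : ZMod l)).val)
    ?_ ?_ ?_ ?_ ?_
  · intro k _
    exact Finset.mem_range.2 (Nat.mod_lt _ hl)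
  · intro k _
    have : NeZero l := ⟨hl.ne'⟩
    exact Finset.mem_range.2 (ZMod.val_lt _)
  · intro k hk
    have : NeZero l := ⟨hl.ne'⟩
    have : (((p * k) % l : ℕ) : ZMod l) = (ZMod.unitOfCoprime p h.symm : ZMod l) * k := by
      simp
    simp only [this, ← mul_assoc, Units.inv_mul, one_mul]
    rw [ZMod.val_natCast, Nat.mod_eq_of_lt (Finset.mem_range.1 hk)]
  · intro k hk
    have : NeZero l := ⟨hl.ne'⟩
    rw [← Nat.mod_eq_of_lt (Finset.mem_range.1 hk), ← ZMod.val_natCast, ← ZMod.val_natCast]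
    congr 1
    rw [Nat.cast_mul, ZMod.natCast_zmod_val, ← mul_assoc]
    have : (p : ZMod l) = (ZMod.unitOfCoprime p h.symm : ZMod l) := by simp
    rw [this, Units.mul_inv, one_mul]; simp
  · intro k _
    rw [opV_apply hp]
    congr 1
    refine hg.nat (p * k / l) _ _ ?_
    rw [coe_dil hp, coe_upperMat_smul k one_pos hl, coe_upperMat_smul _ one_pos hl, coe_dil hp]
    have h3 : (p * k : ℂ) = l * ((p * k / l : ℕ) : ℂ) + ((p * k % l : ℕ) : ℂ) := by
      exact_mod_cast (Nat.div_add_mod (p * k) l).symm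
    field_simp
    linear_combination h3

lemma heckeT_eq (N l : ℕ) (g : ℍ → ℂ) :
    heckeT N l g = opU l g + if l ∣ N then 0 else opV l g := by
  rw [heckeT, opU_def]
  split_ifs <;> rfl

/-- The Hecke operator `T_ℓ` of level `Γ₀(N)` as a linear map. -/
def heckeLin (N l : ℕ) : (ℍ → ℂ) →ₗ[ℂ] (ℍ → ℂ) := opU l + if l ∣ N then 0 else opV l

lemma heckeLin_apply (N l : ℕ) (g : ℍ → ℂ) : heckeLin N l g = heckeT N l g := by
  rw [heckeT_eq, heckeLin]
  split_ifs <;> rfl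

/-- Eigenvectors of a family of operators whose systems of eigenvalues are pairwise distinct
are independent, in the strong form that allows zero vectors. -/
lemma eq_zero_of_sum_eigenvectors_eq_zero {V ι κ : Type*} [AddCommGroup V] [Module ℂ V]
    (T : κ → V →ₗ[ℂ] V) (ev : ι → κ → ℂ) (s : Finset ι) (v : ι → V)
    (hv : ∀ i ∈ s, ∀ k, T k (v i) = ev i k • v i)
    (hsep : ∀ i ∈ s, ∀ j ∈ s, i ≠ j → ∃ k, ev i k ≠ ev j k)
    (hsum : ∑ i ∈ s, v i = 0) : ∀ i ∈ s, v i = 0 := by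
  classical
  induction s using Finset.induction_on generalizing v with
  | empty => simp
  | insert a s ha ih =>
    -- every other component dies under a suitable `T k - ev a k`, and these differences
    -- kill `v a`
    have key : ∀ i ∈ s, v i = 0 := by
      intro i hi
      obtain ⟨k, hk⟩ := hsep i (Finset.mem_insert_of_mem hi) a (Finset.mem_insert_self _ _)
        (by rintro rfl; exact ha hi)
      have h1 : ∑ j ∈ s, (ev j k - ev a k) • v j = 0 := by
        have h2 : T k (∑ j ∈ insert a s, v j) - ev a k • ∑ j ∈ insert a s, v j = 0 := by
          rw [hsum]; simp
        rw [map_sum, Finset.smul_sum, ← Finset.sum_sub_distrib, Finset.sum_insert ha,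
          hv a (Finset.mem_insert_self _ _), sub_self, zero_add] at h2
        rw [← h2]
        refine Finset.sum_congr rfl fun j hj => ?_
        rw [hv j (Finset.mem_insert_of_mem hj), sub_smul]
      have h3 := ih (fun j => (ev j k - ev a k) • v j)
        (fun j hj k' => by
          rw [map_smul, hv j (Finset.mem_insert_of_mem hj), smul_comm])
        (fun j hj j' hj' hne =>
          hsep j (Finset.mem_insert_of_mem hj) j' (Finset.mem_insert_of_mem hj') hne)
        h1 i hi
      exact (smul_eq_zero.1 h3).resolve_left (sub_ne_zero.2 hk)
    intro i hi
    rcases Finset.mem_insert.1 hi with rfl | hi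
    · rw [Finset.sum_insert ha, Finset.sum_eq_zero key, add_zero] at hsum
      exact hsum
    · exact key i hi

/-! ### Double exponential series -/

/-- The additive character `t ↦ exp(2πit)` of `ℂ`. -/
def ee (t : ℂ) : ℂ := Complex.exp (2 * Real.pi * Complex.I * t)

lemma ee_add (s t : ℂ) : ee (s + t) = ee s * ee t := by
  rw [ee, ee, ee, ← Complex.exp_add]; congr 1; ring

lemma ee_zero : ee 0 = 1 := by simp [ee]

lemma ee_neg (t : ℂ) : ee (-t) = (ee t)⁻¹ := by
  rw [ee, ee, ← Complex.exp_neg]; congr 1; ring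

lemma ee_ne_zero (t : ℂ) : ee t ≠ 0 := Complex.exp_ne_zero _

lemma ee_int (n : ℤ) : ee n = 1 := by
  rw [ee, Complex.exp_eq_one_iff]; exact ⟨n, by ring⟩

lemma ee_nat_mul (n : ℕ) (t : ℂ) : ee (n * t) = ee t ^ n := by
  rw [ee, ee, ← Complex.exp_nat_mul]; congr 1; ring

lemma norm_ee (t : ℂ) : ‖ee t‖ = Real.exp (-2 * Real.pi * t.im) := by
  rw [ee, Complex.norm_exp]; congr 1; simp

lemma norm_ee_ofReal (t : ℝ) : ‖ee t‖ = 1 := by simp [norm_ee]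

lemma ee_eq_one_iff (t : ℂ) : ee t = 1 ↔ ∃ n : ℤ, t = n := by
  rw [ee, Complex.exp_eq_one_iff]
  have h : (2 * Real.pi * Complex.I : ℂ) ≠ 0 := Complex.two_pi_I_ne_zero
  constructor
  · rintro ⟨n, hn⟩
    refine ⟨n, ?_⟩
    rw [mul_comm (n : ℂ)] at hn
    exact mul_left_cancel₀ h hn
  · rintro ⟨n, rfl⟩
    exact ⟨n, by ring⟩

/-- Orthogonality of the characters of `ℤ/d`. -/
lemma sum_range_ee {d : ℕ} (hd : 0 < d) (m : ℤ) :
    ∑ i ∈ Finset.range d, ee (m * i / d) = if (d : ℤ) ∣ m then (d : ℂ) else 0 := by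
  have hd' : (d : ℂ) ≠ 0 := by exact_mod_cast hd.ne'
  have h1 : ∀ i ∈ Finset.range d, ee (m * i / d) = ee (m / d) ^ i := fun i _ => by
    rw [← ee_nat_mul]; congr 1; ring
  rw [Finset.sum_congr rfl h1]
  split_ifs with h
  · obtain ⟨k, rfl⟩ := h
    have : ee (((d * k : ℤ) : ℂ) / d) = 1 := by
      rw [ee_eq_one_iff]; exact ⟨k, by push_cast; field_simp⟩
    simp only [this, one_pow, Finset.sum_const, Finset.card_range, nsmul_eq_mul, mul_one]
  · have hne : ee ((m : ℂ) / d) ≠ 1 := by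
      intro h2
      obtain ⟨k, hk⟩ := (ee_eq_one_iff _).1 h2
      refine h ⟨k, ?_⟩
      rw [div_eq_iff hd'] at hk
      have : (m : ℂ) = ((d * k : ℤ) : ℂ) := by rw [hk]; push_cast; ring
      exact_mod_cast this
    have h3 : ee ((m : ℂ) / d) ^ d = 1 := by
      rw [← ee_nat_mul, ee_eq_one_iff]; exact ⟨m, by field_simp⟩
    rw [geom_sum_eq hne, h3]; simp

section DoubleSeries

variable {c : ℕ+ × ℕ+ → ℂ} {C : ℝ} {n : ℕ}

/-- Majorant of the terms of the double series with linearly bounded coefficients. -/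
lemma summable_majorant (C : ℝ) {r : ℝ} (h0 : 0 ≤ r) (h1 : r < 1) :
    Summable fun p : ℕ+ × ℕ+ => C * p.1 * r ^ (p.1 * p.2 : ℕ) := by
  have h := summable_prod_mul_pow 1 (r := r) (by rwa [Real.norm_of_nonneg h0])
  have h2 := (h.prod_symm).mul_left C
  refine h2.congr fun p => ?_
  simp [mul_assoc, mul_comm (p.2 : ℕ)]

lemma norm_ee_term (n : ℕ) (z : ℂ) (p : ℕ+ × ℕ+) :
    ‖ee (p.1 * p.2 * z / n)‖ = Real.exp (-2 * Real.pi * z.im / n) ^ (p.1 * p.2 : ℕ) := by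
  have : ((p.1 : ℂ) * p.2 * z / n) = ((p.1 * p.2 : ℕ) : ℂ) * (z / n) := by push_cast; ring
  rw [this, ee_nat_mul, norm_pow, norm_ee]
  congr 2
  have : (z / (n : ℂ)).im = z.im / n := by
    rw [show (n : ℂ) = ((n : ℝ) : ℂ) by simp, Complex.div_ofReal_im]
  rw [this]; ring

lemma exp_lt_one_of_pos (hn : 0 < n) {y : ℝ} (hy : 0 < y) :
    Real.exp (-2 * Real.pi * y / n) < 1 := by
  rw [Real.exp_lt_one_iff]
  have : (0 : ℝ) < n := by exact_mod_cast hn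
  have := Real.pi_pos
  rw [div_lt_iff₀ ‹_›]; nlinarith [mul_pos this hy]

lemma norm_dser_term_le (hc : ∀ p, ‖c p‖ ≤ C * p.1) {ε : ℝ} {z : ℂ} (hz : ε ≤ z.im)
    (p : ℕ+ × ℕ+) : ‖c p * ee (p.1 * p.2 * z / n)‖ ≤
      C * p.1 * Real.exp (-2 * Real.pi * ε / n) ^ (p.1 * p.2 : ℕ) := by
  rw [norm_mul, norm_ee_term]
  have := Real.pi_pos
  refine mul_le_mul (hc p) ?_ (by positivity) ((norm_nonneg _).trans (hc p))
  gcongr ?_ ^ _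
  rw [Real.exp_le_exp]
  gcongr ?_ / _
  nlinarith

lemma dser_summable (hc : ∀ p, ‖c p‖ ≤ C * p.1) (hn : 0 < n) (z : ℍ) :
    Summable fun p : ℕ+ × ℕ+ => c p * ee (p.1 * p.2 * z / n) :=
  Summable.of_norm_bounded (summable_majorant C (Real.exp_nonneg _) (exp_lt_one_of_pos hn z.im_pos))
    fun p => norm_dser_term_le hc le_rfl p

/-- As `Im z → ∞` the term of index `(1, 1)` dominates. -/
lemma dser_lead (hc : ∀ p, ‖c p‖ ≤ C * p.1) (hn : 0 < n) :
    Tendsto (fun z : ℍ => (∑' p : ℕ+ × ℕ+, c p * ee (p.1 * p.2 * z / n)) * ee (-(z / n)))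
      atImInfty (𝓝 (c (1, 1))) := by
  have hn' : (0 : ℝ) < n := by exact_mod_cast hn
  set r := Real.exp (-2 * Real.pi * 1 / n) with hr
  have hr1 : r < 1 := exp_lt_one_of_pos hn one_pos
  have hr0 : 0 < r := Real.exp_pos _
  have hlim : ∑' p : ℕ+ × ℕ+, (if p = (1, 1) then c (1, 1) else 0) = c (1, 1) := by
    rw [tsum_ite_eq]
  simp_rw [← tsum_mul_right]
  rw [← hlim]
  have hterm : ∀ (p : ℕ+ × ℕ+) (z : ℍ), c p * ee (p.1 * p.2 * z / n) * ee (-(z / n)) =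
      c p * ee (((p.1 * p.2 - 1 : ℕ) : ℂ) * (z / n)) := by
    intro p z
    have h1 : 1 ≤ (p.1 * p.2 : ℕ) := Nat.mul_pos p.1.pos p.2.pos
    rw [mul_assoc, ← ee_add]
    congr 2
    push_cast [Nat.cast_sub h1]; ring
  have hnorm : ∀ z : ℍ, ‖ee ((z : ℂ) / n)‖ = Real.exp (-2 * Real.pi * z.im / n) := by
    intro z
    have := norm_ee_term n z (1, 1)
    simpa using this
  refine tendsto_tsum_of_dominated_convergence
    (bound := fun p : ℕ+ × ℕ+ => (C / r) * p.1 * r ^ (p.1 * p.2 : ℕ))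
    (summable_majorant _ hr0.le hr1) ?_ ?_
  · intro p
    by_cases hp : p = (1, 1)
    · subst hp
      refine tendsto_const_nhds.congr fun z => ?_
      rw [hterm]; simp [ee_zero]
    · rw [if_neg hp]
      have h2 : (p.1 * p.2 - 1 : ℕ) ≠ 0 := by
        intro h
        have h1 : 1 ≤ (p.1 * p.2 : ℕ) := Nat.mul_pos p.1.pos p.2.pos
        have h3 : (p.1 * p.2 : ℕ) = 1 := by omega
        obtain ⟨h4, h5⟩ := mul_eq_one.1 h3
        exact hp (Prod.ext (PNat.coe_injective h4) (PNat.coe_injective h5))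
      have h3 : Tendsto (fun z : ℍ => ee ((z : ℂ) / n)) atImInfty (𝓝 0) := by
        rw [tendsto_zero_iff_norm_tendsto_zero]
        simp_rw [hnorm]
        refine Real.tendsto_exp_atBot.comp ?_
        have h4 : Tendsto (fun z : ℍ => z.im) atImInfty atTop := tendsto_comap
        have h5 : (fun z : ℍ => -2 * Real.pi * z.im / n) =
            fun z : ℍ => (-2 * Real.pi / n) * z.im := by ext; ring
        rw [h5]
        refine h4.const_mul_atTop_of_neg ?_
        have := Real.pi_pos
        apply div_neg_of_neg_of_pos <;> linarith
      have h4 := (h3.pow (p.1 * p.2 - 1)).const_mul (c p)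
      rw [zero_pow h2, mul_zero] at h4
      refine h4.congr fun z => ?_
      rw [hterm, ee_nat_mul]
  · have h6 : ∀ᶠ z : ℍ in atImInfty, 1 ≤ z.im :=
      (tendsto_comap : Tendsto (fun z : ℍ => z.im) atImInfty atTop).eventually_ge_atTop 1
    filter_upwards [h6] with z hz p
    have h1 : 1 ≤ (p.1 * p.2 : ℕ) := Nat.mul_pos p.1.pos p.2.pos
    rw [hterm, ee_nat_mul, norm_mul, norm_pow, hnorm]
    have h7 : Real.exp (-2 * Real.pi * z.im / n) ≤ r := by
      rw [hr, Real.exp_le_exp]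
      have := Real.pi_pos
      gcongr ?_ / _
      nlinarith
    calc ‖c p‖ * Real.exp (-2 * Real.pi * z.im / n) ^ (p.1 * p.2 - 1 : ℕ)
        ≤ (C * p.1) * r ^ (p.1 * p.2 - 1 : ℕ) :=
          mul_le_mul (hc p) (pow_le_pow_left₀ (Real.exp_nonneg _) h7 _) (by positivity)
            ((norm_nonneg _).trans (hc p))
      _ = (C / r) * p.1 * r ^ (p.1 * p.2 : ℕ) := by
          obtain ⟨k, hk⟩ := Nat.exists_eq_add_of_le h1
          rw [hk, Nat.add_sub_cancel_left, pow_add, pow_one]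
          field_simp

lemma tendsto_im_mul_ee (hn : 0 < n) :
    Tendsto (fun z : ℍ => (z.im : ℂ) * ee ((z : ℂ) / n)) atImInfty (𝓝 0) := by
  have hn' : (0 : ℝ) < n := by exact_mod_cast hn
  rw [tendsto_zero_iff_norm_tendsto_zero]
  have h4 : Tendsto (fun z : ℍ => z.im) atImInfty atTop := tendsto_comap
  have hb : 0 < 2 * Real.pi / n := div_pos Real.two_pi_pos hn'
  have h := (tendsto_rpow_mul_exp_neg_mul_atTop_nhds_zero 1 _ hb).comp h4
  refine h.congr fun z => ?_
  have := norm_ee_term n z (1, 1)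
  simp only [PNat.val_ofNat, Nat.cast_one, mul_one, one_mul, pow_one] at this
  rw [norm_mul, this, Complex.norm_real, Real.norm_of_nonneg z.im_pos.le]
  simp only [Function.comp, Real.rpow_one]
  congr 2; rw [UpperHalfPlane.coe_im]; ring

lemma tendsto_im_mul_dser (hc : ∀ p, ‖c p‖ ≤ C * p.1) (hn : 0 < n) :
    Tendsto (fun z : ℍ => (z.im : ℂ) * ∑' p : ℕ+ × ℕ+, c p * ee (p.1 * p.2 * z / n))
      atImInfty (𝓝 0) := by
  have h := (tendsto_im_mul_ee hn).mul (dser_lead hc hn)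
  rw [zero_mul] at h
  refine h.congr fun z => ?_
  rw [ee_neg]
  have := ee_ne_zero ((z : ℂ) / n)
  field_simp

lemma mdifferentiable_dser (hc : ∀ p, ‖c p‖ ≤ C * p.1) (hn : 0 < n) :
    MDiff (fun z : ℍ => ∑' p : ℕ+ × ℕ+, c p * ee (p.1 * p.2 * z / n)) := by
  rw [UpperHalfPlane.mdifferentiable_iff]
  have key : DifferentiableOn ℂ (fun z : ℂ => ∑' p : ℕ+ × ℕ+, c p * ee (p.1 * p.2 * z / n))
      {z | 0 < z.im} := by
    intro z hz
    have hz' : (0 : ℝ) < z.im / 2 := half_pos hz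
    have ho : IsOpen {w : ℂ | z.im / 2 < w.im} :=
      isOpen_lt continuous_const Complex.continuous_im
    refine DifferentiableAt.differentiableWithinAt ?_
    refine DifferentiableOn.differentiableAt (s := {w : ℂ | z.im / 2 < w.im}) ?_
      (ho.mem_nhds (by simpa using hz))
    refine Complex.differentiableOn_tsum_of_summable_norm
      (summable_majorant C (Real.exp_nonneg _) (exp_lt_one_of_pos hn hz')) ?_ ho ?_
    · intro p
      unfold ee
      fun_prop
    · intro p w hw
      exact norm_dser_term_le hc (le_of_lt hw) p
  refine key.congr fun z hz => ?_
  simp only [Function.comp_apply, UpperHalfPlane.ofComplex_apply_of_im_pos hz]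

end DoubleSeries

/-! ### Expansions and elementary properties of Hecke's functions -/

lemma heckeP_eq (x₁ x₂ : ℚ) (z : ℍ) : heckeP x₁ x₂ z =
    ∑' k : {k : ℚ // 0 < k ∧ ∃ n : ℤ, k = x₁ + n}, ∑' m : ℕ+,
      ((k : ℚ) : ℂ) * ee ((m : ℂ) * (((k : ℚ) : ℂ) * (z : ℂ) + (x₂ : ℂ))) := by
  rw [heckeP]
  refine tsum_congr fun k => ?_
  rw [tsum_mul_left]
  congr 1
  refine tsum_congr fun m => ?_
  rw [ee, mul_assoc]

open scoped Classical in
/-- The coefficients of the expansion of `P_{(a/n, x₂)}` as a double series. -/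
def heckeCoeff (n : ℕ) (a : ℤ) (x₂ : ℚ) (p : ℕ+ × ℕ+) : ℂ :=
  if (n : ℤ) ∣ (p.1 : ℤ) - a then (p.1 / n : ℂ) * ee (p.2 * x₂) else 0

lemma norm_heckeCoeff_le {n : ℕ} (hn : 0 < n) (a : ℤ) (x₂ : ℚ) (p : ℕ+ × ℕ+) :
    ‖heckeCoeff n a x₂ p‖ ≤ 1 * p.1 := by
  have hn' : (1 : ℝ) ≤ n := by exact_mod_cast hn
  rw [heckeCoeff]
  split_ifs
  · have : ((p.2 : ℂ) * x₂) = (((p.2 : ℕ) * (x₂ : ℝ) : ℝ) : ℂ) := by push_cast; ring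
    rw [norm_mul, this, norm_ee_ofReal, mul_one, one_mul, norm_div, Complex.norm_natCast,
      Complex.norm_natCast]
    exact div_le_self (Nat.cast_nonneg _) hn'
  · simp

/-- `P_{(a/n, x₂)}` as an absolutely convergent double series. -/
lemma heckeP_eq_tsum {n : ℕ} (hn : 0 < n) (a : ℤ) (x₂ : ℚ) (z : ℍ) :
    heckeP (a / n) x₂ z = ∑' p : ℕ+ × ℕ+, heckeCoeff n a x₂ p * ee (p.1 * p.2 * z / n) := by
  have hn' : (n : ℚ) ≠ 0 := by exact_mod_cast hn.ne'
  have hn0 : (0 : ℚ) < n := by exact_mod_cast hn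
  have hnC : (n : ℂ) ≠ 0 := by exact_mod_cast hn.ne'
  rw [heckeP_eq, (dser_summable (norm_heckeCoeff_le hn a x₂) hn z).tsum_prod]
  -- the numerators `n k` of the rational numbers `k > 0`, `k ≡ a / n`
  have hint : ∀ k : {k : ℚ // 0 < k ∧ ∃ m : ℤ, k = a / n + m},
      ∃ j : ℕ+, ((j : ℕ) : ℚ) = k.1 * n ∧ (n : ℤ) ∣ (j : ℤ) - a := by
    rintro ⟨k, hk, m, hm⟩
    have h1 : k * n = ((a + m * n : ℤ) : ℚ) := by rw [hm]; push_cast; field_simp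
    have h2 : 0 < a + m * n := by
      have : 0 < k * n := mul_pos hk hn0
      rw [h1] at this; exact_mod_cast this
    refine ⟨⟨(a + m * n).toNat, by omega⟩, ?_, ?_⟩
    · rw [h1]
      have : (((a + m * n).toNat : ℤ) : ℚ) = ((a + m * n : ℤ) : ℚ) := by
        rw [Int.toNat_of_nonneg h2.le]
      exact_mod_cast this
    · rw [PNat.mk_coe, Int.toNat_of_nonneg h2.le]
      exact ⟨m, by ring⟩
  choose num hnum hdvd using hint
  have hinj : Function.Injective num := by
    intro k k' h
    have h1 := hnum k
    rw [h, hnum k'] at h1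
    exact Subtype.ext (mul_right_cancel₀ hn' h1.symm)
  rw [← hinj.tsum_eq]
  · refine tsum_congr fun k => tsum_congr fun m => ?_
    have h1 : ((num k : ℕ) : ℂ) = ((k.1 : ℚ) : ℂ) * n := by exact_mod_cast hnum k
    rw [heckeCoeff, if_pos (hdvd k), mul_assoc, ← ee_add, h1]
    congr 1
    · field_simp
    · congr 1; field_simp; ring
  · intro j hj
    have hd : (n : ℤ) ∣ (j : ℤ) - a := by
      by_contra h
      refine hj ?_
      simp only [heckeCoeff, if_neg h, zero_mul, tsum_zero]
    obtain ⟨m, hm⟩ := hd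
    have hj0 : (0 : ℚ) < (j : ℕ) := by exact_mod_cast j.pos
    refine ⟨⟨(j : ℕ) / n, div_pos hj0 hn0, m, ?_⟩, ?_⟩
    · have : ((j : ℤ) : ℚ) = a + n * m := by
        rw [show (j : ℤ) = a + n * m by linarith]; push_cast; ring
      rw [show ((j : ℕ) : ℚ) = ((j : ℤ) : ℚ) by push_cast; rfl, this]
      field_simp
    · refine PNat.coe_injective ?_
      have := hnum ⟨(j : ℕ) / n, div_pos hj0 hn0, m, by
        have : ((j : ℤ) : ℚ) = a + n * m := by
          rw [show (j : ℤ) = a + n * m by linarith]; push_cast; ring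
        rw [show ((j : ℕ) : ℚ) = ((j : ℤ) : ℚ) by push_cast; rfl, this]
        field_simp⟩
      rw [div_mul_cancel₀ _ hn'] at this
      exact_mod_cast this

lemma rat_eq_div (x : ℚ) : x = (x.num : ℚ) / (x.den : ℕ) := (Rat.num_div_den x).symm

lemma heckeP_add_int_left (x₁ x₂ : ℚ) (k : ℤ) : heckeP (x₁ + k) x₂ = heckeP x₁ x₂ := by
  ext z
  have hn : 0 < x₁.den := x₁.den_pos
  have hn' : (x₁.den : ℚ) ≠ 0 := by exact_mod_cast hn.ne'
  have h1 : x₁ + k = ((x₁.num + k * x₁.den : ℤ) : ℚ) / (x₁.den : ℕ) := by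
    conv_lhs => rw [rat_eq_div x₁]
    push_cast; field_simp
  rw [h1]
  conv_rhs => rw [rat_eq_div x₁]
  rw [heckeP_eq_tsum hn, heckeP_eq_tsum hn]
  refine tsum_congr fun p => ?_
  have : (x₁.den : ℤ) ∣ (p.1 : ℤ) - (x₁.num + k * x₁.den) ↔ (x₁.den : ℤ) ∣ (p.1 : ℤ) - x₁.num := by
    rw [← sub_sub]
    exact dvd_sub_left (dvd_mul_left _ _)
  simp only [heckeCoeff, this]

lemma heckeP_add_int_right (x₁ x₂ : ℚ) (k : ℤ) : heckeP x₁ (x₂ + k) = heckeP x₁ x₂ := by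
  ext z
  rw [heckeP_eq, heckeP_eq]
  refine tsum_congr fun j => tsum_congr fun m => ?_
  congr 1
  have : ((m : ℂ) * (((j : ℚ) : ℂ) * (z : ℂ) + ((x₂ + k : ℚ) : ℂ))) =
      (m : ℂ) * (((j : ℚ) : ℂ) * (z : ℂ) + (x₂ : ℂ)) + ((m * k : ℤ) : ℂ) := by
    push_cast; ring
  rw [this, ee_add, ee_int, mul_one]

lemma isIntegral_add_int (x₁ x₂ : ℚ) (k l : ℤ) :
    IsIntegral (x₁ + k) (x₂ + l) ↔ IsIntegral x₁ x₂ := by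
  have h : ∀ (x : ℚ) (k : ℤ), (∃ n : ℤ, x + k = n) ↔ ∃ n : ℤ, x = n := fun x k =>
    ⟨fun ⟨n, hn⟩ => ⟨n - k, by push_cast; linarith⟩, fun ⟨n, hn⟩ => ⟨n + k, by push_cast; linarith⟩⟩
  rw [IsIntegral, IsIntegral, h, h]

lemma isIntegral_neg (x₁ x₂ : ℚ) : IsIntegral (-x₁) (-x₂) ↔ IsIntegral x₁ x₂ := by
  have h : ∀ x : ℚ, (∃ n : ℤ, -x = n) ↔ ∃ n : ℤ, x = n := fun x =>
    ⟨fun ⟨n, hn⟩ => ⟨-n, by push_cast; linarith⟩, fun ⟨n, hn⟩ => ⟨-n, by push_cast; linarith⟩⟩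
  rw [IsIntegral, IsIntegral, h, h]

lemma bernoulliTwo_neg (t : ℚ) : bernoulliTwo (-t) = bernoulliTwo t := by
  rw [bernoulliTwo, bernoulliTwo]
  by_cases h : Int.fract t = 0
  · rw [Int.fract_neg_eq_zero.2 h, h]
  · rw [Int.fract_neg h]; ring

lemma two_I_im (z : ℍ) : (z : ℂ) - (starRingEnd ℂ) (z : ℂ) = 2 * Complex.I * z.im := by
  rw [Complex.sub_conj]; push_cast; rw [UpperHalfPlane.coe_im]; ring

lemma nonhol_term (z : ℍ) :
    Complex.I / (2 * Real.pi * ((z : ℂ) - (starRingEnd ℂ) (z : ℂ))) = 1 / (4 * Real.pi * z.im) := by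
  have h1 : (z.im : ℂ) ≠ 0 := by exact_mod_cast z.im_ne_zero
  have h2 : (Real.pi : ℂ) ≠ 0 := by exact_mod_cast Real.pi_ne_zero
  have h3 := Complex.I_ne_zero
  rw [two_I_im]; field_simp; norm_num

open scoped Classical in
/-- The indicator function of `x = 0` in `(ℚ/ℤ)²`. -/
def intDelta (x₁ x₂ : ℚ) : ℂ := if IsIntegral x₁ x₂ then 1 else 0

lemma intDelta_of_isIntegral {x₁ x₂ : ℚ} (h : IsIntegral x₁ x₂) : intDelta x₁ x₂ = 1 := if_pos h

lemma intDelta_of_not {x₁ x₂ : ℚ} (h : ¬ IsIntegral x₁ x₂) : intDelta x₁ x₂ = 0 := if_neg h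

lemma intDelta_congr {x₁ x₂ y₁ y₂ : ℚ} (h : IsIntegral x₁ x₂ ↔ IsIntegral y₁ y₂) :
    intDelta x₁ x₂ = intDelta y₁ y₂ := by
  by_cases hx : IsIntegral x₁ x₂
  · rw [intDelta_of_isIntegral hx, intDelta_of_isIntegral (h.1 hx)]
  · rw [intDelta_of_not hx, intDelta_of_not (fun hy => hx (h.2 hy))]

lemma heckePhi_apply (x₁ x₂ : ℚ) (z : ℍ) : heckePhi x₁ x₂ z =
    ((bernoulliTwo x₁ : ℚ) : ℂ) / 2 - heckeP x₁ x₂ z - heckeP (-x₁) (-x₂) z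
      - intDelta x₁ x₂ * (1 / (4 * Real.pi * z.im)) := by
  rw [heckePhi, nonhol_term, intDelta]
  congr 1
  split_ifs
  · rw [one_mul]
  · rw [zero_mul]

/-- `φ_x` depends only on the class of `x` modulo `ℤ²`. -/
lemma heckePhi_add_int (x₁ x₂ : ℚ) (k l : ℤ) : heckePhi (x₁ + k) (x₂ + l) = heckePhi x₁ x₂ := by
  ext z
  have h1 : -(x₁ + k) = -x₁ + ((-k : ℤ) : ℚ) := by push_cast; ring
  have h2 : -(x₂ + l) = -x₂ + ((-l : ℤ) : ℚ) := by push_cast; ring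
  have h3 : bernoulliTwo (x₁ + k) = bernoulliTwo x₁ := by simp [bernoulliTwo]
  simp only [heckePhi_apply, h1, h2, heckeP_add_int_left, heckeP_add_int_right, h3,
    intDelta_congr (isIntegral_add_int x₁ x₂ k l)]

lemma heckePhi_neg (x₁ x₂ : ℚ) : heckePhi (-x₁) (-x₂) = heckePhi x₁ x₂ := by
  ext z
  simp only [heckePhi_apply, neg_neg, bernoulliTwo_neg, intDelta_congr (isIntegral_neg x₁ x₂)]
  ring

lemma heckeP_vadd_one (x₁ x₂ : ℚ) (z w : ℍ) (h : (w : ℂ) = z + 1) :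
    heckeP x₁ x₂ w = heckeP x₁ (x₁ + x₂) z := by
  rw [heckeP_eq, heckeP_eq]
  refine tsum_congr fun k => tsum_congr fun m => ?_
  congr 1
  obtain ⟨k, hk, n, rfl⟩ := k
  have : ((m : ℂ) * (((x₁ + n : ℚ) : ℂ) * (w : ℂ) + (x₂ : ℂ))) =
      (m : ℂ) * (((x₁ + n : ℚ) : ℂ) * (z : ℂ) + ((x₁ + x₂ : ℚ) : ℂ)) + ((m * n : ℤ) : ℂ) := by
    rw [h]; push_cast; ring
  rw [this, ee_add, ee_int, mul_one]

/-- The transformation of `φ_x` under translation. -/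
lemma heckePhi_vadd_one (x₁ x₂ : ℚ) (z w : ℍ) (h : (w : ℂ) = z + 1) :
    heckePhi x₁ x₂ w = heckePhi x₁ (x₁ + x₂) z := by
  have h1 : IsIntegral x₁ (x₁ + x₂) ↔ IsIntegral x₁ x₂ := by
    constructor
    · rintro ⟨⟨n, rfl⟩, m, hm⟩
      exact ⟨⟨n, rfl⟩, m - n, by push_cast; linarith⟩
    · rintro ⟨⟨n, rfl⟩, m, hm⟩
      exact ⟨⟨n, rfl⟩, n + m, by push_cast; linarith⟩
  have h2 : w.im = z.im := by simpa using congrArg Complex.im h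
  have h3 : -(x₁ + x₂) = -x₁ + -x₂ := by ring
  rw [heckePhi_apply, heckePhi_apply, heckeP_vadd_one _ _ z w h, heckeP_vadd_one _ _ z w h, h3, h2,
    intDelta_congr h1]

/-- Summing `P_x` over the `d`-division points of the second coordinate. -/
lemma sum_heckeP_division {d : ℕ} (hd : 0 < d) (x₁ x₂ : ℚ) (s : ℤ) (hs : s.natAbs = 1) (z : ℍ) :
    ∑ i ∈ Finset.range d, heckeP x₁ ((x₂ + s * i) / d) z = d * heckeP x₁ x₂ (dil d z) := by
  have hd' : (d : ℂ) ≠ 0 := by exact_mod_cast hd.ne'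
  have hn : 0 < x₁.den := x₁.den_pos
  have hnC : (x₁.den : ℂ) ≠ 0 := by exact_mod_cast hn.ne'
  rw [rat_eq_div x₁]
  simp_rw [heckeP_eq_tsum hn]
  set n := x₁.den
  set a := x₁.num
  rw [← Summable.tsum_finsetSum fun i _ => dser_summable (norm_heckeCoeff_le hn _ _) hn z,
    ← tsum_mul_left]
  let φ : ℕ+ × ℕ+ → ℕ+ × ℕ+ := fun p => (p.1, ⟨d * p.2, Nat.mul_pos hd p.2.pos⟩)
  have hφ : Function.Injective φ := by
    rintro ⟨p, q⟩ ⟨p', q'⟩ h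
    have h1 : p = p' := congrArg Prod.fst h
    have h2 : d * (q : ℕ) = d * q' := congrArg (fun t : ℕ+ × ℕ+ => (t.2 : ℕ)) h
    exact Prod.ext h1 (PNat.coe_injective (Nat.eq_of_mul_eq_mul_left hd h2))
  have hsum : ∀ p : ℕ+ × ℕ+, ∑ i ∈ Finset.range d,
      heckeCoeff n a ((x₂ + s * i) / d) p * ee (p.1 * p.2 * z / n) =
      heckeCoeff n a (x₂ / d) p * ee (p.1 * p.2 * z / n) *
        if (d : ℤ) ∣ (p.2 : ℤ) then (d : ℂ) else 0 := by
    intro p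
    have h1 : (d : ℤ) ∣ (p.2 : ℤ) ↔ (d : ℤ) ∣ (p.2 : ℤ) * s := by
      rcases Int.natAbs_eq s with h | h <;> rw [hs] at h <;> simp [h]
    simp only [h1]
    rw [← sum_range_ee hd, Finset.mul_sum]
    refine Finset.sum_congr rfl fun i _ => ?_
    rw [heckeCoeff, heckeCoeff]
    split_ifs
    · have h2 : (p.2 : ℂ) * (((x₂ + s * i) / d : ℚ) : ℂ) =
          p.2 * ((x₂ / d : ℚ) : ℂ) + ((p.2 : ℤ) * s : ℤ) * i / d := by push_cast; ring
      rw [h2, ee_add]; ring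
    · simp
  rw [tsum_congr hsum, ← hφ.tsum_eq]
  · refine tsum_congr fun p => ?_
    have h1 : (d : ℤ) ∣ ((φ p).2 : ℤ) := ⟨p.2, by simp [φ]⟩
    rw [if_pos h1, mul_comm]
    congr 1
    rw [heckeCoeff, heckeCoeff, coe_dil hd]
    have h2 : (((φ p).2 : ℕ) : ℂ) = d * p.2 := by simp [φ]
    have h3 : (φ p).1 = p.1 := rfl
    rw [h2, h3]
    split_ifs
    · congr 3
      · push_cast; field_simp
      · field_simp
    · simp
  · intro p hp
    have h1 : (d : ℤ) ∣ (p.2 : ℤ) := by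
      by_contra h
      refine hp ?_
      simp only [if_neg h, mul_zero]
    obtain ⟨e, he⟩ : d ∣ (p.2 : ℕ) := by exact_mod_cast h1
    have he0 : 0 < e := by
      rcases Nat.eq_zero_or_pos e with h | h
      · rw [h, mul_zero] at he; exact absurd he p.2.ne_zero
      · exact h
    exact ⟨(p.1, ⟨e, he0⟩), Prod.ext rfl (PNat.coe_injective he.symm)⟩

lemma sum_intDelta_division {d : ℕ} (hd : 0 < d) (x₁ x₂ : ℚ) :
    ∑ i ∈ Finset.range d, intDelta x₁ ((x₂ + i) / d) = intDelta x₁ x₂ := by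
  have hdQ : (d : ℚ) ≠ 0 := by exact_mod_cast hd.ne'
  by_cases h : IsIntegral x₁ x₂
  · rw [intDelta_of_isIntegral h]
    obtain ⟨h1, m, rfl⟩ := h
    -- exactly one of the points `(m + i) / d` is integral
    have hdz : (d : ℤ) ≠ 0 := by exact_mod_cast hd.ne'
    have hpos : 0 ≤ (-m) % d := Int.emod_nonneg _ hdz
    have hlt : (-m) % d < d := Int.emod_lt_of_pos _ (by exact_mod_cast hd)
    rw [Finset.sum_eq_single ((-m) % d).toNat]
    · refine intDelta_of_isIntegral ⟨h1, -((-m) / d), ?_⟩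
      have h5 : ((((-m) % d).toNat : ℤ) : ℚ) = (((-m) % d : ℤ) : ℚ) := by
        rw [Int.toNat_of_nonneg hpos]
      have h6 : ((((-m) % d).toNat : ℕ) : ℚ) = (((-m) % d : ℤ) : ℚ) := by exact_mod_cast h5
      rw [h6, Int.emod_def]
      push_cast; field_simp; ring
    · intro i hi hne
      refine intDelta_of_not ?_
      rintro ⟨-, k, hk⟩
      rw [div_eq_iff hdQ] at hk
      have h5 : m + (i : ℤ) = k * d := by exact_mod_cast hk
      have h6 : ((-m) % d) = i := by
        rw [show -m = i + d * (-k) by linarith, Int.add_mul_emod_self_left]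
        exact Int.emod_eq_of_lt (by positivity) (by exact_mod_cast Finset.mem_range.1 hi)
      exact hne (by rw [h6]; simp)
    · intro h
      exfalso; apply h; rw [Finset.mem_range]; omega
  · rw [intDelta_of_not h]
    refine Finset.sum_eq_zero fun i _ => intDelta_of_not ?_
    rintro ⟨h1, k, hk⟩
    rw [div_eq_iff hdQ] at hk
    exact h ⟨h1, k * d - i, by push_cast; linarith⟩

/-- Distribution relation in the second coordinate. -/
lemma opV_heckePhi {d : ℕ} (hd : 0 < d) (x₁ x₂ : ℚ) :
    opV d (heckePhi x₁ x₂) = ∑ i ∈ Finset.range d, heckePhi x₁ ((x₂ + i) / d) := by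
  ext z
  have hd' : (d : ℂ) ≠ 0 := by exact_mod_cast hd.ne'
  rw [opV_apply hd, Finset.sum_apply]
  simp only [heckePhi_apply]
  rw [Finset.sum_sub_distrib, Finset.sum_sub_distrib, Finset.sum_sub_distrib, ← Finset.sum_mul,
    sum_intDelta_division hd]
  have h1 := sum_heckeP_division hd x₁ x₂ 1 rfl z
  have h2 := sum_heckeP_division hd (-x₁) (-x₂) (-1) rfl z
  have h3 : ∀ i ∈ Finset.range d, heckeP (-x₁) (-((x₂ + i) / d)) z =
      heckeP (-x₁) ((-x₂ + ((-1 : ℤ) : ℚ) * i) / d) z := fun i _ => by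
    congr 1; push_cast; ring
  simp only [Int.cast_one, one_mul] at h1
  rw [h1, Finset.sum_congr rfl h3, h2, Finset.sum_const, Finset.card_range, im_dil hd]
  have h5 : (z.im : ℂ) ≠ 0 := by exact_mod_cast z.im_ne_zero
  have h6 : (Real.pi : ℂ) ≠ 0 := by exact_mod_cast Real.pi_ne_zero
  simp only [nsmul_eq_mul]; push_cast; field_simp

/-! ### Behaviour at infinity -/

/-- `g = A + B / y + o(1 / y)` as `y = Im z → ∞`. -/
def HasAsymp (g : ℍ → ℂ) (A B : ℂ) : Prop :=
  Tendsto (fun z : ℍ => (z.im : ℂ) * (g z - A)) atImInfty (𝓝 B)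

lemma tendsto_im_atImInfty : Tendsto (fun z : ℍ => z.im) atImInfty atTop := tendsto_comap

lemma tendsto_inv_im : Tendsto (fun z : ℍ => ((z.im : ℂ))⁻¹) atImInfty (𝓝 0) := by
  have := tendsto_inv_atTop_zero.comp tendsto_im_atImInfty
  have h := (Complex.continuous_ofReal.tendsto 0).comp this
  rw [Complex.ofReal_zero] at h
  refine h.congr fun z => ?_
  simp

lemma HasAsymp.tendsto {g : ℍ → ℂ} {A B : ℂ} (h : HasAsymp g A B) :
    Tendsto g atImInfty (𝓝 A) := by
  have h1 := (tendsto_inv_im.mul h).add_const A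
  rw [zero_mul, zero_add] at h1
  refine h1.congr fun z => ?_
  have h5 : (z.im : ℂ) ≠ 0 := by exact_mod_cast z.im_ne_zero
  field_simp; ring

lemma HasAsymp.isBoundedAtImInfty {g : ℍ → ℂ} {A B : ℂ} (h : HasAsymp g A B) :
    IsBoundedAtImInfty g :=
  h.tendsto.isBigO_one ℝ

lemma HasAsymp.unique {g : ℍ → ℂ} {A B A' B' : ℂ} (h : HasAsymp g A B) (h' : HasAsymp g A' B') :
    A = A' ∧ B = B' := by
  have h1 := tendsto_nhds_unique h.tendsto h'.tendsto
  subst h1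
  exact ⟨rfl, tendsto_nhds_unique h h'⟩

lemma HasAsymp.add {g g' : ℍ → ℂ} {A B A' B' : ℂ} (h : HasAsymp g A B) (h' : HasAsymp g' A' B') :
    HasAsymp (g + g') (A + A') (B + B') := by
  refine (Tendsto.add h h').congr fun z => ?_
  simp; ring

lemma HasAsymp.smul {g : ℍ → ℂ} {A B : ℂ} (c : ℂ) (h : HasAsymp g A B) :
    HasAsymp (c • g) (c * A) (c * B) := by
  refine (Tendsto.const_mul c h).congr fun z => ?_
  simp; ring

lemma hasAsymp_zero : HasAsymp 0 0 0 := by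
  simp [HasAsymp]

lemma tendsto_dil {d : ℕ} (hd : 0 < d) : Tendsto (dil d) atImInfty atImInfty := by
  rw [atImInfty, tendsto_comap_iff]
  have hd' : (0 : ℝ) < d := by exact_mod_cast hd
  have := tendsto_im_atImInfty.const_mul_atTop hd'
  refine this.congr fun z => ?_
  simp [im_dil hd]

lemma heckeP_hasAsymp (x₁ x₂ : ℚ) : HasAsymp (heckeP x₁ x₂) 0 0 := by
  rw [rat_eq_div x₁]
  have hn : 0 < x₁.den := x₁.den_pos
  refine (tendsto_im_mul_dser (norm_heckeCoeff_le hn x₁.num x₂) hn).congr fun z => ?_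
  rw [heckeP_eq_tsum hn, sub_zero]

lemma heckeP_mdifferentiable (x₁ x₂ : ℚ) : MDiff (heckeP x₁ x₂) := by
  rw [rat_eq_div x₁]
  have hn : 0 < x₁.den := x₁.den_pos
  have h := mdifferentiable_dser (norm_heckeCoeff_le hn x₁.num x₂) hn
  have h2 : heckeP ((x₁.num : ℚ) / (x₁.den : ℕ)) x₂ = fun z : ℍ => ∑' p : ℕ+ × ℕ+,
      heckeCoeff x₁.den x₁.num x₂ p * ee (p.1 * p.2 * z / x₁.den) := by
    ext z; rw [heckeP_eq_tsum hn]
  rw [h2]; exact h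

lemma heckePhi_hasAsymp (x₁ x₂ : ℚ) : HasAsymp (heckePhi x₁ x₂) ((bernoulliTwo x₁ : ℚ) / 2)
    (-(intDelta x₁ x₂ / (4 * Real.pi))) := by
  have h := (((heckeP_hasAsymp x₁ x₂).add (heckeP_hasAsymp (-x₁) (-x₂))).smul (-1)).add
    (show HasAsymp (fun z => ((bernoulliTwo x₁ : ℚ) : ℂ) / 2
      - intDelta x₁ x₂ * (1 / (4 * Real.pi * (z.im : ℂ))))
      ((bernoulliTwo x₁ : ℚ) / 2) (-(intDelta x₁ x₂ / (4 * Real.pi))) from ?_)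
  · simp only [add_zero, mul_zero, zero_add] at h
    refine h.congr fun z => ?_
    congr 2
    simp only [heckePhi_apply, Pi.add_apply, Pi.smul_apply, smul_eq_mul]
    ring
  · refine tendsto_const_nhds.congr fun z => ?_
    have h5 : (z.im : ℂ) ≠ 0 := by exact_mod_cast z.im_ne_zero
    have h6 : (Real.pi : ℂ) ≠ 0 := by exact_mod_cast Real.pi_ne_zero
    field_simp; ring

lemma heckePhi_mdifferentiable {x₁ x₂ : ℚ} (h : ¬ IsIntegral x₁ x₂) : MDiff (heckePhi x₁ x₂) := by
  have : heckePhi x₁ x₂ = (fun _ => ((bernoulliTwo x₁ : ℚ) : ℂ) / 2) - heckeP x₁ x₂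
      - heckeP (-x₁) (-x₂) := by
    ext z; simp [heckePhi_apply, intDelta_of_not h]
  rw [this]
  exact (mdifferentiable_const.sub (heckeP_mdifferentiable _ _)).sub (heckeP_mdifferentiable _ _)

lemma eisensteinAll_induction {p : (ℍ → ℂ) → Prop}
    (hφ : ∀ x₁ x₂ : ℚ, ¬ IsIntegral x₁ x₂ → p (heckePhi x₁ x₂)) (h0 : p 0)
    (hadd : ∀ g h, p g → p h → p (g + h)) (hsmul : ∀ (c : ℂ) g, p g → p (c • g))
    {g : ℍ → ℂ} (hg : g ∈ eisensteinAll) : p g := by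
  induction hg using Submodule.span_induction with
  | mem g hg => obtain ⟨x₁, x₂, hx, rfl⟩ := hg; exact hφ _ _ hx
  | zero => exact h0
  | add g h _ _ hg hh => exact hadd g h hg hh
  | smul c g _ hg => exact hsmul c g hg

lemma heckePhi_mem {x₁ x₂ : ℚ} (h : ¬ IsIntegral x₁ x₂) : heckePhi x₁ x₂ ∈ eisensteinAll :=
  Submodule.subset_span ⟨x₁, x₂, h, rfl⟩

lemma mdifferentiable_of_mem {g : ℍ → ℂ} (hg : g ∈ eisensteinAll) : MDiff g :=
  eisensteinAll_induction (fun _ _ h => heckePhi_mdifferentiable h) mdifferentiable_const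
    (fun _ _ h1 h2 => h1.add h2) (fun c _ h => h.const_smul c) hg

lemma hasAsymp_of_mem {g : ℍ → ℂ} (hg : g ∈ eisensteinAll) : ∃ A, HasAsymp g A 0 := by
  refine eisensteinAll_induction (p := fun g => ∃ A, HasAsymp g A 0) (fun x₁ x₂ h => ?_)
    ⟨0, hasAsymp_zero⟩ ?_ ?_ hg
  · have := heckePhi_hasAsymp x₁ x₂
    rw [intDelta_of_not h, zero_div, neg_zero] at this
    exact ⟨_, this⟩
  · rintro _ _ ⟨A, hA⟩ ⟨A', hA'⟩
    exact ⟨A + A', by simpa using hA.add hA'⟩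
  · rintro c _ ⟨A, hA⟩
    exact ⟨c * A, by simpa using hA.smul c⟩

lemma opV_mem {d : ℕ} (hd : 0 < d) {g : ℍ → ℂ} (hg : g ∈ eisensteinAll) :
    opV d g ∈ eisensteinAll := by
  refine eisensteinAll_induction (p := fun g => opV d g ∈ eisensteinAll) ?_ ?_ ?_ ?_ hg
  · intro x₁ x₂ h
    rw [opV_heckePhi hd]
    refine sum_mem fun i _ => heckePhi_mem fun ⟨h1, k, hk⟩ => h ⟨h1, k * d - i, ?_⟩
    have hdQ : (d : ℚ) ≠ 0 := by exact_mod_cast hd.ne'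
    rw [div_eq_iff hdQ] at hk
    push_cast; linarith
  · simp
  · intro g h hg hh; rw [map_add]; exact add_mem hg hh
  · intro c g hg; rw [map_smul]; exact Submodule.smul_mem _ _ hg

/-! ### Lattice sums and the modular transformation of Hecke's functions -/

/-- The additive character `(c, d) ↦ exp(2πi(c x₂ - d x₁))` of `ℤ²`. -/
def latChar (x₁ x₂ : ℚ) (c d : ℤ) : ℂ := ee (c * x₂ - d * x₁)

/-- The terms of the lattice sum `∑ exp(2πi(c x₂ - d x₁)) (c z + d)⁻²`; the term of index `(0, 0)`
vanishes by the convention `0⁻¹ = 0`. -/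
def latTerm (x₁ x₂ : ℚ) (z : ℂ) (c d : ℤ) : ℂ := latChar x₁ x₂ c d * ((c * z + d) ^ 2)⁻¹

lemma norm_latChar (x₁ x₂ : ℚ) (c d : ℤ) : ‖latChar x₁ x₂ c d‖ = 1 := by
  have : (c * x₂ - d * x₁ : ℂ) = ((c * (x₂ : ℝ) - d * (x₁ : ℝ) : ℝ) : ℂ) := by push_cast; ring
  rw [latChar, this, norm_ee_ofReal]

lemma latChar_succ (x₁ x₂ : ℚ) (c d : ℤ) :
    latChar x₁ x₂ c (d + 1) = ee (-x₁) * latChar x₁ x₂ c d := by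
  rw [latChar, latChar, ← ee_add]; congr 1; push_cast; ring

lemma latTerm_neg (x₁ x₂ : ℚ) (z : ℂ) (c d : ℤ) :
    latTerm x₁ x₂ z (-c) d = latTerm (-x₁) (-x₂) z c (-d) := by
  rw [latTerm, latTerm, latChar, latChar]
  congr 2
  · push_cast; ring
  · push_cast; ring

lemma summable_latTerm_right (x₁ x₂ : ℚ) (z : ℂ) (c : ℤ) : Summable (latTerm x₁ x₂ z c) := by
  refine Summable.of_norm ?_
  have h := (EisensteinSeries.linear_right_summable z c (k := 2) le_rfl).norm
  refine h.congr fun d => ?_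
  rw [latTerm, norm_mul, norm_latChar, one_mul]
  norm_cast

lemma summable_latTerm_left (x₁ x₂ : ℚ) {z : ℂ} (hz : z ≠ 0) (d : ℤ) :
    Summable fun c => latTerm x₁ x₂ z c d := by
  refine Summable.of_norm ?_
  have h := (EisensteinSeries.linear_left_summable hz d (k := 2) le_rfl).norm
  refine h.congr fun c => ?_
  rw [latTerm, norm_mul, norm_latChar, one_mul]
  norm_cast

/-- The row `c = 0` is the Fourier series of the second Bernoulli function. -/
lemma tsum_latTerm_zero (x₁ x₂ : ℚ) (z : ℂ) :
    ∑' d : ℤ, latTerm x₁ x₂ z 0 d = 2 * Real.pi ^ 2 * (bernoulliTwo x₁ : ℚ) := by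
  obtain ⟨t, m, ht0, ht1, hB, hm⟩ : ∃ (t : ℚ) (m : ℤ), 0 ≤ t ∧ t < 1 ∧
      bernoulliTwo x₁ = t ^ 2 - t + 1 / 6 ∧ x₁ = t + m :=
    ⟨Int.fract x₁, ⌊x₁⌋, Int.fract_nonneg x₁, Int.fract_lt_one x₁, rfl,
      (Int.fract_add_floor x₁).symm⟩
  have hx : (t : ℝ) ∈ Set.Icc (0 : ℝ) 1 := ⟨by exact_mod_cast ht0, by exact_mod_cast ht1.le⟩
  have h := (hasSum_one_div_pow_mul_fourier_mul_bernoulliFun le_rfl hx)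
  rw [← (Equiv.neg ℤ).tsum_eq]
  have h2 : ∀ d : ℤ, latTerm x₁ x₂ z 0 (Equiv.neg ℤ d) =
      1 / (d : ℂ) ^ 2 * fourier d ((t : ℝ) : UnitAddCircle) := by
    intro d
    rw [fourier_coe_apply, latTerm, latChar, mul_comm]
    congr 1
    · simp
    · have h4 : (((0 : ℤ) : ℂ) * x₂ - ((Equiv.neg ℤ d : ℤ) : ℂ) * x₁) =
          d * (t : ℂ) + ((d * m : ℤ) : ℂ) := by
        rw [hm]; simp; ring
      rw [h4, ee_add, ee_int, mul_one, ee]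
      congr 1
      push_cast; ring
  rw [tsum_congr h2, h.tsum_eq, bernoulliFun_two, hB]
  push_cast [Nat.factorial]
  have := Complex.I_sq
  linear_combination (-2 * (Real.pi : ℂ) ^ 2 * ((t : ℂ) ^ 2 - (t : ℂ) + 1 / 6)) * this

/-- Lipschitz' formula at the point `(w + r) / n`. -/
lemma tsum_lipschitz_residue {n : ℕ} (hn : 0 < n) (a : ℤ) (w : ℍ) (r : ℕ) :
    ∑' k : ℤ, ee (-((r + n * k : ℤ) : ℂ) * (a / n)) * (((w : ℂ) + ((r + n * k : ℤ) : ℂ)) ^ 2)⁻¹ =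
      -4 * Real.pi ^ 2 / n ^ 2 * ∑' j : ℕ+, (j : ℂ) * ee (j * w / n) *
        ee (((j - a : ℤ) : ℂ) * r / n) := by
  have hnC : (n : ℂ) ≠ 0 := by exact_mod_cast hn.ne'
  have hnR : (0 : ℝ) < n := by exact_mod_cast hn
  have him : 0 < (((w : ℂ) + r) / n).im := by
    rw [show (n : ℂ) = ((n : ℝ) : ℂ) by simp, Complex.div_ofReal_im]
    simpa using div_pos w.im_pos hnR
  have hL := EisensteinSeries.qExpansion_identity_pnat (k := 1) le_rfl ⟨((w : ℂ) + r) / n, him⟩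
  have h1 : ∀ k : ℤ, ee (-((r + n * k : ℤ) : ℂ) * (a / n)) *
      (((w : ℂ) + ((r + n * k : ℤ) : ℂ)) ^ 2)⁻¹ =
      ee (-r * (a / n)) / n ^ 2 * (1 / (((w : ℂ) + r) / n + k) ^ (1 + 1)) := by
    intro k
    have h3 : (-((r + n * k : ℤ) : ℂ) * (a / n)) = -r * (a / n) + ((-(k * a) : ℤ) : ℂ) := by
      push_cast; field_simp; ring
    have h4 : ((w : ℂ) + ((r + n * k : ℤ) : ℂ)) = n * (((w : ℂ) + r) / n + k) := by
      push_cast; field_simp; ring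
    rw [h3, ee_add, ee_int, h4, mul_pow, mul_inv, one_div]
    ring
  have h5 : ∑' k : ℤ, 1 / (((w : ℂ) + r) / n + k) ^ (1 + 1) =
      -4 * Real.pi ^ 2 * ∑' j : ℕ+, (j : ℂ) * ee (j * ((w + r) / n)) := by
    refine hL.trans ?_
    congr 1
    · rw [show (1 + 1 : ℕ) = 2 from rfl, mul_pow, mul_pow, Complex.I_sq]
      simp; ring
    · refine tsum_congr fun j => ?_
      rw [ee_nat_mul, ee, pow_one]
  have h8 : ∀ j : ℕ+, (j : ℂ) * ee (j * w / n) * ee (((j - a : ℤ) : ℂ) * r / n) =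
      ee (-r * (a / n)) * ((j : ℂ) * ee (j * ((w + r) / n))) := by
    intro j
    have h6 : (j * ((w + r) / n) : ℂ) = j * w / n + j * r / n := by ring
    have h7 : (((j - a : ℤ) : ℂ) * r / n) = j * r / n + -r * (a / n) := by
      push_cast; ring
    rw [h6, h7, ee_add, ee_add]
    ring
  rw [tsum_congr h1, tsum_mul_left, h5, tsum_congr h8, tsum_mul_left]
  ring

lemma summable_twisted_exp {n : ℕ} (hn : 0 < n) (a : ℤ) (w : ℍ) (r : ℕ) :
    Summable fun j : ℕ+ => (j : ℂ) * ee (j * w / n) * ee (((j - a : ℤ) : ℂ) * r / n) := by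
  have hb := summable_majorant 1 (Real.exp_nonneg _)
    (exp_lt_one_of_pos hn w.im_pos) (r := Real.exp (-2 * Real.pi * w.im / n))
  have hb2 : Summable fun j : ℕ+ => 1 * (j : ℝ) * Real.exp (-2 * Real.pi * w.im / n) ^ (j : ℕ) := by
    have := hb.comp_injective (i := fun j : ℕ+ => (j, (1 : ℕ+)))
      (fun j j' h => congrArg Prod.fst h)
    refine this.congr fun j => ?_
    simp
  refine Summable.of_norm_bounded hb2 fun j => ?_
  have h8 : (((j - a : ℤ) : ℂ) * r / n) = (((j - a : ℤ) * r / n : ℝ) : ℂ) := by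
    push_cast; ring
  have h9 := norm_ee_term n (w : ℂ) (j, 1)
  simp only [PNat.val_ofNat, Nat.cast_one, mul_one] at h9
  rw [norm_mul, norm_mul, h8, norm_ee_ofReal, mul_one, h9, Complex.norm_natCast, one_mul,
    UpperHalfPlane.coe_im]

lemma tsum_int_eq_sum_residues {n : ℕ} [NeZero n] {F : ℤ → ℂ} (hF : Summable F) :
    ∑' d, F d = ∑ r : Fin n, ∑' k : ℤ, F ((r : ℕ) + n * k) := by
  obtain ⟨e, he⟩ : ∃ e : ℤ × Fin n ≃ ℤ, ∀ p, e p = (p.2 : ℕ) + n * p.1 :=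
    ⟨(Int.divModEquiv n).symm, fun p => by rw [Int.divModEquiv_symm_apply, add_comm, mul_comm]⟩
  obtain ⟨G, hG⟩ : ∃ G : ℤ → Fin n → ℂ, ∀ k r, G k r = F ((r : ℕ) + n * k) := ⟨_, fun _ _ => rfl⟩
  have hs' : Summable fun p : ℤ × Fin n => G p.1 p.2 :=
    (e.summable_iff.2 hF).congr fun p => by rw [Function.comp, he, hG]
  have h1 : ∑' d, F d = ∑' p : ℤ × Fin n, G p.1 p.2 := by
    rw [← e.tsum_eq]
    exact tsum_congr fun p => by rw [he, hG]
  rw [h1, hs'.tsum_prod.trans (Summable.tsum_comm (f := G) hs').symm, tsum_fintype]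
  exact Finset.sum_congr rfl fun r _ => tsum_congr fun k => hG k r

open scoped Classical in
/-- Lipschitz' formula twisted by an additive character of finite order. -/
lemma tsum_twisted_lipschitz {n : ℕ} (hn : 0 < n) (a : ℤ) (w : ℍ) :
    ∑' d : ℤ, ee (-d * (a / n)) * (((w : ℂ) + d) ^ 2)⁻¹ =
      -4 * Real.pi ^ 2 * ∑' j : ℕ+, if (n : ℤ) ∣ (j : ℤ) - a then (j / n : ℂ) * ee (j * w / n)
        else 0 := by
  have hne : NeZero n := ⟨hn.ne'⟩
  have hnC : (n : ℂ) ≠ 0 := by exact_mod_cast hn.ne'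
  have hs : Summable fun d : ℤ => ee (-d * (a / n)) * (((w : ℂ) + d) ^ 2)⁻¹ := by
    refine (summable_latTerm_right (a / n) 0 w 1).congr fun d => ?_
    rw [latTerm, latChar]
    congr 2
    · push_cast; ring
    · push_cast; ring
  rw [tsum_int_eq_sum_residues (n := n) hs,
    Finset.sum_congr rfl fun (r : Fin n) _ => tsum_lipschitz_residue hn a w r,
    ← Finset.mul_sum, ← Summable.tsum_finsetSum fun (r : Fin n) _ => summable_twisted_exp hn a w r,
    ← tsum_mul_left, ← tsum_mul_left]
  refine tsum_congr fun j => ?_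
  rw [← Finset.mul_sum, Fin.sum_univ_eq_sum_range (fun r : ℕ => ee (((j - a : ℤ) : ℂ) * r / n)) n,
    sum_range_ee hn]
  split_ifs
  · field_simp
  · simp

/-- The rows `c > 0` of the lattice sum. -/
lemma tsum_latTerm_pos {n : ℕ} (hn : 0 < n) (a : ℤ) (x₂ : ℚ) (z : ℍ) (c : ℕ+) :
    ∑' d : ℤ, latTerm (a / n) x₂ z (c : ℕ) d =
      -4 * Real.pi ^ 2 * ∑' j : ℕ+, heckeCoeff n a x₂ (j, c) * ee (j * c * z / n) := by
  have hc := c.pos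
  have h := tsum_twisted_lipschitz hn a (dil c z)
  rw [coe_dil hc] at h
  have h1 : ∀ d : ℤ, latTerm (a / n) x₂ z (c : ℕ) d =
      ee (c * x₂) * (ee (-d * (a / n)) * (((c : ℕ) * (z : ℂ) + d) ^ 2)⁻¹) := by
    intro d
    rw [latTerm, latChar, ← mul_assoc, ← ee_add]
    congr 2
    push_cast; ring
  rw [tsum_congr h1, tsum_mul_left, h, mul_left_comm, ← tsum_mul_left]
  congr 1
  refine tsum_congr fun j => ?_
  rw [heckeCoeff]
  split_ifs
  · rw [mul_left_comm, ← mul_assoc]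
    congr 2
    ring
  · simp

lemma hasSum_rows_pos (x₁ x₂ : ℚ) (z : ℍ) :
    HasSum (fun c : ℕ => ∑' d : ℤ, latTerm x₁ x₂ z (c + 1) d)
      (-4 * Real.pi ^ 2 * heckeP x₁ x₂ z) := by
  rw [rat_eq_div x₁]
  have hn : 0 < x₁.den := x₁.den_pos
  have hs := dser_summable (norm_heckeCoeff_le hn x₁.num x₂) hn z
  have h1 : HasSum (fun c : ℕ+ => ∑' j : ℕ+, heckeCoeff x₁.den x₁.num x₂ (j, c) *
      ee (j * c * z / x₁.den)) (heckeP ((x₁.num : ℚ) / (x₁.den : ℕ)) x₂ z) := by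
    rw [heckeP_eq_tsum hn]
    have hs' := hs.prod_symm
    have := hs'.hasSum.prod_fiberwise fun c => (hs'.prod_factor c).hasSum
    have h3 := (Equiv.prodComm ℕ+ ℕ+).tsum_eq (fun p : ℕ+ × ℕ+ => heckeCoeff x₁.den x₁.num x₂ p *
      ee (p.1 * p.2 * z / x₁.den))
    rw [← h3]
    exact this
  have h2 := (Equiv.pnatEquivNat.symm.hasSum_iff.2 h1).mul_left (-4 * (Real.pi : ℂ) ^ 2)
  refine h2.congr_fun fun c => ?_
  have h4 := tsum_latTerm_pos hn x₁.num x₂ z (Equiv.pnatEquivNat.symm c)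
  simp only [Function.comp]
  rw [← h4]
  refine tsum_congr fun d => ?_
  congr 1

/-- Hecke's function as an Eisenstein summed lattice sum, outer index first. -/
lemma hasSum_rows (x₁ x₂ : ℚ) (z : ℍ) :
    HasSum (fun c : ℤ => ∑' d : ℤ, latTerm x₁ x₂ z c d)
      (4 * Real.pi ^ 2 * (((bernoulliTwo x₁ : ℚ) : ℂ) / 2 - heckeP x₁ x₂ z
        - heckeP (-x₁) (-x₂) z)) := by
  have h1 := hasSum_rows_pos x₁ x₂ z
  have h2 := hasSum_rows_pos (-x₁) (-x₂) z
  have h3 : (fun c : ℕ => ∑' d : ℤ, latTerm x₁ x₂ z (-((c : ℤ) + 1)) d) =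
      fun c : ℕ => ∑' d : ℤ, latTerm (-x₁) (-x₂) z (c + 1) d := by
    ext c
    rw [← (Equiv.neg ℤ).tsum_eq]
    refine tsum_congr fun d => ?_
    rw [latTerm_neg]; simp
  have h := HasSum.of_add_one_of_neg_add_one (f := fun c : ℤ => ∑' d : ℤ, latTerm x₁ x₂ z c d)
    h1 (by rw [h3]; exact h2)
  rw [tsum_latTerm_zero] at h
  convert! h using 1
  ring

/-- The difference is of the order of `u⁻³`; the convention `0⁻¹ = 0` makes the bound hold at `u = 0`
and `u = 1` as well. -/
lemma norm_inv_sq_sub_le (u : ℂ) :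
    ‖(u ^ 2)⁻¹ - ((u - 1) ^ 2)⁻¹‖ ≤ 2 * (‖(u ^ 3)⁻¹‖ + ‖((u - 1) ^ 3)⁻¹‖) := by
  rcases eq_or_ne u 0 with rfl | h0
  · norm_num
  rcases eq_or_ne u 1 with rfl | h1
  · norm_num
  have h1' : u - 1 ≠ 0 := sub_ne_zero.2 h1
  have e : (u ^ 2)⁻¹ - ((u - 1) ^ 2)⁻¹ =
      -(u⁻¹ * (u - 1)⁻¹ ^ 2) - u⁻¹ ^ 2 * (u - 1)⁻¹ := by
    field_simp; ring
  rw [e, ← inv_pow u, ← inv_pow (u - 1)]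
  refine (norm_sub_le _ _).trans ?_
  simp only [norm_neg, norm_mul, norm_pow]
  have ha := norm_nonneg u⁻¹
  have hb := norm_nonneg (u - 1)⁻¹
  generalize ‖u⁻¹‖ = a at *
  generalize ‖(u - 1)⁻¹‖ = b at *
  have h2 : 0 ≤ (a + b) * (a - b) ^ 2 := by positivity
  have h3 : 0 ≤ a ^ 3 := by positivity
  have h4 : 0 ≤ b ^ 3 := by positivity
  nlinarith

lemma summable_lattice_cube (z : ℍ) :
    Summable fun p : ℤ × ℤ => ‖(((p.1 : ℂ) * z + p.2) ^ 3)⁻¹‖ := by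
  have h := EisensteinSeries.summable_norm_eisSummand (k := 3) le_rfl z
  refine ((finTwoArrowEquiv ℤ).symm.summable_iff.2 h).congr fun p => ?_
  simp only [Function.comp, EisensteinSeries.eisSummand, finTwoArrowEquiv_symm_apply,
    Matrix.cons_val_zero, Matrix.cons_val_one, zpow_neg]
  norm_cast

/-- The differences of consecutive terms of the lattice sum, which converge absolutely. -/
lemma summable_latTerm_diff (x₁ x₂ : ℚ) (z : ℍ) :
    Summable fun p : ℤ × ℤ =>
      latTerm x₁ x₂ z p.1 p.2 - ee (-x₁) * latTerm x₁ x₂ z p.1 (p.2 - 1) := by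
  have h := summable_lattice_cube z
  have h' : Summable fun p : ℤ × ℤ => ‖(((p.1 : ℂ) * z + p.2 - 1) ^ 3)⁻¹‖ := by
    refine (((Equiv.refl ℤ).prodCongr (Equiv.subRight (1 : ℤ))).summable_iff.2 h).congr fun p => ?_
    simp [add_sub_assoc]
  refine Summable.of_norm_bounded ((h.add h').mul_left 2) fun p => ?_
  have e : latTerm x₁ x₂ z p.1 p.2 - ee (-x₁) * latTerm x₁ x₂ z p.1 (p.2 - 1) =
      latChar x₁ x₂ p.1 p.2 *
        ((((p.1 : ℂ) * z + p.2) ^ 2)⁻¹ - (((p.1 : ℂ) * z + p.2 - 1) ^ 2)⁻¹) := by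
    have := latChar_succ x₁ x₂ p.1 (p.2 - 1)
    rw [sub_add_cancel] at this
    rw [latTerm, latTerm, this]
    push_cast
    rw [add_sub_assoc]
    ring
  rw [e, norm_mul, norm_latChar, one_mul]
  exact norm_inv_sq_sub_le _

/-- The lattice sum may be summed in either order, as long as `x₁` is not an integer:
multiplied with `1 - exp(-2πi x₁) ≠ 0` it becomes absolutely convergent. -/
lemma tsum_latTerm_comm {x₁ : ℚ} (x₂ : ℚ) (h₁ : ¬ ∃ n : ℤ, x₁ = n) (z : ℍ)
    (hc : Summable fun d : ℤ => ∑' c : ℤ, latTerm x₁ x₂ z c d) :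
    ∑' c : ℤ, ∑' d : ℤ, latTerm x₁ x₂ z c d = ∑' d : ℤ, ∑' c : ℤ, latTerm x₁ x₂ z c d := by
  have hζ : (1 - ee (-x₁)) ≠ 0 := by
    intro h
    have h2 : ee (-x₁) = 1 := (sub_eq_zero.1 h).symm
    rw [ee_eq_one_iff] at h2
    obtain ⟨n, hn⟩ := h2
    refine h₁ ⟨-n, ?_⟩
    have h3 : (x₁ : ℂ) = ((-n : ℤ) : ℂ) := by push_cast; linear_combination -hn
    exact_mod_cast h3
  have hG := summable_latTerm_diff x₁ x₂ z
  have hrow := fun c => summable_latTerm_right x₁ x₂ z c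
  have hrow' : ∀ c, Summable fun d => ee (-x₁) * latTerm x₁ x₂ z c (d - 1) := fun c =>
    ((Equiv.subRight (1 : ℤ)).summable_iff.2 (hrow c)).mul_left _
  have hcol := fun d => summable_latTerm_left x₁ x₂ z.ne_zero d
  refine mul_left_cancel₀ hζ ?_
  have e1 : ∀ c : ℤ, ∑' d : ℤ, (latTerm x₁ x₂ z c d - ee (-x₁) * latTerm x₁ x₂ z c (d - 1)) =
      (1 - ee (-x₁)) * ∑' d : ℤ, latTerm x₁ x₂ z c d := by
    intro c
    rw [(hrow c).tsum_sub (hrow' c), tsum_mul_left,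
      show ∑' d : ℤ, latTerm x₁ x₂ z c (d - 1) = _ from
        (Equiv.subRight (1 : ℤ)).tsum_eq (fun d => latTerm x₁ x₂ z c d)]
    ring
  have e2 : ∀ d : ℤ, ∑' c : ℤ, (latTerm x₁ x₂ z c d - ee (-x₁) * latTerm x₁ x₂ z c (d - 1)) =
      ∑' c : ℤ, latTerm x₁ x₂ z c d - ee (-x₁) * ∑' c : ℤ, latTerm x₁ x₂ z c (d - 1) := by
    intro d
    rw [(hcol d).tsum_sub ((hcol (d - 1)).mul_left _), tsum_mul_left]
  have hc' : Summable fun d : ℤ => ee (-x₁) * ∑' c : ℤ, latTerm x₁ x₂ z c (d - 1) :=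
    ((Equiv.subRight (1 : ℤ)).summable_iff.2 hc).mul_left _
  have e3 : ∑' d : ℤ, ∑' c : ℤ, (latTerm x₁ x₂ z c d - ee (-x₁) * latTerm x₁ x₂ z c (d - 1)) =
      (1 - ee (-x₁)) * ∑' d : ℤ, ∑' c : ℤ, latTerm x₁ x₂ z c d := by
    rw [tsum_congr e2, hc.tsum_sub hc', tsum_mul_left,
      show ∑' d : ℤ, ∑' c : ℤ, latTerm x₁ x₂ z c (d - 1) = _ from
        (Equiv.subRight (1 : ℤ)).tsum_eq (fun d => ∑' c : ℤ, latTerm x₁ x₂ z c d)]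
    ring
  rw [← tsum_mul_left, ← tsum_congr e1, ← e3]
  exact (Summable.tsum_comm (f := fun c d : ℤ =>
    latTerm x₁ x₂ z c d - ee (-x₁) * latTerm x₁ x₂ z c (d - 1)) hG).symm

/-- The point `-1 / z`. -/
abbrev invPt (z : ℍ) : ℍ := ⟨(-(z : ℂ))⁻¹, UpperHalfPlane.im_inv_neg_coe_pos z⟩

lemma latTerm_invPt (x₁ x₂ : ℚ) (z : ℍ) (c d : ℤ) :
    latTerm x₁ x₂ z c d = ((z : ℂ) ^ 2)⁻¹ * latTerm x₂ (-x₁) (invPt z) d (-c) := by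
  have hz := z.ne_zero
  have h1 : latChar x₂ (-x₁) d (-c) = latChar x₁ x₂ c d := by
    rw [latChar, latChar]; congr 1; push_cast; ring
  have h2 : (d * (-(z : ℂ))⁻¹ + ((-c : ℤ) : ℂ)) = -(c * z + d) / z := by
    push_cast; field_simp; ring
  rw [latTerm, latTerm, h1, h2, div_pow, neg_sq, inv_div]
  field_simp

/-- The matrix `S` exchanges the roles of `c` and `d` in the lattice sum. -/
lemma heckePhi_slash_S_of_not_int {x₁ : ℚ} (x₂ : ℚ) (h₁ : ¬ ∃ n : ℤ, x₁ = n) :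
    heckePhi x₂ (-x₁) ∣[(2 : ℤ)] ModularGroup.S = heckePhi x₁ x₂ := by
  ext z
  have hr := hasSum_rows x₁ x₂ z
  have hc := (hasSum_rows x₂ (-x₁) (invPt z)).mul_left ((z : ℂ) ^ 2)⁻¹
  have e : ∀ d : ℤ, ((z : ℂ) ^ 2)⁻¹ * ∑' c : ℤ, latTerm x₂ (-x₁) (invPt z) d c =
      ∑' c : ℤ, latTerm x₁ x₂ z c d := by
    intro d
    rw [← tsum_mul_left, ← (Equiv.neg ℤ).tsum_eq]
    exact tsum_congr fun c => (latTerm_invPt x₁ x₂ z c d).symm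
  rw [funext e] at hc
  have h := tsum_latTerm_comm x₂ h₁ z hc.summable
  rw [hr.tsum_eq, hc.tsum_eq] at h
  rw [SlashInvariantForm.slash_S_apply, heckePhi_apply, heckePhi_apply,
    intDelta_of_not (fun h => h₁ h.1), intDelta_of_not (x₁ := x₂), zero_mul, zero_mul, sub_zero,
    sub_zero]
  · have hpi : (4 * (Real.pi : ℂ) ^ 2) ≠ 0 := by
      simp [Real.pi_ne_zero]
    refine mul_left_cancel₀ hpi ?_
    rw [h, zpow_neg]
    norm_cast
    ring
  · rintro ⟨-, n, hn⟩
    exact h₁ ⟨-n, by push_cast; linarith⟩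

lemma slash_S_slash_S (g : ℍ → ℂ) :
    (g ∣[(2 : ℤ)] ModularGroup.S) ∣[(2 : ℤ)] ModularGroup.S = g := by
  ext z
  rw [SlashInvariantForm.slash_S_apply, SlashInvariantForm.slash_S_apply]
  have hz := z.ne_zero
  have h : invPt (invPt z) = z := by
    ext
    simp
  change g (invPt (invPt z)) * ((-(z : ℂ))⁻¹) ^ (-2 : ℤ) * _ = _
  rw [h, zpow_neg, zpow_neg]
  norm_cast
  field_simp

lemma heckeP_zero_zero (z : ℍ) : heckeP 0 0 z = (1 - EisensteinSeries.E2 z) / 24 := by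
  have h := heckeP_eq_tsum one_pos 0 0 z
  have hs := dser_summable (norm_heckeCoeff_le one_pos 0 0) one_pos z
  simp only [Int.cast_zero, Nat.cast_one, div_one] at h hs
  have hq : ‖ee z‖ < 1 := by
    rw [norm_ee]
    rw [Real.exp_lt_one_iff]
    have := mul_pos Real.pi_pos z.im_pos
    simp only [UpperHalfPlane.coe_im]
    nlinarith
  rw [EisensteinSeries.E2_eq_tsum_cexp, h]
  have h2 := tsum_prod_pow_eq_tsum_sigma 1 hq
  have h3 : ∑' p : ℕ+ × ℕ+, heckeCoeff 1 0 0 p * ee (p.1 * p.2 * z) =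
      ∑' (d : ℕ+) (c : ℕ+), (c : ℂ) ^ 1 * ee z ^ ((d : ℕ) * (c : ℕ)) := by
    rw [← (Equiv.prodComm ℕ+ ℕ+).tsum_eq, Summable.tsum_prod]
    · refine tsum_congr fun d => tsum_congr fun c => ?_
      have : ((c : ℂ) * d * z) = ((d * c : ℕ) : ℂ) * z := by push_cast; ring
      rw [← ee_nat_mul, ← this]
      simp [heckeCoeff, ee_zero]
    · exact (Equiv.prodComm ℕ+ ℕ+).summable_iff.2 hs
  rw [h3, h2]
  have h4 : Complex.exp (2 * Real.pi * Complex.I * z) = ee z := rfl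
  rw [h4]
  ring

/-- The function `φ_0` is a multiple of the completed Eisenstein series `E₂ - 3 / (π y)`. -/
lemma heckePhi_zero_apply (z : ℍ) : heckePhi 0 0 z =
    EisensteinSeries.E2 z / 12 - 1 / (4 * Real.pi * z.im) := by
  have h : IsIntegral 0 0 := ⟨⟨0, by simp⟩, ⟨0, by simp⟩⟩
  rw [heckePhi_apply, neg_zero, heckeP_zero_zero, intDelta_of_isIntegral h, bernoulliTwo,
    Int.fract_zero]
  push_cast
  ring

lemma heckePhi_zero_slash_S : heckePhi 0 0 ∣[(2 : ℤ)] ModularGroup.S = heckePhi 0 0 := by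
  ext z
  have hz := z.ne_zero
  have hE := congrFun (EisensteinSeries.E2_slash_action ModularGroup.S) z
  rw [SlashInvariantForm.slash_S_apply, Pi.sub_apply, Pi.smul_apply, EisensteinSeries.D2_S,
    riemannZeta_two] at hE
  rw [SlashInvariantForm.slash_S_apply, heckePhi_zero_apply, heckePhi_zero_apply, sub_mul,
    div_mul_eq_mul_div, hE]
  have him : (((invPt z).im : ℝ) : ℂ) = z.im / (z * (starRingEnd ℂ) z) := by
    rw [Complex.mul_conj]
    have : (invPt z).im = z.im / Complex.normSq z := by
      change ((-(z : ℂ))⁻¹).im = _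
      rw [Complex.inv_im]; simp
    rw [this]; push_cast; rfl
  have hconj : (starRingEnd ℂ) (z : ℂ) = z - 2 * Complex.I * z.im := by
    apply Complex.ext <;> simp
    ring
  have hcz : (starRingEnd ℂ) (z : ℂ) ≠ 0 := by simpa using hz
  have hy : (z.im : ℂ) ≠ 0 := by exact_mod_cast z.im_pos.ne'
  have hpi : (Real.pi : ℂ) ≠ 0 := by exact_mod_cast Real.pi_ne_zero
  have h2 : (z : ℂ) ^ (-2 : ℤ) = ((z : ℂ) ^ 2)⁻¹ := by rw [zpow_neg]; norm_cast
  rw [him, h2, smul_eq_mul, hconj]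
  rw [hconj] at hcz
  field_simp
  ring_nf

/-- If `x₁` or `x₂` is not an integer a lattice sum may be rearranged; for integral `x` this is the
transformation of the completed `E₂`. -/
theorem heckePhi_slash_S (x₁ x₂ : ℚ) :
    heckePhi x₁ x₂ ∣[(2 : ℤ)] ModularGroup.S = heckePhi x₂ (-x₁) := by
  by_cases h₂ : ∃ n : ℤ, x₂ = n
  · by_cases h₁ : ∃ n : ℤ, x₁ = n
    · obtain ⟨n, rfl⟩ := h₁
      obtain ⟨m, rfl⟩ := h₂
      have e1 := heckePhi_add_int 0 0 n m
      have e2 := heckePhi_add_int 0 0 m (-n)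
      simp only [zero_add] at e1 e2
      push_cast at e2
      rw [e1, e2, heckePhi_zero_slash_S]
    · have h := heckePhi_slash_S_of_not_int x₂ h₁
      rw [← h, slash_S_slash_S]
  · have h := heckePhi_slash_S_of_not_int (-x₁) h₂
    rwa [heckePhi_neg] at h

lemma heckePhi_slash_T (x₁ x₂ : ℚ) :
    heckePhi x₁ x₂ ∣[(2 : ℤ)] ModularGroup.T = heckePhi x₁ (x₁ + x₂) := by
  ext z
  rw [ModularForm.SL_slash_apply, ← heckePhi_vadd_one x₁ x₂ z (ModularGroup.T • z)]
  · rw [ModularGroup.denom_apply]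
    simp [ModularGroup.coe_T]
  · rw [UpperHalfPlane.modular_T_smul]; simp [add_comm]

/-- `SL₂(ℤ)` permutes Hecke's functions by its action on the row vectors of `(ℚ/ℤ)²`. -/
theorem heckePhi_slash (γ : SL(2, ℤ)) (x₁ x₂ : ℚ) :
    heckePhi x₁ x₂ ∣[(2 : ℤ)] γ =
      heckePhi (x₁ * γ 0 0 + x₂ * γ 1 0) (x₁ * γ 0 1 + x₂ * γ 1 1) := by
  have hγ : γ ∈ Subgroup.closure {ModularGroup.S, ModularGroup.T} := by
    simp [SpecialLinearGroup.SL2Z_generators]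
  induction hγ using Subgroup.closure_induction generalizing x₁ x₂ with
  | one => simp
  | mem g hg =>
    simp only [Set.mem_insert_iff, Set.mem_singleton_iff] at hg
    rcases hg with rfl | rfl
    · rw [heckePhi_slash_S]; simp [ModularGroup.S]
    · rw [heckePhi_slash_T]; simp [ModularGroup.T]
  | mul g h _ _ ig ih =>
    rw [SlashAction.slash_mul, ig, ih]
    congr 1 <;> simp [Matrix.mul_apply, Fin.sum_univ_two] <;> ring
  | inv g _ ig =>
    have h := ig (x₁ * g⁻¹ 0 0 + x₂ * g⁻¹ 1 0) (x₁ * g⁻¹ 0 1 + x₂ * g⁻¹ 1 1)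
    have hdet : (g 0 0 : ℚ) * g 1 1 - g 0 1 * g 1 0 = 1 := by
      have := g.det_coe
      rw [Matrix.det_fin_two] at this
      exact_mod_cast this
    have e1 : (x₁ * g⁻¹ 0 0 + x₂ * g⁻¹ 1 0) * g 0 0 + (x₁ * g⁻¹ 0 1 + x₂ * g⁻¹ 1 1) * g 1 0
        = x₁ := by
      simp [Matrix.SpecialLinearGroup.SL2_inv_expl]
      linear_combination x₁ * hdet
    have e2 : (x₁ * g⁻¹ 0 0 + x₂ * g⁻¹ 1 0) * g 0 1 + (x₁ * g⁻¹ 0 1 + x₂ * g⁻¹ 1 1) * g 1 1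
        = x₂ := by
      simp [Matrix.SpecialLinearGroup.SL2_inv_expl]
      linear_combination x₂ * hdet
    rw [e1, e2] at h
    rw [← h, ← SlashAction.slash_mul, mul_inv_cancel, SlashAction.slash_one]

/-! ### Modular forms in the span of Hecke's functions -/

lemma opV_slash_S {d : ℕ} (hd : 0 < d) (g : ℍ → ℂ) :
    opV d (opV d g ∣[(2 : ℤ)] ModularGroup.S) = g ∣[(2 : ℤ)] ModularGroup.S := by
  ext z
  have hdC : (d : ℂ) ≠ 0 := by exact_mod_cast hd.ne'
  have hz := z.ne_zero
  rw [opV_apply hd, SlashInvariantForm.slash_S_apply, opV_apply hd,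
    SlashInvariantForm.slash_S_apply]
  have h : dil d (invPt (dil d z)) = invPt z := by
    ext
    rw [coe_dil hd]
    change (d : ℂ) * (-(dil d z : ℂ))⁻¹ = (-(z : ℂ))⁻¹
    rw [coe_dil hd]
    field_simp
  change (d : ℂ) * (d * g (dil d (invPt (dil d z))) * _) = g (invPt z) * _
  rw [h, coe_dil hd, zpow_neg, zpow_neg]
  norm_cast
  field_simp

lemma opV_mul_slash_S {d u : ℕ} (hd : 0 < d) (hu : 0 < u) (g : ℍ → ℂ) :
    opV (d * u) (opV d g ∣[(2 : ℤ)] ModularGroup.S) = opV u (g ∣[(2 : ℤ)] ModularGroup.S) := by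
  rw [← opV_opV hu hd, opV_slash_S hd]

/-- The action of `γ ∈ SL₂(ℤ)` in weight two, as a linear map. -/
def slashSL (γ : SL(2, ℤ)) : (ℍ → ℂ) →ₗ[ℂ] (ℍ → ℂ) where
  toFun g := g ∣[(2 : ℤ)] γ
  map_add' _ _ := SlashAction.add_slash _ _ _ _
  map_smul' _ _ := ModularForm.SL_smul_slash _ _ _ _

lemma slashSL_apply (γ : SL(2, ℤ)) (g : ℍ → ℂ) : slashSL γ g = g ∣[(2 : ℤ)] γ := rfl

/-- Distribution relation in the first coordinate; it is the image of the one in the second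
coordinate under `z ↦ -1 / z`. -/
lemma opV_sum_heckePhi_left {d : ℕ} (hd : 0 < d) (x₁ x₂ : ℚ) :
    opV d (∑ i ∈ Finset.range d, heckePhi ((x₁ + i) / d) x₂) = heckePhi x₁ x₂ := by
  have h : ∑ i ∈ Finset.range d, heckePhi ((x₁ + i) / d) x₂ =
      opV d (heckePhi (-x₂) x₁) ∣[(2 : ℤ)] ModularGroup.S := by
    rw [opV_heckePhi hd, ← slashSL_apply, map_sum]
    refine Finset.sum_congr rfl fun i _ => ?_
    rw [slashSL_apply, heckePhi_slash_S, neg_neg]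
  rw [h, opV_slash_S hd, heckePhi_slash_S, neg_neg]

lemma SL2_det (γ : SL(2, ℤ)) : γ 0 0 * γ 1 1 - γ 0 1 * γ 1 0 = 1 := by
  have := γ.det_coe
  rwa [Matrix.det_fin_two] at this

lemma slash_mem {g : ℍ → ℂ} (hg : g ∈ eisensteinAll) (γ : SL(2, ℤ)) :
    g ∣[(2 : ℤ)] γ ∈ eisensteinAll := by
  refine eisensteinAll_induction (p := fun g => g ∣[(2 : ℤ)] γ ∈ eisensteinAll) ?_ ?_ ?_ ?_ hg
  · intro x₁ x₂ h
    rw [heckePhi_slash]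
    refine heckePhi_mem ?_
    rintro ⟨⟨n, hn⟩, m, hm⟩
    have hdet : (γ 0 0 : ℚ) * γ 1 1 - γ 0 1 * γ 1 0 = 1 := by exact_mod_cast SL2_det γ
    refine h ⟨⟨n * γ 1 1 - m * γ 1 0, ?_⟩, ⟨m * γ 0 0 - n * γ 0 1, ?_⟩⟩
    · push_cast; rw [← hn, ← hm]; linear_combination -x₁ * hdet
    · push_cast; rw [← hn, ← hm]; linear_combination -x₂ * hdet
  · rw [← slashSL_apply, map_zero]; exact zero_mem _
  · intro g h hg hh
    rw [SlashAction.add_slash]; exact add_mem hg hh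
  · intro c g hg
    rw [← slashSL_apply, map_smul]; exact Submodule.smul_mem _ c hg

/-- Invariance in weight two under the group `Γ₀(N)`. -/
def IsGammaInv (N : ℕ) (g : ℍ → ℂ) : Prop :=
  ∀ γ ∈ CongruenceSubgroup.Gamma0 N, g ∣[(2 : ℤ)] γ = g

lemma mem_Gamma0_iff (N : ℕ) (γ : SL(2, ℤ)) :
    γ ∈ CongruenceSubgroup.Gamma0 N ↔ (N : ℤ) ∣ γ 1 0 := by
  rw [CongruenceSubgroup.Gamma0_mem, ZMod.intCast_zmod_eq_zero_iff_dvd]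

lemma IsGammaInv.of_dvd {N N' : ℕ} (h : N ∣ N') {g : ℍ → ℂ} (hg : IsGammaInv N g) :
    IsGammaInv N' g := by
  intro γ hγ
  refine hg γ ?_
  rw [mem_Gamma0_iff] at hγ ⊢
  exact (Int.natCast_dvd_natCast.2 h).trans hγ

lemma IsGammaInv.sub {N : ℕ} {g h : ℍ → ℂ} (hg : IsGammaInv N g) (hh : IsGammaInv N h) :
    IsGammaInv N (g - h) := by
  intro γ hγ
  rw [← slashSL_apply, map_sub, slashSL_apply, slashSL_apply, hg γ hγ, hh γ hγ]

lemma IsGammaInv.smul {N : ℕ} {g : ℍ → ℂ} (c : ℂ) (hg : IsGammaInv N g) :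
    IsGammaInv N (c • g) := by
  intro γ hγ
  rw [← slashSL_apply, map_smul, slashSL_apply, hg γ hγ]

lemma opV_slash {u : ℕ} (hu : 0 < u) (g : ℍ → ℂ) {γ γ' : SL(2, ℤ)} (h00 : γ' 0 0 = γ 0 0)
    (h01 : γ' 0 1 = u * γ 0 1) (h10 : u * γ' 1 0 = γ 1 0) (h11 : γ' 1 1 = γ 1 1) :
    opV u g ∣[(2 : ℤ)] γ = opV u (g ∣[(2 : ℤ)] γ') := by
  ext z
  have h10' : (γ 1 0 : ℂ) = u * γ' 1 0 := by rw [← h10]; push_cast; ring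
  rw [ModularForm.SL_slash_apply, opV_apply hu, opV_apply hu, ModularForm.SL_slash_apply,
    ModularGroup.denom_apply, ModularGroup.denom_apply, coe_dil hu]
  have h1 : dil u (γ • z) = γ' • dil u z := by
    ext
    rw [coe_dil hu, UpperHalfPlane.coe_specialLinearGroup_apply,
      UpperHalfPlane.coe_specialLinearGroup_apply, coe_dil hu, h00, h01, h11]
    simp only [algebraMap_int_eq, eq_intCast]
    push_cast
    rw [h10', mul_div_assoc']
    congr 1 <;> ring
  rw [h1, h11, h10', mul_assoc]
  congr 3
  ring

lemma IsGammaInv.opV {N p : ℕ} (hp : 0 < p) {g : ℍ → ℂ} (hg : IsGammaInv N g) :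
    IsGammaInv (N * p) (opV p g) := by
  intro γ hγ
  rw [mem_Gamma0_iff] at hγ
  obtain ⟨c, hc⟩ := hγ
  have hdet := SL2_det γ
  let γ' : SL(2, ℤ) := ⟨!![γ 0 0, p * γ 0 1; N * c, γ 1 1], by
    rw [Matrix.det_fin_two_of]
    push_cast at hc
    linear_combination hdet + γ 0 1 * hc⟩
  rw [opV_slash hp g (γ := γ) (γ' := γ') rfl rfl (by rw [hc]; simp [γ']; ring) rfl,
    hg γ' ((mem_Gamma0_iff _ _).2 ⟨c, by simp [γ']⟩)]

lemma IsGammaInv.isPeriodic {N : ℕ} {g : ℍ → ℂ} (hg : IsGammaInv N g) : IsPeriodic g := by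
  intro z w h
  have hT := congrFun (hg ModularGroup.T (by rw [mem_Gamma0_iff]; simp [ModularGroup.coe_T])) z
  rw [ModularForm.SL_slash_apply, ModularGroup.denom_apply] at hT
  have hw : w = ModularGroup.T • z := by
    ext; rw [h, UpperHalfPlane.modular_T_smul]; simp [add_comm]
  rw [hw, ← hT]
  simp [ModularGroup.coe_T]

/-- The cusps need not be examined: all the functions `g | γ` lie in the span of Hecke's
functions, whose members are bounded at infinity. -/
lemma mem_eisensteinSpace_iff {N : ℕ} [NeZero N] {g : ℍ → ℂ} :
    g ∈ eisensteinSpace N ↔ IsGammaInv N g ∧ g ∈ eisensteinAll := by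
  constructor
  · rintro ⟨⟨F, rfl⟩, hF⟩
    refine ⟨fun γ hγ => ?_, hF⟩
    exact F.slash_action_eq' _ (Subgroup.mem_map_of_mem _ hγ)
  · rintro ⟨hinv, hmem⟩
    refine ⟨⟨⟨⟨g, ?_⟩, mdifferentiable_of_mem hmem, ?_⟩, rfl⟩, hmem⟩
    · rintro _ ⟨γ, hγ, rfl⟩
      exact hinv γ hγ
    · intro c hc
      have hc' : IsCusp c (Matrix.SpecialLinearGroup.mapGL ℝ).range :=
        hc.mono (by rintro _ ⟨γ, -, rfl⟩; exact ⟨γ, rfl⟩)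
      rw [OnePoint.isBoundedAt_iff_forall_SL2Z hc']
      intro γ _
      obtain ⟨A, hA⟩ := hasAsymp_of_mem (slash_mem hmem γ)
      exact hA.isBoundedAtImInfty

/-! ### The series attached to a primitive character -/

lemma sum_range_mul_eq {M : Type*} [AddCommMonoid M] (d n : ℕ) (F : ℕ → M) :
    ∑ j ∈ Finset.range (d * n), F j =
      ∑ i ∈ Finset.range d, ∑ r ∈ Finset.range n, F (r + n * i) := by
  induction d with
  | zero => simp
  | succ d ih =>
    rw [add_mul, one_mul, Finset.sum_range_add, ih, Finset.sum_range_succ]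
    congr 1
    exact Finset.sum_congr rfl fun r _ => by rw [add_comm, mul_comm]

lemma sum_zmod_val {M : Type*} [AddCommMonoid M] (n : ℕ) [NeZero n] (F : ℕ → M) :
    ∑ a : ZMod n, F a.val = ∑ i ∈ Finset.range n, F i := by
  obtain ⟨k, rfl⟩ := Nat.exists_eq_succ_of_ne_zero (NeZero.ne n)
  exact Fin.sum_univ_eq_sum_range F (k + 1)

lemma sum_units_zmod {M : Type*} [AddCommMonoid M] (n : ℕ) [NeZero n] (F : ZMod n → M)
    (h : ∀ a, ¬ IsUnit a → F a = 0) : ∑ u : (ZMod n)ˣ, F u = ∑ a, F a := by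
  refine Finset.sum_of_injOn (fun u : (ZMod n)ˣ => (u : ZMod n)) (fun _ _ _ _ h => Units.ext h)
    (fun _ _ => Finset.mem_coe.2 (Finset.mem_univ _)) (fun a _ ha => h a ?_) (fun _ _ => rfl)
  rintro ⟨u, rfl⟩
  exact ha ⟨u, by simp, rfl⟩

variable {f : ℕ} (χ : DirichletCharacter ℂ f)

lemma char_add_mul (r i : ℕ) : χ ((r + f * i : ℕ) : ZMod f) = χ (r : ZMod f) := by
  push_cast; simp

/-- Summing the second coordinate over the multiples of `1 / (e f)` with periodic weights. -/
lemma opV_sum_right {f e : ℕ} (hf : 0 < f) (he : 0 < e) (c : ℕ → ℂ)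
    (hc : ∀ r i, c (r + f * i) = c r) (x₁ : ℚ) :
    opV e (∑ r ∈ Finset.range f, c r • heckePhi x₁ (r / f)) =
      ∑ j ∈ Finset.range (e * f), c j • heckePhi x₁ (j / (e * f)) := by
  have hfQ : (f : ℚ) ≠ 0 := by exact_mod_cast hf.ne'
  have heQ : (e : ℚ) ≠ 0 := by exact_mod_cast he.ne'
  rw [sum_range_mul_eq, Finset.sum_comm, map_sum]
  refine Finset.sum_congr rfl fun r _ => ?_
  rw [map_smul, opV_heckePhi he, Finset.smul_sum]
  refine Finset.sum_congr rfl fun i _ => ?_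
  rw [hc]
  congr 2
  push_cast; field_simp

/-- Summing the first coordinate over the multiples of `1 / (e f)` with periodic weights. -/
lemma opV_sum_left {f e : ℕ} (hf : 0 < f) (he : 0 < e) (c : ℕ → ℂ)
    (hc : ∀ r i, c (r + f * i) = c r) (x₂ : ℚ) :
    opV e (∑ j ∈ Finset.range (e * f), c j • heckePhi (j / (e * f)) x₂) =
      ∑ r ∈ Finset.range f, c r • heckePhi (r / f) x₂ := by
  have hfQ : (f : ℚ) ≠ 0 := by exact_mod_cast hf.ne'
  have heQ : (e : ℚ) ≠ 0 := by exact_mod_cast he.ne'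
  rw [sum_range_mul_eq, Finset.sum_comm, map_sum]
  refine Finset.sum_congr rfl fun r _ => ?_
  rw [← opV_sum_heckePhi_left he (r / f) x₂, ← map_smul, Finset.smul_sum]
  congr 1
  refine Finset.sum_congr rfl fun i _ => ?_
  rw [hc]
  congr 2
  push_cast; field_simp

/-- The sum `∑ χ(a) χ(b) φ_{(a/f, b/f)}`, which is invariant under `Γ₀(f) ∩ Γ⁰(f)`. -/
def eisAux : ℍ → ℂ :=
  ∑ a ∈ Finset.range f, ∑ b ∈ Finset.range f,
    (χ (a : ZMod f) * χ (b : ZMod f)) • heckePhi (a / f) (b / f)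

lemma opV_eisAux (hf : 0 < f) {e : ℕ} (he : 0 < e) :
    opV e (eisAux χ) = ∑ a ∈ Finset.range f, ∑ b ∈ Finset.range (e * f),
      (χ (a : ZMod f) * χ (b : ZMod f)) • heckePhi (a / f) (b / (e * f)) := by
  rw [eisAux, map_sum]
  refine Finset.sum_congr rfl fun a _ => ?_
  exact opV_sum_right hf he (fun b => χ (a : ZMod f) * χ (b : ZMod f))
    (fun r i => by simp only [char_add_mul]) _

/-- The sum over all residues of division points `(i / (d f), j / (e f))` is reduced by the
distribution relations to the series `eisAux`. -/
lemma opV_sum_sum {d e : ℕ} (hf : 0 < f) (hd : 0 < d) (he : 0 < e) :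
    opV d (∑ i ∈ Finset.range (d * f), ∑ j ∈ Finset.range (e * f),
      (χ (i : ZMod f) * χ (j : ZMod f)) • heckePhi (i / (d * f)) (j / (e * f))) =
      opV e (eisAux χ) := by
  rw [opV_eisAux χ hf he, Finset.sum_comm, map_sum, Finset.sum_comm]
  refine Finset.sum_congr rfl fun j _ => ?_
  exact opV_sum_left hf hd (fun i => χ (i : ZMod f) * χ (j : ZMod f))
    (fun r i => by simp only [char_add_mul]) _

/-- The points `b / f²` are the `f`-division points of the `b / f`, so the distribution relation turns
`E_χ` into the image of a sum over `(f⁻¹ℤ/ℤ)²`. -/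
lemma eisChi_eq [NeZero f] :
    eisChi χ = (-1 / (2 * gaussSum χ ZMod.stdAddChar)) • opV f (eisAux χ) := by
  have hf : 0 < f := Nat.pos_of_ne_zero (NeZero.ne f)
  rw [eisChi, opV_eisAux χ hf hf]
  congr 1
  have h1 : ∀ (a : ZMod f), ∑ b : (ZMod (f ^ 2))ˣ,
      (χ a * χ (((b : ZMod (f ^ 2)).val : ℕ) : ZMod f)) •
        heckePhi ((a.val : ℚ) / (f : ℚ)) (((b : ZMod (f ^ 2)).val : ℚ) / (f : ℚ) ^ 2) =
      ∑ b ∈ Finset.range (f * f),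
        (χ a * χ (b : ZMod f)) • heckePhi ((a.val : ℚ) / f) (b / (f * f)) := by
    intro a
    rw [sum_units_zmod (f ^ 2) (fun b : ZMod (f ^ 2) => (χ a * χ ((b.val : ℕ) : ZMod f)) •
        heckePhi ((a.val : ℚ) / (f : ℚ)) ((b.val : ℚ) / (f : ℚ) ^ 2)),
      sum_zmod_val (f ^ 2) (fun b => (χ a * χ (b : ZMod f)) •
        heckePhi ((a.val : ℚ) / (f : ℚ)) ((b : ℚ) / (f : ℚ) ^ 2)), pow_two, pow_two]
    intro b hb
    have : ¬ IsUnit ((b.val : ℕ) : ZMod f) := by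
      rw [ZMod.isUnit_iff_coprime]
      intro h
      apply hb
      rw [← ZMod.natCast_zmod_val b, ZMod.isUnit_iff_coprime]
      exact h.pow_right 2
    rw [MulChar.map_nonunit _ this, mul_zero, zero_smul]
  rw [Finset.sum_congr rfl fun (a : (ZMod f)ˣ) _ => h1 a,
    sum_units_zmod f (fun a => ∑ b ∈ Finset.range (f * f),
        (χ a * χ (b : ZMod f)) • heckePhi ((a.val : ℚ) / f) (b / (f * f))),
    ← sum_zmod_val f]
  · simp only [ZMod.natCast_zmod_val]
  · intro a ha
    refine Finset.sum_eq_zero fun b _ => ?_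
    rw [MulChar.map_nonunit _ ha, zero_mul, zero_smul]

/-- `φ_{(a/f, b/f)}` for residue classes `a`, `b` modulo `f`. -/
def phiZ (f : ℕ) (a b : ZMod f) : ℍ → ℂ := heckePhi (a.val / f) (b.val / f)

lemma exists_intCast_div {f : ℕ} (hf : 0 < f) (m : ℤ) :
    ∃ k : ℤ, (m : ℚ) / f = ((m : ZMod f).val : ℚ) / f + k := by
  have hfQ : (f : ℚ) ≠ 0 := by exact_mod_cast hf.ne'
  have : NeZero f := ⟨hf.ne'⟩
  refine ⟨m / f, ?_⟩
  have h1 : ((m : ZMod f).val : ℤ) = m % f := ZMod.val_intCast m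
  have h2 : (m : ℚ) = ((m : ZMod f).val : ℚ) + f * ((m / f : ℤ) : ℚ) := by
    have := Int.emod_add_mul_ediv m f
    rw [← h1] at this
    exact_mod_cast this.symm
  field_simp
  exact h2

lemma phiZ_intCast {f : ℕ} (hf : 0 < f) (m n : ℤ) :
    phiZ f (m : ZMod f) (n : ZMod f) = heckePhi (m / f) (n / f) := by
  obtain ⟨k, hk⟩ := exists_intCast_div hf m
  obtain ⟨l, hl⟩ := exists_intCast_div hf n
  rw [phiZ, hk, hl, heckePhi_add_int]

lemma phiZ_slash {f : ℕ} (hf : 0 < f) (a b : ZMod f) (γ : SL(2, ℤ)) :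
    phiZ f a b ∣[(2 : ℤ)] γ = phiZ f (a * (γ 0 0 : ℤ) + b * (γ 1 0 : ℤ))
      (a * (γ 0 1 : ℤ) + b * (γ 1 1 : ℤ)) := by
  have : NeZero f := ⟨hf.ne'⟩
  have hfQ : (f : ℚ) ≠ 0 := by exact_mod_cast hf.ne'
  have h := phiZ_intCast hf ((a.val : ℤ) * γ 0 0 + (b.val : ℤ) * γ 1 0)
    ((a.val : ℤ) * γ 0 1 + (b.val : ℤ) * γ 1 1)
  push_cast at h
  simp only [ZMod.natCast_zmod_val] at h
  rw [h, phiZ, heckePhi_slash]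
  congr 1 <;> ring

lemma eisAux_eq [NeZero f] :
    eisAux χ = ∑ a : ZMod f, ∑ b : ZMod f, (χ a * χ b) • phiZ f a b := by
  rw [eisAux, ← sum_zmod_val f]
  refine Finset.sum_congr rfl fun a _ => ?_
  rw [← sum_zmod_val f]
  simp only [ZMod.natCast_zmod_val, phiZ]

lemma eisAux_slash [NeZero f] (γ : SL(2, ℤ)) :
    eisAux χ ∣[(2 : ℤ)] γ = ∑ a : ZMod f, ∑ b : ZMod f, (χ a * χ b) •
      phiZ f (a * (γ 0 0 : ℤ) + b * (γ 1 0 : ℤ)) (a * (γ 0 1 : ℤ) + b * (γ 1 1 : ℤ)) := by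
  rw [eisAux_eq, ← slashSL_apply]
  simp only [map_sum, map_smul, slashSL_apply, phiZ_slash (Nat.pos_of_ne_zero (NeZero.ne f))]

lemma eisAux_slash_S [NeZero f] :
    eisAux χ ∣[(2 : ℤ)] ModularGroup.S = χ (-1) • eisAux χ := by
  rw [eisAux_slash, eisAux_eq, Finset.sum_comm, Finset.smul_sum]
  refine Finset.sum_congr rfl fun a _ => ?_
  rw [Finset.smul_sum, ← Equiv.sum_comp (Equiv.neg (ZMod f))]
  refine Finset.sum_congr rfl fun b _ => ?_
  have h : χ (-b) = χ (-1) * χ b := by rw [← map_mul, neg_one_mul]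
  simp only [Equiv.neg_apply, h, ModularGroup.coe_S, Matrix.of_apply, Matrix.cons_val_zero,
    Matrix.cons_val_one, Int.cast_zero, Int.cast_one, Int.cast_neg, mul_zero, mul_one, zero_add,
    add_zero, smul_smul, mul_neg, neg_neg]
  congr 1
  ring

/-- A diagonal matrix modulo `f` permutes the summands by `(a, b) ↦ (u a, u⁻¹ b)`. -/
lemma eisAux_slash_diag [NeZero f] {γ : SL(2, ℤ)} (h01 : (f : ℤ) ∣ γ 0 1)
    (h10 : (f : ℤ) ∣ γ 1 0) : eisAux χ ∣[(2 : ℤ)] γ = eisAux χ := by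
  have hdet : ((γ 0 0 : ℤ) : ZMod f) * ((γ 1 1 : ℤ) : ZMod f) = 1 := by
    have h := congrArg (Int.cast : ℤ → ZMod f) (SL2_det γ)
    push_cast at h
    rwa [(ZMod.intCast_zmod_eq_zero_iff_dvd _ _).2 h01, zero_mul, sub_zero] at h
  let u : (ZMod f)ˣ := ⟨(γ 0 0 : ℤ), (γ 1 1 : ℤ), hdet, by rw [mul_comm]; exact hdet⟩
  rw [eisAux_slash, eisAux_eq]
  simp only [(ZMod.intCast_zmod_eq_zero_iff_dvd _ _).2 h01,
    (ZMod.intCast_zmod_eq_zero_iff_dvd _ _).2 h10, mul_zero, add_zero, zero_add]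
  rw [← Equiv.sum_comp (Units.mulRight u⁻¹)]
  refine Finset.sum_congr rfl fun a _ => ?_
  rw [← Equiv.sum_comp (Units.mulRight u)]
  refine Finset.sum_congr rfl fun b _ => ?_
  have e1 : (((u⁻¹ : (ZMod f)ˣ)) : ZMod f) = ((γ 1 1 : ℤ) : ZMod f) := rfl
  have e2 : ((u : (ZMod f)ˣ) : ZMod f) = ((γ 0 0 : ℤ) : ZMod f) := rfl
  have e3 : χ ((γ 1 1 : ℤ) : ZMod f) * χ ((γ 0 0 : ℤ) : ZMod f) = 1 := by
    rw [← map_mul, mul_comm, hdet, map_one]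
  simp only [Units.mulRight_apply, e1, e2, map_mul]
  rw [mul_assoc a, mul_assoc b, hdet, mul_comm ((γ 1 1 : ℤ) : ZMod f), hdet, mul_one, mul_one]
  congr 1
  linear_combination (χ a * χ b) * e3

lemma isGammaInv_eisChi [NeZero f] : IsGammaInv (f ^ 2) (eisChi χ) := by
  rw [eisChi_eq]
  refine IsGammaInv.smul _ ?_
  intro γ hγ
  rw [mem_Gamma0_iff] at hγ
  obtain ⟨c, hc⟩ := hγ
  have hdet := SL2_det γ
  let γ' : SL(2, ℤ) := ⟨!![γ 0 0, f * γ 0 1; f * c, γ 1 1], by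
    rw [Matrix.det_fin_two_of]
    push_cast at hc
    linear_combination hdet + γ 0 1 * hc⟩
  rw [opV_slash (Nat.pos_of_ne_zero (NeZero.ne f)) _ (γ := γ) (γ' := γ') rfl rfl
      (by rw [hc]; simp [γ']; ring) rfl,
    eisAux_slash_diag χ ⟨γ 0 1, by simp [γ']⟩ ⟨c, by simp [γ']⟩]

/-- Otherwise the discrete Fourier transform of `χ` would vanish. -/
lemma gaussSum_ne_zero [NeZero f] {χ : DirichletCharacter ℂ f} (hχ : χ.IsPrimitive) :
    gaussSum χ ZMod.stdAddChar ≠ 0 := by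
  intro h
  have h1 : ZMod.dft (χ : ZMod f → ℂ) = 0 := by
    ext k
    rw [hχ.fourierTransform_eq_inv_mul_gaussSum, h, mul_zero]
    rfl
  have h2 : (χ : ZMod f → ℂ) = 0 := ZMod.dft.map_eq_zero_iff.1 h1
  have h3 := congrFun h2 1
  simp at h3

/-! ### Fourier expansions and Hecke eigenvalues of the series `E_χ` -/

variable {f : ℕ} (χ : DirichletCharacter ℂ f)

/-- The coefficient `j χ(j) χ⁻¹(m)` of the double series of `E_χ`. -/
def eisCoeff (p : ℕ+ × ℕ+) : ℂ :=
  (p.1 : ℂ) * χ ((p.1 : ℕ) : ZMod f) * χ⁻¹ ((p.2 : ℕ) : ZMod f)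

lemma norm_eisCoeff_le (p : ℕ+ × ℕ+) : ‖eisCoeff χ p‖ ≤ 1 * p.1 := by
  rw [eisCoeff, norm_mul, norm_mul, Complex.norm_natCast, mul_assoc, mul_comm (1 : ℝ)]
  refine mul_le_mul_of_nonneg_left ?_ (Nat.cast_nonneg _)
  exact mul_le_one₀ (DirichletCharacter.norm_le_one _ _) (norm_nonneg _)
    (DirichletCharacter.norm_le_one _ _)

/-- The double series `∑ j χ(j) χ⁻¹(m) q^{j m}`. -/
def eisDouble (z : ℍ) : ℂ := ∑' p : ℕ+ × ℕ+, eisCoeff χ p * ee (p.1 * p.2 * z)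

lemma summable_eisDouble (z : ℍ) :
    Summable fun p : ℕ+ × ℕ+ => eisCoeff χ p * ee (p.1 * p.2 * z) := by
  simpa using dser_summable (norm_eisCoeff_le χ) one_pos z

lemma gaussSum_twist [NeZero f] {χ : DirichletCharacter ℂ f} (hχ : χ.IsPrimitive) (m : ℕ) :
    ∑ b ∈ Finset.range f, χ (b : ZMod f) * ee (m * b / f) =
      χ⁻¹ (m : ZMod f) * gaussSum χ ZMod.stdAddChar := by
  rw [← gaussSum_mulShift_of_isPrimitive _ hχ, gaussSum,
    ← sum_zmod_val f (fun b => χ (b : ZMod f) * ee (m * b / f))]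
  refine Finset.sum_congr rfl fun b _ => ?_
  have h := ZMod.stdAddChar_coe (N := f) ((m : ℤ) * b.val)
  push_cast at h
  rw [ZMod.natCast_zmod_val] at h
  rw [ZMod.natCast_zmod_val, AddChar.mulShift_apply, h, ee]
  congr 2
  ring

lemma sum_char_delta [NeZero f] (j : ℕ+) :
    ∑ a ∈ Finset.range f, χ (a : ZMod f) * (if (f : ℤ) ∣ (j : ℤ) - (a : ℤ) then 1 else 0) =
      χ ((j : ℕ) : ZMod f) := by
  rw [← sum_zmod_val f (fun a => χ (a : ZMod f) *
    (if (f : ℤ) ∣ (j : ℤ) - (a : ℤ) then (1 : ℂ) else 0)),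
    Finset.sum_eq_single ((j : ℕ) : ZMod f)]
  · rw [ZMod.natCast_zmod_val, if_pos, mul_one]
    rw [← ZMod.intCast_eq_intCast_iff_dvd_sub]
    push_cast
    rw [ZMod.natCast_zmod_val]
  · intro a _ ha
    rw [if_neg, mul_zero]
    rw [← ZMod.intCast_eq_intCast_iff_dvd_sub]
    push_cast
    rwa [ZMod.natCast_zmod_val]
  · simp

/-- The sum over `a` selects the residue of `j`, and the sum over `b` is a Gauss sum. -/
lemma sum_sum_heckeP [NeZero f] {χ : DirichletCharacter ℂ f} (hχ : χ.IsPrimitive) (z : ℍ) :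
    (f : ℂ) * ∑ a ∈ Finset.range f, ∑ b ∈ Finset.range f,
      χ (a : ZMod f) * χ (b : ZMod f) * heckeP (a / f) (b / f) (dil f z) =
      gaussSum χ ZMod.stdAddChar * eisDouble χ z := by
  have hf : 0 < f := Nat.pos_of_ne_zero (NeZero.ne f)
  have hfC : (f : ℂ) ≠ 0 := by exact_mod_cast hf.ne'
  have h1 : ∀ a b : ℕ, heckeP (a / f) (b / f) (dil f z) =
      ∑' p : ℕ+ × ℕ+, heckeCoeff f a (b / f) p * ee (p.1 * p.2 * z) := by
    intro a b
    have := heckeP_eq_tsum hf a (b / f) (dil f z)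
    rw [Int.cast_natCast] at this
    rw [this]
    refine tsum_congr fun p => ?_
    rw [coe_dil hf]
    congr 2
    field_simp
  have hs : ∀ a b : ℕ, Summable fun p : ℕ+ × ℕ+ => heckeCoeff f a (b / f) p *
      ee (p.1 * p.2 * z) := by
    intro a b
    refine (dser_summable (norm_heckeCoeff_le hf a (b / f)) hf (dil f z)).congr fun p => ?_
    rw [coe_dil hf]
    congr 2
    field_simp
  simp only [h1, ← tsum_mul_left]
  rw [Finset.sum_congr rfl fun a _ => (Summable.tsum_finsetSum fun b _ =>
      (hs a b).mul_left (χ (a : ZMod f) * χ (b : ZMod f))).symm,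
    ← Summable.tsum_finsetSum, eisDouble, ← tsum_mul_left, ← tsum_mul_left]
  · refine tsum_congr fun p => ?_
    have e : ∀ a b : ℕ, χ (a : ZMod f) * χ (b : ZMod f) * (heckeCoeff f a (b / f) p *
        ee (p.1 * p.2 * z)) = (p.1 / f * ee (p.1 * p.2 * z)) *
        ((χ (a : ZMod f) * (if (f : ℤ) ∣ (p.1 : ℤ) - (a : ℤ) then 1 else 0)) *
          (χ (b : ZMod f) * ee ((p.2 : ℕ) * b / f))) := by
      intro a b
      rw [heckeCoeff]
      split_ifs
      · push_cast
        rw [mul_div_assoc]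
        ring
      · simp
    simp only [e, ← Finset.mul_sum, gaussSum_twist hχ]
    rw [← Finset.sum_mul, sum_char_delta, eisCoeff]
    field_simp
  · intro a _
    exact summable_sum fun b _ => (hs a b).mul_left _

/-- Replacing `(a, b)` by `(-a, -b)` in a sum over residue classes. -/
lemma sum_sum_heckeP_neg [NeZero f] (z : ℍ) :
    ∑ a ∈ Finset.range f, ∑ b ∈ Finset.range f,
      χ (a : ZMod f) * χ (b : ZMod f) * heckeP (-(a / f)) (-(b / f)) z =
    ∑ a ∈ Finset.range f, ∑ b ∈ Finset.range f,
      χ (a : ZMod f) * χ (b : ZMod f) * heckeP (a / f) (b / f) z := by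
  have hf : 0 < f := Nat.pos_of_ne_zero (NeZero.ne f)
  have hneg : ∀ a b : ZMod f, heckeP (-(((-a).val : ℚ) / f)) (-(((-b).val : ℚ) / f)) =
      heckeP ((a.val : ℚ) / f) ((b.val : ℚ) / f) := by
    intro a b
    obtain ⟨k, hk⟩ := exists_intCast_div hf (-((-a).val : ℤ))
    obtain ⟨l, hl⟩ := exists_intCast_div hf (-((-b).val : ℤ))
    push_cast at hk hl
    rw [ZMod.natCast_zmod_val, neg_neg, neg_div] at hk hl
    rw [hk, hl, heckeP_add_int_left, heckeP_add_int_right]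
  have hχ2 : χ (-1) * χ (-1) = 1 := by rw [← map_mul]; simp
  have hχn : ∀ a, χ (-a) = χ (-1) * χ a := fun a => by rw [← map_mul, neg_one_mul]
  have conv : ∀ F : ℚ → ℚ → ℂ, ∑ a ∈ Finset.range f, ∑ b ∈ Finset.range f,
      χ (a : ZMod f) * χ (b : ZMod f) * F ((a : ℚ) / f) ((b : ℚ) / f) =
      ∑ a : ZMod f, ∑ b : ZMod f, χ a * χ b * F ((a.val : ℚ) / f) ((b.val : ℚ) / f) := by
    intro F
    rw [← sum_zmod_val f]
    refine Finset.sum_congr rfl fun a _ => ?_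
    rw [← sum_zmod_val f]
    simp only [ZMod.natCast_zmod_val]
  rw [conv (fun x y => heckeP (-x) (-y) z), conv (fun x y => heckeP x y z),
    ← Equiv.sum_comp (Equiv.neg (ZMod f))]
  refine Finset.sum_congr rfl fun a _ => ?_
  rw [← Equiv.sum_comp (Equiv.neg (ZMod f))]
  refine Finset.sum_congr rfl fun b _ => ?_
  simp only [Equiv.neg_apply]
  rw [hneg, hχn a, hχn b]
  linear_combination (χ a * χ b * heckeP ((a.val : ℚ) / f) ((b.val : ℚ) / f) z) * hχ2

lemma ne_one_of_isPrimitive [NeZero f] {χ : DirichletCharacter ℂ f} (hχ : χ.IsPrimitive)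
    (hf : f ≠ 1) : χ ≠ 1 := by
  rintro rfl
  rw [DirichletCharacter.isPrimitive_def, DirichletCharacter.conductor_one] at hχ
  exact hf hχ.symm

lemma sum_range_char_eq_zero [NeZero f] {χ : DirichletCharacter ℂ f} (hχ : χ ≠ 1) :
    ∑ b ∈ Finset.range f, χ (b : ZMod f) = 0 := by
  rw [← sum_zmod_val f (fun b => χ (b : ZMod f))]
  simp only [ZMod.natCast_zmod_val]
  exact MulChar.sum_eq_zero_of_ne_one hχ

/-- For `f ≠ 1` the weights `χ(a) χ(b)` are supported on non-integral points. -/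
lemma not_isIntegral_of_char_ne_zero {a b : ℕ} (ha : a < f) (hf : f ≠ 1)
    (h : χ (a : ZMod f) ≠ 0) : ¬ IsIntegral ((a : ℚ) / f) ((b : ℚ) / f) := by
  rintro ⟨⟨n, hn⟩, -⟩
  have hfpos : 0 < f := by omega
  have hfQ : (f : ℚ) ≠ 0 := by exact_mod_cast hfpos.ne'
  rw [div_eq_iff hfQ] at hn
  have hn' : (a : ℤ) = n * f := by exact_mod_cast hn
  have ha0 : a = 0 := by
    have : f ∣ a := by
      have : (f : ℤ) ∣ a := ⟨n, by rw [hn', mul_comm]⟩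
      exact_mod_cast this
    exact Nat.eq_zero_of_dvd_of_lt this ha
  rw [ha0, MulChar.map_nonunit] at h
  · exact h rfl
  · rw [ZMod.isUnit_iff_coprime, Nat.coprime_zero_left]
    exact hf

/-- For `f ≠ 1` no `φ_0` occurs in `E_χ`. -/
lemma eisChi_mem [NeZero f] (hf : f ≠ 1) : eisChi χ ∈ eisensteinAll := by
  have hfpos : 0 < f := Nat.pos_of_ne_zero (NeZero.ne f)
  rw [eisChi_eq]
  refine Submodule.smul_mem _ _ (opV_mem hfpos ?_)
  rw [eisAux]
  refine Submodule.sum_mem _ fun a ha => Submodule.sum_mem _ fun b _ => ?_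
  by_cases h : χ (a : ZMod f) = 0
  · rw [h, zero_mul, zero_smul]; exact zero_mem _
  · exact Submodule.smul_mem _ _ (heckePhi_mem
      (not_isIntegral_of_char_ne_zero χ (Finset.mem_range.1 ha) hf h))

/-- The Fourier expansion of `E_χ`: up to the constant term and, for the trivial character, a
multiple of `1 / y`, it is the double series `eisDouble`. -/
lemma exists_eisChi_eq [NeZero f] {χ : DirichletCharacter ℂ f} (hχ : χ.IsPrimitive) :
    ∃ A B : ℂ, (f ≠ 1 → A = 0 ∧ B = 0) ∧
      ∀ z : ℍ, eisChi χ z = A + B / z.im + eisDouble χ z := by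
  have hfpos : 0 < f := Nat.pos_of_ne_zero (NeZero.ne f)
  have hfC : (f : ℂ) ≠ 0 := by exact_mod_cast hfpos.ne'
  have hg := gaussSum_ne_zero hχ
  have hpi : (Real.pi : ℂ) ≠ 0 := by exact_mod_cast Real.pi_ne_zero
  set κ := -1 / (2 * gaussSum χ ZMod.stdAddChar) with hκ
  set SB : ℂ := ∑ a ∈ Finset.range f, ∑ b ∈ Finset.range f,
    χ (a : ZMod f) * χ (b : ZMod f) * (((bernoulliTwo ((a : ℚ) / f) : ℚ) : ℂ) / 2) with hSB
  set SD : ℂ := ∑ a ∈ Finset.range f, ∑ b ∈ Finset.range f,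
    χ (a : ZMod f) * χ (b : ZMod f) * intDelta ((a : ℚ) / f) ((b : ℚ) / f) with hSD
  refine ⟨κ * f * SB, -κ * SD / (4 * Real.pi), ?_, ?_⟩
  · intro hf
    have h1 : SB = 0 := by
      rw [hSB]
      refine Finset.sum_eq_zero fun a _ => ?_
      rw [← Finset.sum_mul, ← Finset.mul_sum,
        sum_range_char_eq_zero (ne_one_of_isPrimitive hχ hf), mul_zero, zero_mul]
    have h2 : SD = 0 := by
      rw [hSD]
      refine Finset.sum_eq_zero fun a ha => Finset.sum_eq_zero fun b _ => ?_
      by_cases h : χ (a : ZMod f) = 0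
      · rw [h]; ring
      · rw [intDelta_of_not (not_isIntegral_of_char_ne_zero χ (Finset.mem_range.1 ha) hf h),
          mul_zero]
    rw [h1, h2]
    constructor <;> ring
  · intro z
    have hy : (z.im : ℂ) ≠ 0 := by exact_mod_cast z.im_pos.ne'
    have hP := sum_sum_heckeP hχ z
    have hN := sum_sum_heckeP_neg χ (dil f z)
    rw [eisChi_eq, Pi.smul_apply, opV_apply hfpos, eisAux, smul_eq_mul, ← hκ]
    have e : (∑ a ∈ Finset.range f, ∑ b ∈ Finset.range f,
        (χ (a : ZMod f) * χ (b : ZMod f)) • heckePhi (a / f) (b / f)) (dil f z) =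
        SB - SD * (1 / (4 * Real.pi * (f * z.im))) - ∑ a ∈ Finset.range f, ∑ b ∈ Finset.range f,
          χ (a : ZMod f) * χ (b : ZMod f) * heckeP (a / f) (b / f) (dil f z) -
        ∑ a ∈ Finset.range f, ∑ b ∈ Finset.range f,
          χ (a : ZMod f) * χ (b : ZMod f) * heckeP (-(a / f)) (-(b / f)) (dil f z) := by
      rw [hSB, hSD, Finset.sum_mul]
      simp only [Finset.sum_apply, Finset.sum_mul, ← Finset.sum_sub_distrib]
      refine Finset.sum_congr rfl fun a _ => Finset.sum_congr rfl fun b _ => ?_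
      rw [Pi.smul_apply, heckePhi_apply, smul_eq_mul, im_dil hfpos]
      push_cast
      ring
    rw [e, hN]
    have hκg : κ * gaussSum χ ZMod.stdAddChar = -1 / 2 := by
      rw [hκ]; field_simp
    have h3 : κ * ((f : ℂ) * (SD * (1 / (4 * Real.pi * (f * z.im))))) =
        κ * SD / (4 * Real.pi) / z.im := by
      field_simp
    linear_combination (-2 * κ) * hP - h3 - 2 * eisDouble χ z * hκg

section Eigenvalues

variable {f : ℕ} (χ : DirichletCharacter ℂ f)

/-- `U_l` keeps the exponents `j m` divisible by `l`, which are counted by inclusion and exclusion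
as those with `l ∣ j`, those with `l ∣ m`, and those with both. -/
lemma opU_eisDouble {l : ℕ} (hl : l.Prime) :
    opU l (eisDouble χ) = (χ⁻¹ (l : ZMod f) + l * χ (l : ZMod f)) • eisDouble χ -
      (χ (l : ZMod f) * χ⁻¹ (l : ZMod f)) • opV l (eisDouble χ) := by
  have hl0 := hl.pos
  have hlC : (l : ℂ) ≠ 0 := by exact_mod_cast hl0.ne'
  ext z
  rw [opU_apply hl0, Pi.sub_apply, Pi.smul_apply, Pi.smul_apply, opV_apply hl0, smul_eq_mul,
    smul_eq_mul]
  set G : ℕ+ × ℕ+ → ℂ := fun p => eisCoeff χ p * ee (p.1 * p.2 * z / l) with hG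
  let lp : ℕ+ := ⟨l, hl0⟩
  have hind : ∀ (P : ℕ+ × ℕ+ → Prop) [DecidablePred P], Summable fun p => if P p then G p else 0 := by
    intro P _
    have h := dser_summable (c := fun p => if P p then eisCoeff χ p else 0) (C := 1)
      (fun p => by
        split_ifs
        · exact norm_eisCoeff_le χ p
        · simp) hl0 z
    refine h.congr fun p => ?_
    split_ifs <;> simp [hG]
  -- the left hand side
  have h1 : (l : ℂ)⁻¹ * ∑ k ∈ Finset.range l, eisDouble χ (upperMat 1 k l • z) =
      ∑' p : ℕ+ × ℕ+, if l ∣ (p.1 * p.2 : ℕ) then G p else 0 := by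
    simp only [eisDouble]
    rw [← Summable.tsum_finsetSum fun k _ => summable_eisDouble χ _, ← tsum_mul_left]
    refine tsum_congr fun p => ?_
    have h2 : ∀ k : ℕ, eisCoeff χ p * ee (p.1 * p.2 * (upperMat 1 k l • z : ℍ)) =
        G p * ee (((p.1 * p.2 : ℕ) : ℤ) * k / l) := by
      intro k
      rw [coe_upperMat_smul k one_pos hl0, hG]
      simp only
      rw [mul_assoc (eisCoeff χ p), ← ee_add]
      congr 2
      push_cast; ring
    rw [Finset.sum_congr rfl fun k _ => h2 k, ← Finset.mul_sum, sum_range_ee hl0]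
    simp only [Int.natCast_dvd_natCast]
    split_ifs
    · field_simp
    · ring
  have h2 : ∀ p : ℕ+ × ℕ+, (if l ∣ (p.1 * p.2 : ℕ) then G p else 0) =
      ((if l ∣ (p.1 : ℕ) then G p else 0) + (if l ∣ (p.2 : ℕ) then G p else 0)) -
        (if l ∣ (p.1 : ℕ) ∧ l ∣ (p.2 : ℕ) then G p else 0) := by
    intro p
    simp only [hl.dvd_mul]
    by_cases ha : l ∣ (p.1 : ℕ) <;> by_cases hb : l ∣ (p.2 : ℕ) <;> simp [ha, hb]
  have hdvd : ∀ n : ℕ+, l ∣ (n : ℕ) → ∃ m : ℕ+, n = lp * m := fun n hn => by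
    obtain ⟨m, hm⟩ := hn
    have : 0 < m := Nat.pos_of_ne_zero (by rintro rfl; simp at hm)
    exact ⟨⟨m, this⟩, PNat.eq hm⟩
  have hlp : ((lp : ℕ+) : ℕ) = l := rfl
  have hinj : Function.Injective fun n : ℕ+ => lp * n := mul_right_injective lp
  have e1 : ∑' p : ℕ+ × ℕ+, (if l ∣ (p.1 : ℕ) then G p else 0) =
      l * χ (l : ZMod f) * eisDouble χ z := by
    rw [← (hinj.prodMap Function.injective_id).tsum_eq, eisDouble, ← tsum_mul_left]
    · refine tsum_congr fun p => ?_
      simp only [Prod.map, id, PNat.mul_coe, hlp, dvd_mul_right, if_true, hG, eisCoeff]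
      push_cast
      rw [map_mul]
      have : (l * p.1 * p.2 * z / l : ℂ) = p.1 * p.2 * z := by field_simp
      rw [this]; ring
    · intro p hp
      have : l ∣ (p.1 : ℕ) := by by_contra h; simp [h] at hp
      obtain ⟨m, hm⟩ := hdvd _ this
      exact ⟨(m, p.2), by simp [← hm]⟩
  have e2 : ∑' p : ℕ+ × ℕ+, (if l ∣ (p.2 : ℕ) then G p else 0) =
      χ⁻¹ (l : ZMod f) * eisDouble χ z := by
    rw [← (Function.injective_id.prodMap hinj).tsum_eq, eisDouble, ← tsum_mul_left]
    · refine tsum_congr fun p => ?_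
      simp only [Prod.map, id, PNat.mul_coe, hlp, dvd_mul_right, if_true, hG, eisCoeff]
      push_cast
      rw [map_mul]
      have : (p.1 * (l * p.2) * z / l : ℂ) = p.1 * p.2 * z := by field_simp
      rw [this]; ring
    · intro p hp
      have : l ∣ (p.2 : ℕ) := by by_contra h; simp [h] at hp
      obtain ⟨m, hm⟩ := hdvd _ this
      exact ⟨(p.1, m), by simp [← hm]⟩
  have e3 : ∑' p : ℕ+ × ℕ+, (if l ∣ (p.1 : ℕ) ∧ l ∣ (p.2 : ℕ) then G p else 0) =
      χ (l : ZMod f) * χ⁻¹ (l : ZMod f) * (l * eisDouble χ (dil l z)) := by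
    rw [← (hinj.prodMap hinj).tsum_eq, eisDouble, ← tsum_mul_left, ← tsum_mul_left]
    · refine tsum_congr fun p => ?_
      simp only [Prod.map, PNat.mul_coe, hlp, dvd_mul_right, and_self, if_true, hG, eisCoeff]
      push_cast
      rw [map_mul, map_mul, coe_dil hl0]
      have : (l * p.1 * (l * p.2) * z / l : ℂ) = p.1 * p.2 * (l * z) := by field_simp
      rw [this]; ring
    · intro p hp
      have : l ∣ (p.1 : ℕ) ∧ l ∣ (p.2 : ℕ) := by by_contra h; simp [h] at hp
      obtain ⟨m, hm⟩ := hdvd _ this.1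
      obtain ⟨n, hn⟩ := hdvd _ this.2
      exact ⟨(m, n), by simp [← hm, ← hn]⟩
  rw [h1, tsum_congr h2, Summable.tsum_sub ((hind _).add (hind _)) (hind _),
    Summable.tsum_add (hind _) (hind _), e1, e2, e3]
  ring

lemma eisChi_eq_add [NeZero f] {χ : DirichletCharacter ℂ f} (hχ : χ.IsPrimitive) :
    ∃ A B : ℂ, (f ≠ 1 → A = 0 ∧ B = 0) ∧
      eisChi χ = (fun z : ℍ => A + B / z.im) + eisDouble χ := by
  obtain ⟨A, B, h, h'⟩ := exists_eisChi_eq hχ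
  exact ⟨A, B, h, funext h'⟩

lemma isPeriodic_eisChi [NeZero f] : IsPeriodic (eisChi χ) :=
  (isGammaInv_eisChi χ).isPeriodic

lemma im_upperMat_smul {l : ℕ} (hl : 0 < l) (k : ℕ) (z : ℍ) :
    (upperMat 1 k l • z : ℍ).im = z.im / l := by
  rw [← UpperHalfPlane.coe_im, coe_upperMat_smul k one_pos hl,
    show (l : ℂ) = ((l : ℝ) : ℂ) by simp, Complex.div_ofReal_im]
  simp

/-- For `f = 1` the constant term and the `1 / y` term satisfy the same relation as the double series. -/
theorem opU_eisChi [NeZero f] {χ : DirichletCharacter ℂ f} (hχ : χ.IsPrimitive) {l : ℕ}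
    (hl : l.Prime) :
    opU l (eisChi χ) = (χ⁻¹ (l : ZMod f) + l * χ (l : ZMod f)) • eisChi χ -
      (χ (l : ZMod f) * χ⁻¹ (l : ZMod f)) • opV l (eisChi χ) := by
  obtain ⟨A, B, h0, hE⟩ := eisChi_eq_add hχ
  have hl0 := hl.pos
  have hlC : (l : ℂ) ≠ 0 := by exact_mod_cast hl0.ne'
  have hc : opU l (fun z : ℍ => A + B / z.im) =
      (χ⁻¹ (l : ZMod f) + l * χ (l : ZMod f)) • (fun z : ℍ => A + B / z.im) -
      (χ (l : ZMod f) * χ⁻¹ (l : ZMod f)) • opV l (fun z : ℍ => A + B / z.im) := by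
    ext z
    have hy : (z.im : ℂ) ≠ 0 := by exact_mod_cast z.im_pos.ne'
    rw [opU_apply hl0, Pi.sub_apply, Pi.smul_apply, Pi.smul_apply, opV_apply hl0, smul_eq_mul,
      smul_eq_mul, im_dil hl0]
    simp only [im_upperMat_smul hl0, Finset.sum_const, Finset.card_range, nsmul_eq_mul]
    push_cast
    by_cases hf : f = 1
    · subst hf
      have h1 : χ (l : ZMod 1) = 1 := by
        rw [Subsingleton.elim (l : ZMod 1) 1, map_one]
      have h2 : χ⁻¹ (l : ZMod 1) = 1 := by
        rw [Subsingleton.elim (l : ZMod 1) 1, map_one]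
      rw [h1, h2]
      field_simp
      ring
    · rw [(h0 hf).1, (h0 hf).2]
      simp
  rw [hE, map_add, hc, opU_eisDouble χ hl, map_add, smul_add, smul_add]
  abel

lemma char_mul_inv_of_coprime {l : ℕ} (h : Nat.Coprime l f) :
    χ (l : ZMod f) * χ⁻¹ (l : ZMod f) = 1 := by
  have hu : IsUnit (l : ZMod f) := (ZMod.isUnit_iff_coprime l f).2 h
  rw [← MulChar.mul_apply, mul_inv_cancel, MulChar.one_apply hu]

lemma char_eq_zero_of_not_coprime {l : ℕ} (h : ¬ Nat.Coprime l f) : χ (l : ZMod f) = 0 :=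
  MulChar.map_nonunit _ fun hu => h ((ZMod.isUnit_iff_coprime l f).1 hu)

end Eigenvalues

/-- `g` is `1`-periodic and an eigenfunction of `U_l + ε V_l`, of eigenvalue `lam`. For `ε = 1`
and `ε = 0` these are the Hecke operators at `l` of levels prime to `l` and divisible by `l`. -/
def HeckeEig (l : ℕ) (lam ε : ℂ) (g : ℍ → ℂ) : Prop :=
  IsPeriodic g ∧ opU l g + ε • opV l g = lam • g

/-- The operator `g ↦ g - c g|γ_p`. -/
def eulerOp (c : ℕ → ℂ) (p : ℕ) (g : ℍ → ℂ) : ℍ → ℂ := g - c p • opV p g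

lemma HeckeEig.eulerOp_of_coprime {l p : ℕ} (hl : 0 < l) (hp : 0 < p) (h : Nat.Coprime l p)
    {lam ε : ℂ} {g : ℍ → ℂ} (hg : HeckeEig l lam ε g) (c : ℕ → ℂ) :
    HeckeEig l lam ε (eulerOp c p g) := by
  refine ⟨hg.1.sub ((hg.1.opV hp).smul _), ?_⟩
  have h2 : opV p (opU l g) + ε • opV p (opV l g) = lam • opV p g := by
    rw [← map_smul, ← map_add, hg.2, map_smul]
  simp only [eulerOp, map_sub, map_smul]
  rw [opU_opV_of_coprime hl hp h hg.1, opV_comm hl hp]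
  calc _ = (opU l g + ε • opV l g) - c p • (opV p (opU l g) + ε • opV p (opV l g)) := by module
    _ = lam • g - c p • lam • opV p g := by rw [hg.2, h2]
    _ = _ := by module

/-- Removing the factor at `l` turns an eigenfunction of `U_l + V_l`, of eigenvalue `α + β` with
`α β = l`, into one of `U_l`, of eigenvalue `α`. -/
lemma HeckeEig.eulerOp_first {l : ℕ} (hl : 0 < l) {α β : ℂ} (hαβ : α * β = l) {g : ℍ → ℂ}
    (hg : HeckeEig l (α + β) 1 g) {c : ℕ → ℂ} (hc : c l * α = 1) :
    HeckeEig l α 0 (eulerOp c l g) := by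
  refine ⟨hg.1.sub ((hg.1.opV hl).smul _), ?_⟩
  have h1 : opU l g = (α + β) • g - opV l g := by
    rw [← hg.2, one_smul, add_sub_cancel_right]
  have h2 : c l * l = β := by rw [← hαβ, ← mul_assoc, hc, one_mul]
  have h3 : α * c l = 1 := by rw [mul_comm, hc]
  simp only [eulerOp, map_sub, map_smul]
  rw [opU_opV_self hl hg.1, h1, smul_smul, h2, smul_sub α, smul_smul α, h3]
  module

/-- Removing the remaining factor at `l` gives an element of the kernel of `U_l`. -/
lemma HeckeEig.eulerOp_second {l : ℕ} (hl : 0 < l) {α : ℂ} {g : ℍ → ℂ}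
    (hg : HeckeEig l α 0 g) {c : ℕ → ℂ} (hc : c l * l = α) :
    HeckeEig l 0 0 (eulerOp c l g) := by
  refine ⟨hg.1.sub ((hg.1.opV hl).smul _), ?_⟩
  have h1 : opU l g = α • g := by rw [← hg.2, zero_smul, add_zero]
  simp only [eulerOp, map_sub, map_smul]
  rw [opU_opV_self hl hg.1, h1, smul_smul, hc]
  module

lemma HeckeEig.foldr_of_coprime {l : ℕ} (hl : 0 < l) {lam ε : ℂ} (c : ℕ → ℂ) {ps : List ℕ}
    (hps : ∀ p ∈ ps, 0 < p ∧ Nat.Coprime l p) {g : ℍ → ℂ} (hg : HeckeEig l lam ε g) :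
    HeckeEig l lam ε (ps.foldr (eulerOp c) g) := by
  induction ps with
  | nil => exact hg
  | cons p ps ih =>
    have h := hps p (by simp)
    exact (ih fun q hq => hps q (by simp [hq])).eulerOp_of_coprime hl h.1 h.2 c

/-- Among distinct primes, only the factor at `l` matters for the Hecke operator at `l`. -/
lemma HeckeEig.foldr_of_mem {l : ℕ} (hl : l.Prime) {lam ε lam' ε' : ℂ} {c : ℕ → ℂ}
    (hstep : ∀ g, HeckeEig l lam ε g → HeckeEig l lam' ε' (eulerOp c l g)) {ps : List ℕ}
    (hps : ∀ p ∈ ps, p.Prime) (hnd : ps.Nodup) (hmem : l ∈ ps) {g : ℍ → ℂ}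
    (hg : HeckeEig l lam ε g) : HeckeEig l lam' ε' (ps.foldr (eulerOp c) g) := by
  induction ps with
  | nil => simp at hmem
  | cons p ps ih =>
    have hp := hps p (by simp)
    have hps' : ∀ q ∈ ps, q.Prime := fun q hq => hps q (by simp [hq])
    rw [List.nodup_cons] at hnd
    rw [List.foldr_cons]
    rcases eq_or_ne p l with rfl | hne
    · refine hstep _ (hg.foldr_of_coprime hl.pos c fun q hq => ⟨(hps' q hq).pos, ?_⟩)
      exact (Nat.coprime_primes hl (hps' q hq)).2 fun h => hnd.1 (h ▸ hq)
    · have hm : l ∈ ps := by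
        rcases List.mem_cons.1 hmem with h | h
        · exact absurd h.symm hne
        · exact h
      exact (ih hps' hnd.2 hm).eulerOp_of_coprime hl.pos hp.pos
        ((Nat.coprime_primes hl hp).2 hne.symm) c

/-! ### Leading Fourier coefficients -/

/-- Up to a constant and a multiple of `1 / y`, the function `g` is asymptotic to `c q ^ s`
at infinity. -/
def LeadAt (g : ℍ → ℂ) (s : ℕ) (c : ℂ) : Prop :=
  ∃ A B : ℂ, Tendsto (fun z : ℍ => (g z - A - B / z.im) * ee (-(s * z))) atImInfty (𝓝 c)

lemma tendsto_ee_mul {s : ℕ} (hs : 0 < s) :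
    Tendsto (fun z : ℍ => ee (s * z)) atImInfty (𝓝 0) := by
  have h := (tendsto_im_mul_ee one_pos).mul tendsto_inv_im
  rw [zero_mul] at h
  have h2 := h.comp (tendsto_dil hs)
  refine h2.congr fun z => ?_
  have hy : ((dil s z).im : ℂ) ≠ 0 := by exact_mod_cast (dil s z).im_pos.ne'
  simp only [Function.comp]
  rw [mul_right_comm, mul_inv_cancel₀ hy, one_mul, coe_dil hs, Nat.cast_one, div_one]

lemma tendsto_im_mul_ee_mul {s : ℕ} (hs : 0 < s) :
    Tendsto (fun z : ℍ => (z.im : ℂ) * ee (s * z)) atImInfty (𝓝 0) := by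
  have hsC : (s : ℂ) ≠ 0 := by exact_mod_cast hs.ne'
  have h := ((tendsto_im_mul_ee one_pos).comp (tendsto_dil hs)).const_mul (s : ℂ)⁻¹
  rw [mul_zero] at h
  refine h.congr fun z => ?_
  simp only [Function.comp]
  rw [im_dil hs, coe_dil hs, Nat.cast_one, div_one]
  push_cast
  field_simp

lemma leadAt_zero (s : ℕ) : LeadAt 0 s 0 := ⟨0, 0, by simp⟩

lemma LeadAt.add {g h : ℍ → ℂ} {s : ℕ} {c d : ℂ} (hg : LeadAt g s c) (hh : LeadAt h s d) :
    LeadAt (g + h) s (c + d) := by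
  obtain ⟨A, B, hg⟩ := hg
  obtain ⟨A', B', hh⟩ := hh
  refine ⟨A + A', B + B', (hg.add hh).congr fun z => ?_⟩
  rw [Pi.add_apply]; ring

lemma LeadAt.smul {g : ℍ → ℂ} {s : ℕ} {c : ℂ} (a : ℂ) (hg : LeadAt g s c) :
    LeadAt (a • g) s (a * c) := by
  obtain ⟨A, B, hg⟩ := hg
  refine ⟨a * A, a * B, (hg.const_mul a).congr fun z => ?_⟩
  rw [Pi.smul_apply, smul_eq_mul]; ring

lemma LeadAt.sub {g h : ℍ → ℂ} {s : ℕ} {c d : ℂ} (hg : LeadAt g s c) (hh : LeadAt h s d) :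
    LeadAt (g - h) s (c - d) := by
  have := hg.add (hh.smul (-1))
  rwa [neg_one_smul, neg_one_mul, ← sub_eq_add_neg, ← sub_eq_add_neg] at this

lemma LeadAt.sum {ι : Type*} {S : Finset ι} {g : ι → ℍ → ℂ} {s : ℕ} {c : ι → ℂ}
    (h : ∀ i ∈ S, LeadAt (g i) s (c i)) : LeadAt (∑ i ∈ S, g i) s (∑ i ∈ S, c i) := by
  classical
  induction S using Finset.induction_on with
  | empty => simpa using leadAt_zero s
  | insert i S hi ih =>
    rw [Finset.sum_insert hi, Finset.sum_insert hi]
    exact (h i (by simp)).add (ih fun j hj => h j (by simp [hj]))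

lemma LeadAt.of_lt {g : ℍ → ℂ} {s s' : ℕ} {c : ℂ} (hs : s' < s) (hg : LeadAt g s c) :
    LeadAt g s' 0 := by
  obtain ⟨A, B, hg⟩ := hg
  refine ⟨A, B, ?_⟩
  have h := hg.mul (tendsto_ee_mul (Nat.sub_pos_of_lt hs))
  rw [mul_zero] at h
  refine h.congr fun z => ?_
  rw [mul_assoc, ← ee_add, Nat.cast_sub hs.le]
  congr 2; ring

/-- The function `q ^ s` decays faster than constants and multiples of `1 / y`, so these are
determined by `g` and may be compared first. -/
lemma LeadAt.unique {g : ℍ → ℂ} {s : ℕ} (hs : 0 < s) {c d : ℂ} (hc : LeadAt g s c)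
    (hd : LeadAt g s d) : c = d := by
  obtain ⟨A, B, h⟩ := hc.sub hd
  simp only [sub_self, Pi.zero_apply, zero_sub] at h
  have he : ∀ z : ℍ, ee (-(s * z)) * ee (s * z) = 1 := fun z => by rw [← ee_add]; simp [ee_zero]
  have hA : A = 0 := by
    have h1 := h.mul (tendsto_ee_mul hs)
    rw [mul_zero] at h1
    have h2 : Tendsto (fun z : ℍ => -A - B * (z.im : ℂ)⁻¹) atImInfty (𝓝 (-A - B * 0)) :=
      tendsto_const_nhds.sub (tendsto_inv_im.const_mul B)
    have h3 := tendsto_nhds_unique h2 (h1.congr fun z => by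
      rw [mul_assoc, he, mul_one, div_eq_mul_inv])
    simpa using h3
  subst hA
  have hB : B = 0 := by
    have h1 := h.mul (tendsto_im_mul_ee_mul hs)
    rw [mul_zero] at h1
    have h3 := tendsto_nhds_unique (tendsto_const_nhds (x := -B)) (h1.congr fun z => by
      have hy : (z.im : ℂ) ≠ 0 := by exact_mod_cast z.im_pos.ne'
      have hb := div_mul_cancel₀ B hy
      linear_combination (-(B / z.im) * z.im) * he z - hb)
    simpa using h3
  subst hB
  have h4 := tendsto_nhds_unique h ((tendsto_const_nhds (x := (0 : ℂ))).congr fun z => by simp)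
  exact sub_eq_zero.1 h4

lemma LeadAt.opV {g : ℍ → ℂ} {s d : ℕ} (hd : 0 < d) {c : ℂ} (hg : LeadAt g s c) :
    LeadAt (opV d g) (s * d) (d * c) := by
  obtain ⟨A, B, hg⟩ := hg
  have hdC : (d : ℂ) ≠ 0 := by exact_mod_cast hd.ne'
  refine ⟨d * A, B, ((hg.comp (tendsto_dil hd)).const_mul (d : ℂ)).congr fun z => ?_⟩
  simp only [Function.comp]
  rw [opV_apply hd, im_dil hd, coe_dil hd, ← mul_assoc]
  have hy : (z.im : ℂ) ≠ 0 := by exact_mod_cast z.im_pos.ne'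
  congr 1
  · push_cast; field_simp
  · congr 1; push_cast; ring

lemma LeadAt.eulerOp {g : ℍ → ℂ} {p : ℕ} (hp : p.Prime) {c : ℂ} (hg : LeadAt g 1 c)
    (a : ℕ → ℂ) : LeadAt (eulerOp a p g) 1 c := by
  have h := hg.sub ((((hg.opV hp.pos).of_lt (s' := 1) (by simpa using hp.one_lt))).smul (a p))
  rwa [mul_zero, sub_zero] at h

lemma leadAt_eisChi {f : ℕ} [NeZero f] {χ : DirichletCharacter ℂ f} (hχ : χ.IsPrimitive) :
    LeadAt (eisChi χ) 1 1 := by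
  obtain ⟨A, B, -, h⟩ := exists_eisChi_eq hχ
  refine ⟨A, B, ?_⟩
  have h1 := dser_lead (norm_eisCoeff_le χ) one_pos
  have h2 : eisCoeff χ (1, 1) = 1 := by simp [eisCoeff]
  rw [h2] at h1
  refine h1.congr fun z => ?_
  rw [h, eisDouble]
  simp only [Nat.cast_one, div_one, one_mul]
  ring

/-- The first Fourier coefficient is the derivative of the cusp function at `0`, hence the leading
coefficient in the sense of `LeadAt`. -/
lemma leadAt_qExpansion {g : ℍ → ℂ} (hper : IsPeriodic g) (hmem : g ∈ eisensteinAll) :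
    LeadAt g 1 ((qExpansion 1 g).coeff 1) := by
  have hhol := mdifferentiable_of_mem hmem
  obtain ⟨A, hA⟩ := hasAsymp_of_mem hmem
  have hp : Function.Periodic (g ∘ ofComplex) ((1 : ℝ) : ℂ) := by
    intro w
    simp only [Function.comp]
    by_cases hw : 0 < w.im
    · have hw' : 0 < (w + ((1 : ℝ) : ℂ)).im := by simpa using hw
      rw [ofComplex_apply_of_im_pos hw, ofComplex_apply_of_im_pos hw']
      exact hper _ _ (by simp)
    · have hw' : (w + ((1 : ℝ) : ℂ)).im ≤ 0 := by simpa using hw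
      rw [ofComplex_apply_of_im_nonpos (not_lt.1 hw), ofComplex_apply_of_im_nonpos hw']
  have hd := differentiableAt_cuspFunction one_pos hp hhol hA.isBoundedAtImInfty
    (q := 0) (by simp)
  refine ⟨cuspFunction 1 g 0, 0, ?_⟩
  rw [qExpansion_coeff, iteratedDeriv_one, Nat.factorial_one, Nat.cast_one, inv_one, one_mul]
  have hs := hasDerivAt_iff_tendsto_slope.1 hd.hasDerivAt
  have hq : Tendsto (fun z : ℍ => Function.Periodic.qParam 1 z) atImInfty (𝓝[≠] 0) :=
    tendsto_nhdsWithin_iff.2 ⟨qParam_tendsto_atImInfty one_pos,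
      Eventually.of_forall fun z => Function.Periodic.qParam_ne_zero _⟩
  refine (hs.comp hq).congr fun z => ?_
  have hqe : Function.Periodic.qParam 1 (z : ℂ) = ee z := by
    rw [Function.Periodic.qParam, ee]; simp
  simp only [Function.comp]
  rw [slope_def_field, eq_cuspFunction z one_ne_zero hp, hqe]
  simp only [one_mul, zero_div, sub_zero]
  rw [ee_neg, div_eq_mul_inv]

/-! ### The series `E_{M, L, χ}` -/

/-- The coefficients of the operators `[p]⁺_χ`. -/
def cPlus {f : ℕ} (χ : DirichletCharacter ℂ f) (p : ℕ) : ℂ := χ (p : ZMod f)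

/-- The coefficients of the operators `[p]⁻_χ`. -/
def cMinus {f : ℕ} (χ : DirichletCharacter ℂ f) (p : ℕ) : ℂ := (p : ℂ)⁻¹ * χ⁻¹ (p : ZMod f)

lemma bracketPlus_eq {f : ℕ} (χ : DirichletCharacter ℂ f) (m : ℕ) (g : ℍ → ℂ) :
    bracketPlus χ m g = m.primeFactorsList.foldr (eulerOp (cPlus χ)) g := rfl

lemma bracketMinus_eq {f : ℕ} (χ : DirichletCharacter ℂ f) (m : ℕ) (g : ℍ → ℂ) :
    bracketMinus χ m g = m.primeFactorsList.foldr (eulerOp (cMinus χ)) g := rfl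

lemma isGammaInv_foldr {N : ℕ} {g : ℍ → ℂ} (hg : IsGammaInv N g) (c : ℕ → ℂ) {m : ℕ}
    (hm : m ≠ 0) : IsGammaInv (N * m) (m.primeFactorsList.foldr (eulerOp c) g) := by
  have key : ∀ ps : List ℕ, (∀ p ∈ ps, 0 < p) →
      IsGammaInv (N * ps.prod) (ps.foldr (eulerOp c) g) := by
    intro ps
    induction ps with
    | nil => intro _; simpa using hg
    | cons p ps ih =>
      intro h
      have h1 := ih fun q hq => h q (by simp [hq])
      have hp := h p (by simp)
      rw [List.foldr_cons, List.prod_cons, mul_comm p, ← mul_assoc]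
      exact (h1.of_dvd (Dvd.intro _ rfl)).sub ((h1.opV hp).smul _)
  have h := key m.primeFactorsList fun p hp => (Nat.prime_of_mem_primeFactorsList hp).pos
  rwa [Nat.prod_primeFactorsList hm] at h

lemma leadAt_foldr {g : ℍ → ℂ} {v : ℂ} (hg : LeadAt g 1 v) (c : ℕ → ℂ) (m : ℕ) :
    LeadAt (m.primeFactorsList.foldr (eulerOp c) g) 1 v := by
  have key : ∀ ps : List ℕ, (∀ p ∈ ps, p.Prime) → LeadAt (ps.foldr (eulerOp c) g) 1 v := by
    intro ps
    induction ps with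
    | nil => intro _; exact hg
    | cons p ps ih =>
      intro h
      exact (ih fun q hq => h q (by simp [hq])).eulerOp (h p (by simp)) c
  exact key _ fun p hp => Nat.prime_of_mem_primeFactorsList hp

/-- `g` is congruent to `v φ_0` modulo the span of the `φ_x`, `x ≠ 0`. -/
def EisMod (g : ℍ → ℂ) (v : ℂ) : Prop := g - v • heckePhi 0 0 ∈ eisensteinAll

/-- `φ_0 - φ_0 | γ_p` is a combination of the `φ_{(0, i/p)}` with `0 < i < p`. -/
lemma opV_heckePhi_zero_sub_mem {p : ℕ} (hp : 0 < p) :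
    opV p (heckePhi 0 0) - heckePhi 0 0 ∈ eisensteinAll := by
  obtain ⟨k, rfl⟩ := Nat.exists_eq_succ_of_ne_zero hp.ne'
  rw [opV_heckePhi hp, Finset.sum_range_succ']
  have h0 : heckePhi 0 ((0 + ((0 : ℕ) : ℚ)) / (k.succ : ℕ)) = heckePhi 0 0 := by
    congr 1; simp
  rw [h0, add_sub_cancel_right]
  refine Submodule.sum_mem _ fun i hi => heckePhi_mem ?_
  rintro ⟨-, n, hn⟩
  have hkQ : ((k.succ : ℕ) : ℚ) ≠ 0 := by exact_mod_cast hp.ne'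
  rw [div_eq_iff hkQ, zero_add] at hn
  have h1 : ((i + 1 : ℕ) : ℤ) = n * (k.succ : ℕ) := by exact_mod_cast hn
  have h2 : (k.succ : ℕ) ∣ i + 1 := by
    have : ((k.succ : ℕ) : ℤ) ∣ ((i + 1 : ℕ) : ℤ) := ⟨n, by rw [h1, mul_comm]⟩
    exact_mod_cast this
  have := Nat.le_of_dvd (Nat.succ_pos i) h2
  have := Finset.mem_range.1 hi
  omega

lemma EisMod.sub_smul_opV {g : ℍ → ℂ} {v : ℂ} (hg : EisMod g v) {p : ℕ} (hp : 0 < p) (c : ℕ → ℂ) :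
    EisMod (eulerOp c p g) (v * (1 - c p)) := by
  have h1 := opV_mem hp hg
  have h2 := opV_heckePhi_zero_sub_mem hp
  have e : eulerOp c p g - (v * (1 - c p)) • heckePhi 0 0 = (g - v • heckePhi 0 0) -
      c p • opV p (g - v • heckePhi 0 0) -
        (c p * v) • (opV p (heckePhi 0 0) - heckePhi 0 0) := by
    rw [eulerOp, map_sub, map_smul]; module
  rw [EisMod, e]
  exact sub_mem (sub_mem hg (Submodule.smul_mem _ _ h1)) (Submodule.smul_mem _ _ h2)

lemma eisMod_foldr {g : ℍ → ℂ} {v : ℂ} (hg : EisMod g v) (c : ℕ → ℂ) {ps : List ℕ}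
    (hps : ∀ p ∈ ps, 0 < p) :
    EisMod (ps.foldr (eulerOp c) g) (v * (ps.map fun p => 1 - c p).prod) := by
  induction ps with
  | nil => simpa using hg
  | cons p ps ih =>
    have h := (ih fun q hq => hps q (by simp [hq])).sub_smul_opV (hps p (by simp)) c
    rwa [mul_assoc, mul_comm (List.prod _)] at h

lemma eisChi_one (χ : DirichletCharacter ℂ 1) : eisChi χ =
    (-1 / (2 * gaussSum χ ZMod.stdAddChar)) • heckePhi 0 0 := by
  have h : χ 0 = 1 := by rw [Subsingleton.elim (0 : ZMod 1) 1, map_one]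
  rw [eisChi_eq, opV_one, eisAux]
  simp [h]

lemma eisMod_eisChi {f : ℕ} [NeZero f] {χ : DirichletCharacter ℂ f} (hχ : χ.IsPrimitive) :
    ∃ v : ℂ, (f = 1 → v ≠ 0) ∧ (f ≠ 1 → v = 0) ∧ EisMod (eisChi χ) v := by
  by_cases hf : f = 1
  · subst hf
    refine ⟨-1 / (2 * gaussSum χ ZMod.stdAddChar), fun _ => ?_, fun h => absurd rfl h, ?_⟩
    · have := gaussSum_ne_zero hχ
      simp [this]
    · rw [EisMod, eisChi_one, sub_self]; exact zero_mem _
  · refine ⟨0, fun h => absurd h hf, fun _ => rfl, ?_⟩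
    rw [EisMod, zero_smul, sub_zero]
    exact eisChi_mem χ hf

lemma mem_of_eisMod_zero {g : ℍ → ℂ} (h : EisMod g 0) : g ∈ eisensteinAll := by
  rwa [EisMod, zero_smul, sub_zero] at h

/-- A function congruent to a non-zero multiple of `φ_0` is not an Eisenstein series: its `1 / y`
term survives. -/
lemma eq_zero_of_eisMod {g : ℍ → ℂ} {v : ℂ} (h : EisMod g v) (hg : g ∈ eisensteinAll) : v = 0 := by
  have h1 : v • heckePhi 0 0 ∈ eisensteinAll := by
    have := sub_mem hg h
    rwa [sub_sub_cancel] at this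
  obtain ⟨A, hA⟩ := hasAsymp_of_mem h1
  have h2 := ((heckePhi_hasAsymp 0 0).smul v).unique hA
  have hpi : (Real.pi : ℂ) ≠ 0 := by exact_mod_cast Real.pi_ne_zero
  have h3 := h2.2
  rw [intDelta_of_isIntegral ⟨⟨0, by simp⟩, ⟨0, by simp⟩⟩] at h3
  rcases mul_eq_zero.1 h3 with h4 | h4
  · exact h4
  · exfalso
    simp [hpi] at h4

namespace Triple

variable {D C : ℕ} (t : Triple D C)

lemma f_dvd_M : t.f ∣ t.M := t.f_dvd.trans (Nat.gcd_dvd_left _ _)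

lemma f_dvd_L : t.f ∣ t.L := t.f_dvd.trans (Nat.gcd_dvd_right _ _)

lemma M_eq : t.M = t.f * (t.M / t.f) := (Nat.mul_div_cancel' t.f_dvd_M).symm

lemma L_eq : t.L = t.f * (t.L / t.f) := (Nat.mul_div_cancel' t.f_dvd_L).symm

lemma mem_primeFactorsList_M {l : ℕ} (hD : Squarefree D) (hl : l.Prime) :
    l ∈ (t.M / t.f).primeFactorsList ↔ l ∣ t.M ∧ ¬ l ∣ t.f := by
  have hM : Squarefree t.M := hD.squarefree_of_dvd t.M_dvd
  have h0 : t.M / t.f ≠ 0 := by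
    intro h
    have := t.M_eq
    rw [h, mul_zero] at this
    exact hM.ne_zero this
  rw [Nat.mem_primeFactorsList h0]
  have hcop : Nat.Coprime t.f (t.M / t.f) := by
    rw [t.M_eq] at hM
    exact Nat.coprime_of_squarefree_mul hM
  constructor
  · rintro ⟨-, h⟩
    refine ⟨h.trans (Nat.div_dvd_of_dvd t.f_dvd_M), fun hf => ?_⟩
    exact hl.one_lt.ne' (Nat.eq_one_of_dvd_coprimes hcop hf h)
  · rintro ⟨h, hf⟩
    rw [t.M_eq, hl.dvd_mul] at h
    exact ⟨hl, h.resolve_left hf⟩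

lemma mem_primeFactorsList_L {l : ℕ} (hD : Squarefree D) (hl : l.Prime) :
    l ∈ (t.L / t.f).primeFactorsList ↔ l ∣ t.L ∧ ¬ l ∣ t.f := by
  have hL : Squarefree t.L := hD.squarefree_of_dvd t.L_dvd
  have h0 : t.L / t.f ≠ 0 := by
    intro h
    have := t.L_eq
    rw [h, mul_zero] at this
    exact hL.ne_zero this
  rw [Nat.mem_primeFactorsList h0]
  have hcop : Nat.Coprime t.f (t.L / t.f) := by
    rw [t.L_eq] at hL
    exact Nat.coprime_of_squarefree_mul hL
  constructor
  · rintro ⟨-, h⟩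
    refine ⟨h.trans (Nat.div_dvd_of_dvd t.f_dvd_L), fun hf => ?_⟩
    exact hl.one_lt.ne' (Nat.eq_one_of_dvd_coprimes hcop hf h)
  · rintro ⟨h, hf⟩
    rw [t.L_eq, hl.dvd_mul] at h
    exact ⟨hl, h.resolve_left hf⟩

end Triple

section

variable {D C : ℕ}

lemma isGammaInv_eisSeries (hD : Squarefree D) (t : Triple D C) :
    IsGammaInv (D * C) (eisSeries t) := by
  have hM : t.M / t.f ≠ 0 := fun h => (hD.squarefree_of_dvd t.M_dvd).ne_zero
    (by rw [t.M_eq, h, mul_zero])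
  have hL : t.L / t.f ≠ 0 := fun h => (hD.squarefree_of_dvd t.L_dvd).ne_zero
    (by rw [t.L_eq, h, mul_zero])
  have h := isGammaInv_foldr (isGammaInv_foldr (isGammaInv_eisChi t.χ) (cPlus t.χ) hM)
    (cMinus t.χ) hL
  refine IsGammaInv.of_dvd ?_ h
  refine dvd_trans (dvd_of_eq ?_) t.mul_dvd
  conv_rhs => rw [t.M_eq, t.L_eq]
  ring

lemma leadAt_eisSeries (t : Triple D C) : LeadAt (eisSeries t) 1 1 :=
  leadAt_foldr (leadAt_foldr (leadAt_eisChi t.primitive) _ _) _ _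

/-- For trivial `χ` the condition `M ≠ 1` provides a prime `p ∣ M`, and the operator `[p]⁺`
removes the non-holomorphic part. -/
lemma eisSeries_mem (t : Triple D C) (hD : Squarefree D) : eisSeries t ∈ eisensteinAll := by
  obtain ⟨v, -, hv, hmod⟩ := eisMod_eisChi t.primitive
  have hpos : ∀ m : ℕ, ∀ p ∈ m.primeFactorsList, 0 < p := fun m p hp =>
    (Nat.prime_of_mem_primeFactorsList hp).pos
  have h := eisMod_foldr (eisMod_foldr hmod (cPlus t.χ) (hpos (t.M / t.f))) (cMinus t.χ)
    (hpos (t.L / t.f))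
  refine mem_of_eisMod_zero ?_
  convert! h using 1
  symm
  by_cases hf : t.f = 1
  · have hne : t.M / t.f ≠ 1 := by rw [hf, Nat.div_one]; exact t.M_ne_one
    obtain ⟨p, hp, hdvd⟩ := Nat.exists_prime_and_dvd hne
    have hmem : p ∈ (t.M / t.f).primeFactorsList := by
      rw [t.mem_primeFactorsList_M hD hp]
      exact ⟨hdvd.trans (Nat.div_dvd_of_dvd t.f_dvd_M), by rw [hf]; exact hp.not_dvd_one⟩
    have hχ : cPlus t.χ p = 1 := by
      rw [cPlus]
      have : ∀ (f : ℕ) (hf : f = 1) (χ : DirichletCharacter ℂ f), χ (p : ZMod f) = 1 := by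
        rintro f rfl χ
        rw [Subsingleton.elim (p : ZMod 1) 1, map_one]
      exact this _ hf _
    have h0 : ((t.M / t.f).primeFactorsList.map fun p => 1 - cPlus t.χ p).prod = 0 :=
      List.prod_eq_zero (List.mem_map.2 ⟨p, hmem, by rw [hχ, sub_self]⟩)
    rw [h0, mul_zero, zero_mul]
  · rw [hv hf, zero_mul, zero_mul]

lemma coeff_one_eisSeries (hD : Squarefree D) (t : Triple D C) :
    (qExpansion 1 (eisSeries t)).coeff 1 = 1 :=
  (leadAt_qExpansion (isGammaInv_eisSeries hD t).isPeriodic (eisSeries_mem t hD)).unique one_pos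
    (leadAt_eisSeries t)

lemma heckeEig_eisChi {f : ℕ} [NeZero f] {χ : DirichletCharacter ℂ f} (hχ : χ.IsPrimitive) {l : ℕ}
    (hl : l.Prime) : HeckeEig l (χ⁻¹ (l : ZMod f) + l * χ (l : ZMod f))
      (χ (l : ZMod f) * χ⁻¹ (l : ZMod f)) (eisChi χ) :=
  ⟨isPeriodic_eisChi χ, by rw [opU_eisChi hχ hl, sub_add_cancel]⟩

lemma heckeEig_eisChi_of_coprime {f : ℕ} [NeZero f] {χ : DirichletCharacter ℂ f}
    (hχ : χ.IsPrimitive) {l : ℕ} (hl : l.Prime) (h : Nat.Coprime l f) :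
    HeckeEig l (χ⁻¹ (l : ZMod f) + l * χ (l : ZMod f)) 1 (eisChi χ) := by
  have := heckeEig_eisChi hχ hl
  rwa [char_mul_inv_of_coprime χ h] at this

variable (t : Triple D C) {l : ℕ}

lemma pos_coprime_of_not_mem {m : ℕ} (hl : l.Prime) (h : l ∉ m.primeFactorsList) :
    ∀ p ∈ m.primeFactorsList, 0 < p ∧ Nat.Coprime l p := fun p hp => by
  have hpp := Nat.prime_of_mem_primeFactorsList hp
  exact ⟨hpp.pos, (Nat.coprime_primes hl hpp).2 fun e => h (e ▸ hp)⟩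

lemma nodup_M (hD : Squarefree D) : (t.M / t.f).primeFactorsList.Nodup :=
  Nat.squarefree_iff_nodup_primeFactorsList (fun h => (hD.squarefree_of_dvd t.M_dvd).ne_zero
    (by rw [t.M_eq, h, mul_zero])) |>.1
    (hD.squarefree_of_dvd ((Nat.div_dvd_of_dvd t.f_dvd_M).trans t.M_dvd))

lemma nodup_L (hD : Squarefree D) : (t.L / t.f).primeFactorsList.Nodup :=
  Nat.squarefree_iff_nodup_primeFactorsList (fun h => (hD.squarefree_of_dvd t.L_dvd).ne_zero
    (by rw [t.L_eq, h, mul_zero])) |>.1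
    (hD.squarefree_of_dvd ((Nat.div_dvd_of_dvd t.f_dvd_L).trans t.L_dvd))

lemma heckeEig_eisSeries_of_not_dvd (hl : l.Prime) (h : ¬ l ∣ D) :
    HeckeEig l (t.χ⁻¹ (l : ZMod t.f) + l * t.χ (l : ZMod t.f)) 1 (eisSeries t) := by
  have hf : Nat.Coprime l t.f := (hl.coprime_iff_not_dvd).2 fun h' =>
    h (h'.trans (t.f_dvd_M.trans t.M_dvd))
  refine ((heckeEig_eisChi_of_coprime t.primitive hl hf).foldr_of_coprime hl.pos _
    (pos_coprime_of_not_mem hl fun hm => ?_)).foldr_of_coprime hl.pos _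
    (pos_coprime_of_not_mem hl fun hm => ?_)
  · exact h (((Nat.dvd_of_mem_primeFactorsList hm).trans (Nat.div_dvd_of_dvd t.f_dvd_M)).trans
      t.M_dvd)
  · exact h (((Nat.dvd_of_mem_primeFactorsList hm).trans (Nat.div_dvd_of_dvd t.f_dvd_L)).trans
      t.L_dvd)

lemma cMinus_mul_self {f : ℕ} (χ : DirichletCharacter ℂ f) (hl : l.Prime) :
    cMinus χ l * l = χ⁻¹ (l : ZMod f) := by
  have hlC : (l : ℂ) ≠ 0 := by exact_mod_cast hl.ne_zero
  rw [cMinus]; field_simp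

lemma char_mul_mul_eq {f : ℕ} (χ : DirichletCharacter ℂ f) (h : Nat.Coprime l f) :
    χ⁻¹ (l : ZMod f) * (l * χ (l : ZMod f)) = l := by
  linear_combination (l : ℂ) * char_mul_inv_of_coprime χ h

lemma heckeEig_eisSeries_of_dvd_M (hD : Squarefree D) (hl : l.Prime) (hM : l ∣ t.M)
    (hL : ¬ l ∣ t.L) : HeckeEig l (t.χ⁻¹ (l : ZMod t.f)) 0 (eisSeries t) := by
  have hnf : ¬ l ∣ t.f := fun h => hL (h.trans t.f_dvd_L)
  have hf : Nat.Coprime l t.f := (hl.coprime_iff_not_dvd).2 hnf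
  refine HeckeEig.foldr_of_coprime hl.pos _ (pos_coprime_of_not_mem hl fun hm => ?_)
    (HeckeEig.foldr_of_mem hl (fun g hg => ?_)
      (fun p hp => Nat.prime_of_mem_primeFactorsList hp) (nodup_M t hD)
      ((t.mem_primeFactorsList_M hD hl).2 ⟨hM, hnf⟩)
      (heckeEig_eisChi_of_coprime t.primitive hl hf))
  · exact hL ((t.mem_primeFactorsList_L hD hl).1 hm).1
  · exact hg.eulerOp_first hl.pos (char_mul_mul_eq _ hf) (char_mul_inv_of_coprime _ hf)

lemma heckeEig_eisSeries_of_dvd_L (hD : Squarefree D) (hl : l.Prime) (hM : ¬ l ∣ t.M)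
    (hL : l ∣ t.L) : HeckeEig l (l * t.χ (l : ZMod t.f)) 0 (eisSeries t) := by
  have hnf : ¬ l ∣ t.f := fun h => hM (h.trans t.f_dvd_M)
  have hf : Nat.Coprime l t.f := (hl.coprime_iff_not_dvd).2 hnf
  have hlC : (l : ℂ) ≠ 0 := by exact_mod_cast hl.ne_zero
  refine HeckeEig.foldr_of_mem hl (fun g hg => ?_)
      (fun p hp => Nat.prime_of_mem_primeFactorsList hp) (nodup_L t hD)
      ((t.mem_primeFactorsList_L hD hl).2 ⟨hL, hnf⟩)
      (HeckeEig.foldr_of_coprime hl.pos _ (pos_coprime_of_not_mem hl fun hm => ?_)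
      (heckeEig_eisChi_of_coprime t.primitive hl hf))
  · rw [add_comm] at hg
    refine hg.eulerOp_first hl.pos ?_ ?_
    · rw [mul_comm, char_mul_mul_eq _ hf]
    · have h := cMinus_mul_self t.χ hl
      have h' := char_mul_inv_of_coprime t.χ hf
      change cMinus t.χ l * (l * t.χ (l : ZMod t.f)) = 1
      rw [← mul_assoc, h, mul_comm, h']
  · exact hM ((t.mem_primeFactorsList_M hD hl).1 hm).1

lemma heckeEig_eisSeries_of_dvd_both (hD : Squarefree D) (hl : l.Prime) (hM : l ∣ t.M)
    (hL : l ∣ t.L) : HeckeEig l 0 0 (eisSeries t) := by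
  by_cases hnf : l ∣ t.f
  · have hnc : ¬ Nat.Coprime l t.f := fun h => (hl.coprime_iff_not_dvd).1 h hnf
    have h := heckeEig_eisChi t.primitive hl
    rw [char_eq_zero_of_not_coprime t.χ hnc, char_eq_zero_of_not_coprime t.χ⁻¹ hnc, zero_add,
      mul_zero, zero_mul] at h
    exact (h.foldr_of_coprime hl.pos _ (pos_coprime_of_not_mem hl fun hm =>
      ((t.mem_primeFactorsList_M hD hl).1 hm).2 hnf)).foldr_of_coprime hl.pos _
      (pos_coprime_of_not_mem hl fun hm => ((t.mem_primeFactorsList_L hD hl).1 hm).2 hnf)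
  · have hf : Nat.Coprime l t.f := (hl.coprime_iff_not_dvd).2 hnf
    refine HeckeEig.foldr_of_mem hl
      (fun g hg => hg.eulerOp_second hl.pos (cMinus_mul_self _ hl))
      (fun p hp => Nat.prime_of_mem_primeFactorsList hp) (nodup_L t hD)
      ((t.mem_primeFactorsList_L hD hl).2 ⟨hL, hnf⟩)
      (HeckeEig.foldr_of_mem hl (fun g hg => ?_)
        (fun p hp => Nat.prime_of_mem_primeFactorsList hp) (nodup_M t hD)
        ((t.mem_primeFactorsList_M hD hl).2 ⟨hM, hnf⟩)
        (heckeEig_eisChi_of_coprime t.primitive hl hf))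
    exact hg.eulerOp_first hl.pos (char_mul_mul_eq _ hf) (char_mul_inv_of_coprime _ hf)

lemma prime_dvd_mul_iff (hC : C ∣ D) (hl : l.Prime) : l ∣ D * C ↔ l ∣ D :=
  ⟨fun h => (hl.dvd_mul.1 h).elim id fun h' => h'.trans hC, fun h => h.mul_right C⟩

lemma heckeT_of_not_dvd (hC : C ∣ D) (hl : l.Prime) (h : ¬ l ∣ D) {lam : ℂ} {g : ℍ → ℂ}
    (hg : HeckeEig l lam 1 g) : heckeT (D * C) l g = lam • g := by
  rw [heckeT_eq, if_neg (by rwa [prime_dvd_mul_iff hC hl]), ← hg.2, one_smul]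

lemma heckeT_of_dvd (h : l ∣ D) {lam : ℂ} {g : ℍ → ℂ}
    (hg : HeckeEig l lam 0 g) : heckeT (D * C) l g = lam • g := by
  rw [heckeT_eq, if_pos (h.mul_right C), ← hg.2, zero_smul]

lemma dvd_div_gcd {M L : ℕ} (hM : Squarefree M) (h : l ∣ M / Nat.gcd M L) (hl : l.Prime) :
    l ∣ M ∧ ¬ l ∣ L := by
  have hg : Nat.gcd M L ∣ M := Nat.gcd_dvd_left _ _
  have h1 : l ∣ M := h.trans (Nat.div_dvd_of_dvd hg)
  refine ⟨h1, fun h2 => ?_⟩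
  have hcop : Nat.Coprime (Nat.gcd M L) (M / Nat.gcd M L) := by
    rw [← Nat.mul_div_cancel' hg] at hM
    exact Nat.coprime_of_squarefree_mul hM
  exact hl.one_lt.ne' (Nat.eq_one_of_dvd_coprimes hcop (Nat.dvd_gcd h1 h2) h)

end

/-! ### Linear independence of the functions `E_χ | γ_s` -/

/-- A primitive Dirichlet character, together with its conductor. -/
structure PrimChar where
  /-- The conductor. -/
  f : ℕ
  /-- The character. -/
  χ : DirichletCharacter ℂ f
  f_pos : 0 < f
  primitive : χ.IsPrimitive

instance (c : PrimChar) : NeZero c.f := ⟨c.f_pos.ne'⟩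

namespace PrimChar

/-- The eigenvalue of the Hecke operator at `l` on `E_χ`. -/
def eig (c : PrimChar) (l : ℕ) : ℂ := c.χ⁻¹ (l : ZMod c.f) + l * c.χ (l : ZMod c.f)

lemma ext_of_changeLevel {c c' : PrimChar} {N : ℕ} [NeZero N] (h : c.f ∣ N) (h' : c'.f ∣ N)
    (heq : DirichletCharacter.changeLevel h c.χ = DirichletCharacter.changeLevel h' c'.χ) :
    c = c' := by
  have h1 : c.f = c'.f := by
    rw [← (DirichletCharacter.isPrimitive_def _).1 c.primitive,
      ← (DirichletCharacter.isPrimitive_def _).1 c'.primitive,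
      ← DirichletCharacter.conductor_changeLevel c.χ h, heq,
      DirichletCharacter.conductor_changeLevel c'.χ h']
  obtain ⟨f, χ, hf, hp⟩ := c
  obtain ⟨f', χ', hf', hp'⟩ := c'
  subst h1
  congr 1
  exact DirichletCharacter.changeLevel_injective h heq

lemma norm_eq_one (c : PrimChar) {l : ℕ} (h : Nat.Coprime l c.f) : ‖c.χ (l : ZMod c.f)‖ = 1 := by
  obtain ⟨u, hu⟩ := (ZMod.isUnit_iff_coprime l c.f).2 h
  rw [← hu, DirichletCharacter.unit_norm_eq_one]

/-- The Hecke eigenvalues at the primes outside a finite set determine the character: there is a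
prime `l` with `χ(l) ≠ χ'(l)`, and `|χ⁻¹(l) - χ'⁻¹(l)| = |χ(l) - χ'(l)| ≠ l |χ(l) - χ'(l)|`. -/
lemma exists_prime_eig_ne {c c' : PrimChar} (hne : c ≠ c') {R : ℕ} (hR : 0 < R) :
    ∃ l : ℕ, l.Prime ∧ Nat.Coprime l R ∧ Nat.Coprime l c.f ∧ Nat.Coprime l c'.f ∧
      c.eig l ≠ c'.eig l := by
  set N := c.f * c'.f * R with hN
  have hN0 : NeZero N := ⟨(Nat.mul_pos (Nat.mul_pos c.f_pos c'.f_pos) hR).ne'⟩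
  have h : c.f ∣ N := (Nat.dvd_mul_right _ _).trans (Nat.dvd_mul_right _ _)
  have h' : c'.f ∣ N := (Nat.dvd_mul_left _ _).trans (Nat.dvd_mul_right _ _)
  obtain ⟨u, hu⟩ : ∃ u : (ZMod N)ˣ, DirichletCharacter.changeLevel h c.χ u ≠
      DirichletCharacter.changeLevel h' c'.χ u := by
    by_contra! hcon
    exact hne (ext_of_changeLevel h h' (MulChar.ext hcon))
  obtain ⟨l, -, hl, hlu⟩ := Nat.forall_exists_prime_gt_and_eq_mod u.isUnit 0
  have hlN : Nat.Coprime l N := by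
    rw [← ZMod.isUnit_iff_coprime, hlu]; exact u.isUnit
  have hlNZ : IsCoprime (l : ℤ) N := Nat.isCoprime_iff_coprime.2 hlN
  have e1 := DirichletCharacter.changeLevel_eq_cast_of_dvd' c.χ h hlNZ
  have e2 := DirichletCharacter.changeLevel_eq_cast_of_dvd' c'.χ h' hlNZ
  rw [Int.cast_natCast, Int.cast_natCast] at e1 e2
  rw [← hlu, e1, e2] at hu
  refine ⟨l, hl, hlN.coprime_dvd_right (Nat.dvd_mul_left _ _), hlN.coprime_dvd_right h,
    hlN.coprime_dvd_right h', fun heq => hu ?_⟩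
  rw [eig, eig, ← MulChar.star_apply', ← MulChar.star_apply'] at heq
  have h3 : star (c.χ (l : ZMod c.f) - c'.χ (l : ZMod c'.f)) =
      -(l : ℂ) * (c.χ (l : ZMod c.f) - c'.χ (l : ZMod c'.f)) := by
    rw [star_sub]; linear_combination heq
  have h4 := congrArg norm h3
  rw [norm_star, norm_mul, norm_neg, Complex.norm_natCast] at h4
  have h5 : (2 : ℝ) ≤ l := by exact_mod_cast hl.two_le
  have h6 := norm_nonneg (c.χ (l : ZMod c.f) - c'.χ (l : ZMod c'.f))
  have h7 : ‖c.χ (l : ZMod c.f) - c'.χ (l : ZMod c'.f)‖ = 0 := by nlinarith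
  exact sub_eq_zero.1 (norm_eq_zero.1 h7)

end PrimChar

lemma HeckeEig.opV {l p : ℕ} (hl : 0 < l) (hp : 0 < p) (h : Nat.Coprime l p)
    {lam ε : ℂ} {g : ℍ → ℂ} (hg : HeckeEig l lam ε g) : HeckeEig l lam ε (opV p g) := by
  refine ⟨hg.1.opV hp, ?_⟩
  rw [opU_opV_of_coprime hl hp h hg.1, opV_comm hl hp, ← map_smul, ← map_add, hg.2, map_smul]

/-- The function `E_χ | γ_s`. -/
def eisV (i : PrimChar × ℕ+) : ℍ → ℂ := opV i.2 (eisChi i.1.χ)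

lemma leadAt_eisV (i : PrimChar × ℕ+) : LeadAt (eisV i) i.2 i.2 := by
  have h := (leadAt_eisChi i.1.primitive).opV i.2.pos
  rwa [one_mul, mul_one] at h

lemma heckeEig_eisV (i : PrimChar × ℕ+) {l : ℕ} (hl : l.Prime) (hf : Nat.Coprime l i.1.f)
    (hs : Nat.Coprime l i.2) : HeckeEig l (i.1.eig l) 1 (eisV i) :=
  (heckeEig_eisChi_of_coprime i.1.primitive hl hf).opV hl.pos i.2.pos hs

/-- The Hecke operators at the primes outside a finite set separate the characters; for a single
character the functions have leading terms in different degrees. -/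
theorem linearIndependent_eisV : LinearIndependent ℂ eisV := by
  classical
  rw [linearIndependent_iff']
  intro S a hsum
  set R := ∏ i ∈ S, (i.1.f * i.2) with hR
  have hRpos : 0 < R := Finset.prod_pos fun i _ => Nat.mul_pos i.1.f_pos i.2.pos
  let w : PrimChar → ℍ → ℂ := fun c => ∑ i ∈ S with i.1 = c, a i • eisV i
  have hcop : ∀ l : ℕ, Nat.Coprime l R → ∀ i ∈ S, Nat.Coprime l i.1.f ∧ Nat.Coprime l i.2 := by
    intro l hl i hi
    have h1 : i.1.f * i.2 ∣ R := Finset.dvd_prod_of_mem (fun i => i.1.f * (i.2 : ℕ)) hi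
    exact ⟨hl.coprime_dvd_right ((Nat.dvd_mul_right _ _).trans h1),
      hl.coprime_dvd_right ((Nat.dvd_mul_left _ _).trans h1)⟩
  have hw0 : ∑ c ∈ S.image Prod.fst, w c = 0 := by
    rw [← hsum]
    exact Finset.sum_fiberwise_of_maps_to (fun i hi => Finset.mem_image_of_mem _ hi) _
  have hw : ∀ c ∈ S.image Prod.fst, w c = 0 := by
    refine eq_zero_of_sum_eigenvectors_eq_zero
      (fun k : {l : ℕ // l.Prime ∧ Nat.Coprime l R} => opU k.1 + opV k.1)
      (fun c k => c.eig k.1) _ w ?_ ?_ hw0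
    · rintro c - ⟨l, hl, hlR⟩
      change (opU l + opV l) (∑ i ∈ S with i.1 = c, a i • eisV i) = _
      rw [map_sum, Finset.smul_sum]
      refine Finset.sum_congr rfl fun i hi => ?_
      obtain ⟨hi', rfl⟩ := Finset.mem_filter.1 hi
      have h := (heckeEig_eisV i hl (hcop l hlR i hi').1 (hcop l hlR i hi').2).2
      rw [one_smul] at h
      rw [map_smul, LinearMap.add_apply, h, smul_comm]
    · intro c _ c' _ hne
      obtain ⟨l, hl, hlR, -, -, h⟩ := PrimChar.exists_prime_eig_ne hne hRpos
      exact ⟨⟨l, hl, hlR⟩, h⟩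
  have key : ∀ n : ℕ, ∀ i ∈ S, (i.2 : ℕ) = n → a i = 0 := by
    intro n
    induction n using Nat.strong_induction_on with
    | _ n ih =>
      intro i hi hin
      have h1 : LeadAt (w i.1) i.2 (∑ j ∈ S with j.1 = i.1, if j = i then a i * i.2 else 0) := by
        refine LeadAt.sum fun j hj => ?_
        obtain ⟨hj, hji⟩ := Finset.mem_filter.1 hj
        rcases lt_trichotomy (j.2 : ℕ) i.2 with h | h | h
        · rw [ih j.2 (by omega) j hj rfl, zero_smul, if_neg (by rintro rfl; omega)]
          exact leadAt_zero _
        · have e : j = i := Prod.ext hji (PNat.eq h)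
          rw [if_pos e, e]
          exact (leadAt_eisV i).smul _
        · rw [if_neg (by rintro rfl; omega)]
          have := ((leadAt_eisV j).of_lt h).smul (a j)
          rwa [mul_zero] at this
      rw [hw i.1 (Finset.mem_image_of_mem _ hi), Finset.sum_ite_eq',
        if_pos (show i ∈ S.filter (fun j => j.1 = i.1) from Finset.mem_filter.2 ⟨hi, rfl⟩)] at h1
      have h2 := h1.unique i.2.pos (leadAt_zero _)
      have hne : ((i.2 : ℕ) : ℂ) ≠ 0 := by exact_mod_cast i.2.ne_zero
      exact (mul_eq_zero.1 h2).resolve_right hne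
  exact fun i hi => key _ i hi rfl

/-! ### Character sums over division points -/

lemma sum_range_eq_sum_divisors {M : Type*} [AddCommMonoid M] {m : ℕ} (hm : 0 < m) (F : ℕ → M) :
    ∑ i ∈ Finset.range m, F i =
      ∑ e ∈ m.divisors, ∑ j ∈ Finset.range (m / e) with Nat.Coprime j (m / e), F (e * j) := by
  rw [← Finset.sum_fiberwise_of_maps_to (s := Finset.range m) (t := m.divisors)
    (g := fun i => Nat.gcd i m)
    (fun i _ => Nat.mem_divisors.2 ⟨Nat.gcd_dvd_right _ _, hm.ne'⟩)]
  refine Finset.sum_congr rfl fun e he => ?_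
  obtain ⟨⟨k, rfl⟩, -⟩ := Nat.mem_divisors.1 he
  have he0 : 0 < e := Nat.pos_of_mul_pos_right hm
  rw [Nat.mul_div_cancel_left k he0]
  refine Finset.sum_nbij' (fun i => i / e) (fun j => e * j) ?_ ?_ ?_ ?_ ?_
  · intro i hi
    simp only [Finset.mem_filter, Finset.mem_range] at hi ⊢
    obtain ⟨j, rfl⟩ : e ∣ i := by rw [← hi.2]; exact Nat.gcd_dvd_left _ _
    rw [Nat.mul_div_cancel_left j he0]
    have h2 := hi.2
    rw [Nat.gcd_mul_left] at h2
    exact ⟨Nat.lt_of_mul_lt_mul_left hi.1, Nat.eq_of_mul_eq_mul_left he0 (by rw [h2, mul_one])⟩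
  · intro j hj
    simp only [Finset.mem_filter, Finset.mem_range] at hj ⊢
    refine ⟨Nat.mul_lt_mul_of_pos_left hj.1 he0, ?_⟩
    rw [Nat.gcd_mul_left, hj.2, mul_one]
  · intro i hi
    simp only [Finset.mem_filter, Finset.mem_range] at hi
    exact Nat.mul_div_cancel' (by rw [← hi.2]; exact Nat.gcd_dvd_left _ _)
  · intro j _
    exact Nat.mul_div_cancel_left j he0
  · intro i hi
    simp only [Finset.mem_filter, Finset.mem_range] at hi
    rw [Nat.mul_div_cancel' (by rw [← hi.2]; exact Nat.gcd_dvd_left _ _)]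

lemma sum_units_eq_coprimeSum {M : Type*} [AddCommMonoid M] {m : ℕ} [NeZero m] (F : ℕ → M) :
    ∑ β : (ZMod m)ˣ, F (β : ZMod m).val = ∑ j ∈ Finset.range m with Nat.Coprime j m, F j := by
  classical
  rw [Finset.sum_filter, ← sum_zmod_val m (fun j => if Nat.Coprime j m then F j else 0),
    ← sum_units_zmod m]
  · refine Finset.sum_congr rfl fun β _ => ?_
    rw [if_pos (ZMod.val_coe_unit_coprime β)]
  · intro a ha
    rw [if_neg]
    rwa [← ZMod.isUnit_iff_coprime, ZMod.natCast_zmod_val]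

section OneVariable

variable {M : Type*} [AddCommGroup M] [Module ℂ M] {f : ℕ} (χ : DirichletCharacter ℂ f)
  (h : ℚ → M)

/-- The span of the sums `∑ χ(i) h(i / (d f))` over all residues `i` modulo `d f`. -/
def fullSums : Submodule ℂ M :=
  Submodule.span ℂ {v | ∃ d : ℕ, 0 < d ∧
    v = ∑ i ∈ Finset.range (d * f), χ (i : ZMod f) • h (i / (d * f))}

/-- The sums over the residues prime to `m` are obtained from the sums over all residues by
inversion over the divisors of `m`. -/
lemma coprimeSum_mem (m : ℕ) (hm : 0 < m) (hfm : f ∣ m) :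
    ∑ j ∈ Finset.range m with Nat.Coprime j m, χ (j : ZMod f) • h (j / m) ∈ fullSums χ h := by
  induction m using Nat.strong_induction_on with
  | _ m ih =>
    have hall : ∑ i ∈ Finset.range m, χ (i : ZMod f) • h (i / m) ∈ fullSums χ h := by
      obtain ⟨d, rfl⟩ := hfm
      refine Submodule.subset_span ⟨d, Nat.pos_of_mul_pos_left hm, ?_⟩
      rw [mul_comm f d]
      push_cast
      rfl
    rw [sum_range_eq_sum_divisors hm, ← Finset.add_sum_erase _ _ (Nat.one_mem_divisors.2 hm.ne'),
      Nat.div_one] at hall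
    simp only [one_mul] at hall
    have hrest : ∑ e ∈ m.divisors.erase 1, ∑ j ∈ Finset.range (m / e) with Nat.Coprime j (m / e),
        χ ((e * j : ℕ) : ZMod f) • h ((e * j : ℕ) / m) ∈ fullSums χ h := by
      refine Submodule.sum_mem _ fun e he => ?_
      obtain ⟨he1, he⟩ := Finset.mem_erase.1 he
      obtain ⟨⟨k, rfl⟩, -⟩ := Nat.mem_divisors.1 he
      have he0 : 0 < e := Nat.pos_of_mul_pos_right hm
      have hk0 : 0 < k := Nat.pos_of_mul_pos_left hm
      have heQ : (e : ℚ) ≠ 0 := by exact_mod_cast he0.ne'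
      have hkQ : (k : ℚ) ≠ 0 := by exact_mod_cast hk0.ne'
      rw [Nat.mul_div_cancel_left k he0]
      have e1 : ∑ j ∈ Finset.range k with Nat.Coprime j k,
          χ ((e * j : ℕ) : ZMod f) • h ((e * j : ℕ) / (e * k : ℕ)) =
          χ (e : ZMod f) • ∑ j ∈ Finset.range k with Nat.Coprime j k,
            χ (j : ZMod f) • h (j / k) := by
        rw [Finset.smul_sum]
        refine Finset.sum_congr rfl fun j _ => ?_
        rw [smul_smul]
        push_cast
        rw [map_mul, mul_div_mul_left _ _ heQ]
      rw [e1]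
      by_cases hχe : χ (e : ZMod f) = 0
      · rw [hχe, zero_smul]; exact zero_mem _
      · have hcop : Nat.Coprime f e := by
          by_contra hc
          exact hχe (char_eq_zero_of_not_coprime χ fun h' => hc h'.symm)
        refine Submodule.smul_mem _ _ (ih k ?_ hk0 (hcop.dvd_of_dvd_mul_left hfm))
        have : 1 < e := by omega
        nlinarith
    exact (Submodule.add_mem_iff_left _ hrest).1 hall

variable {n : ℕ} [NeZero n] (ψ : DirichletCharacter ℂ n)

lemma unit_val_unitsMap {m : ℕ} [NeZero m] (hmn : m ∣ n) (α : (ZMod n)ˣ) :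
    (ZMod.unitsMap hmn α : ZMod m) = (((α : ZMod n).val : ℕ) : ZMod m) := by
  rw [ZMod.unitsMap_def, Units.coe_map, MonoidHom.coe_coe, ZMod.castHom_apply,
    ZMod.natCast_val]

/-- The sums of a character `ψ` over the orbits of division points are combinations of the sums
of the primitive character attached to `ψ`. -/
lemma charSum_mem (hper : ∀ (x : ℚ) (k : ℤ), h (x + k) = h x) (a : ZMod n) :
    ∑ α : (ZMod n)ˣ, ψ α • h ((a * α : ZMod n).val / n) ∈
      fullSums ψ.primitiveCharacter h := by
  classical
  have hn : 0 < n := Nat.pos_of_ne_zero (NeZero.ne n)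
  obtain ⟨d, ⟨m, hdm⟩, u, hu, rfl⟩ := ZMod.eq_unit_mul_divisor a
  obtain ⟨u, rfl⟩ := hu
  have hm0 : 0 < m := Nat.pos_of_ne_zero (by rintro rfl; simp at hdm; omega)
  have hd0 : 0 < d := Nat.pos_of_ne_zero (by rintro rfl; simp at hdm; omega)
  have hdQ : (d : ℚ) ≠ 0 := by exact_mod_cast hd0.ne'
  have hmn : m ∣ n := ⟨d, by rw [hdm, mul_comm]⟩
  have hnm : (n : ℚ) = d * m := by exact_mod_cast hdm
  have : NeZero m := ⟨hm0.ne'⟩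
  have hval : ∀ α : (ZMod n)ˣ, h ((((d : ZMod n) * (α : ZMod n)).val : ℚ) / n) =
      h (((ZMod.unitsMap hmn α : ZMod m).val : ℚ) / m) := by
    intro α
    obtain ⟨k, hk⟩ := exists_intCast_div hn ((d * (α : ZMod n).val : ℕ) : ℤ)
    obtain ⟨l, hl⟩ := exists_intCast_div hm0 (((α : ZMod n).val : ℕ) : ℤ)
    rw [unit_val_unitsMap hmn]
    push_cast at hk hl
    rw [ZMod.natCast_zmod_val] at hk
    rw [← hper ((((d : ZMod n) * (α : ZMod n)).val : ℚ) / n) k, ← hk,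
      ← hper (((((α : ZMod n).val : ℕ) : ZMod m).val : ℚ) / m) l, ← hl]
    congr 1
    rw [hnm, mul_div_mul_left _ _ hdQ]
  -- the unit `u` only contributes a constant factor
  have e1 : ∑ α : (ZMod n)ˣ, ψ α • h (((u * d * α : ZMod n)).val / n) =
      ψ (u⁻¹ : (ZMod n)ˣ) • ∑ α : (ZMod n)ˣ, ψ α •
        h (((ZMod.unitsMap hmn α : ZMod m).val : ℚ) / m) := by
    rw [Finset.smul_sum, ← Equiv.sum_comp (Equiv.mulLeft u⁻¹)]
    refine Finset.sum_congr rfl fun α _ => ?_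
    rw [smul_smul, ← hval, Equiv.coe_mulLeft, Units.val_mul, map_mul]
    congr 4
    rw [mul_comm (u : ZMod n), mul_assoc, ← mul_assoc (u : ZMod n), Units.mul_inv, one_mul]
  rw [e1]
  refine Submodule.smul_mem _ _ ?_
  by_cases hcm : ψ.conductor ∣ m
  · have hψ : ∀ α : (ZMod n)ˣ, ψ α = ψ.primitiveCharacter
        (((ZMod.unitsMap hmn α : ZMod m).val : ℕ) : ZMod ψ.conductor) := by
      intro α
      have h1 : IsCoprime (((α : ZMod n).val : ℕ) : ℤ) n :=
        Nat.isCoprime_iff_coprime.2 (ZMod.val_coe_unit_coprime α)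
      have h2 := DirichletCharacter.primitiveCharacter_apply_of_isCoprime ψ h1
      rw [Int.cast_natCast, Int.cast_natCast, ZMod.natCast_zmod_val] at h2
      rw [← h2, unit_val_unitsMap hmn]
      congr 1
      rw [ZMod.val_natCast, ZMod.natCast_eq_natCast_iff]
      exact ((Nat.mod_modEq _ m).of_dvd hcm).symm
    set G : (ZMod m)ˣ → M := fun β => ψ.primitiveCharacter
        (((β : ZMod m).val : ℕ) : ZMod ψ.conductor) • h (((β : ZMod m).val : ℚ) / m) with hG
    have e2 : ∑ α : (ZMod n)ˣ, ψ α • h (((ZMod.unitsMap hmn α : ZMod m).val : ℚ) / m) =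
        ({α : (ZMod n)ˣ | ZMod.unitsMap hmn α = 1} : Finset _).card •
          ∑ β : (ZMod m)ˣ, G β := by
      have e3 : ∀ α : (ZMod n)ˣ, ψ α • h (((ZMod.unitsMap hmn α : ZMod m).val : ℚ) / m) =
          G (ZMod.unitsMap hmn α) := fun α => by rw [hG, hψ α]
      rw [Finset.sum_congr rfl fun α _ => e3 α,
        ← Finset.sum_fiberwise Finset.univ (ZMod.unitsMap hmn), Finset.smul_sum]
      refine Finset.sum_congr rfl fun β _ => ?_
      have hsurj := ZMod.unitsMap_surjective hmn
      rw [Finset.sum_congr rfl fun α hα => by rw [(Finset.mem_filter.1 hα).2],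
        Finset.sum_const, MonoidHom.card_fiber_eq_of_mem_range (ZMod.unitsMap hmn)
          (hsurj β) (hsurj 1)]
    rw [e2, hG, sum_units_eq_coprimeSum (fun j => ψ.primitiveCharacter
      (j : ZMod ψ.conductor) • h ((j : ℚ) / m))]
    exact Submodule.smul_of_tower_mem _ _ (coprimeSum_mem _ h m hm0 hcm)
  · -- a kernel element on which `ψ` is not trivial kills the sum
    obtain ⟨κ, hκ, hψκ⟩ : ∃ κ : (ZMod n)ˣ, ZMod.unitsMap hmn κ = 1 ∧ ψ κ ≠ 1 := by
      by_contra! hcon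
      refine hcm ((DirichletCharacter.mem_conductorSet_iff_conductor_dvd ψ hmn).1 ?_)
      refine (DirichletCharacter.factorsThrough_iff_ker_unitsMap hmn).2 fun κ hκ => ?_
      rw [MonoidHom.mem_ker] at hκ ⊢
      ext
      rw [MulChar.coe_toUnitHom, hcon κ hκ, Units.val_one]
    set S := ∑ α : (ZMod n)ˣ, ψ α • h (((ZMod.unitsMap hmn α : ZMod m).val : ℚ) / m) with hS
    have e2 : S = ψ κ • S := by
      conv_lhs => rw [hS, ← Equiv.sum_comp (Equiv.mulLeft κ)]
      rw [hS, Finset.smul_sum]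
      refine Finset.sum_congr rfl fun α _ => ?_
      rw [Equiv.coe_mulLeft, map_mul, hκ, one_mul, Units.val_mul, map_mul, smul_smul]
    have e3 : (1 - ψ κ) • S = 0 := by rw [sub_smul, one_smul, ← e2, sub_self]
    have e4 : S = 0 := (smul_eq_zero.1 e3).resolve_left (sub_ne_zero.2 hψκ.symm)
    rw [e4]; exact zero_mem _

end OneVariable

/-! ### Eisenstein series for `Γ₀(N)` in terms of the `E_χ | γ_s` -/

/-- The span of the functions `E_χ | γ_s`. -/
def eisVSpan : Submodule ℂ (ℍ → ℂ) := Submodule.span ℂ (Set.range eisV)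

lemma opV_eisV {t : ℕ} (ht : 0 < t) (i : PrimChar × ℕ+) :
    opV t (eisV i) = eisV (i.1, i.2 * ⟨t, ht⟩) := by
  rw [eisV, eisV, opV_opV ht i.2.pos]
  rfl

lemma opV_mem_eisVSpan {t : ℕ} (ht : 0 < t) {g : ℍ → ℂ} (hg : g ∈ eisVSpan) :
    opV t g ∈ eisVSpan := by
  have h : eisVSpan ≤ eisVSpan.comap (opV t) := by
    refine Submodule.span_le.2 ?_
    rintro _ ⟨i, rfl⟩
    exact Submodule.subset_span ⟨_, (opV_eisV ht i).symm⟩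
  exact h hg

/-- The functions `g` such that some `g | γ_t` lies in the span of the functions `E_χ | γ_s`. -/
def eisVSat : Submodule ℂ (ℍ → ℂ) where
  carrier := {g | ∃ t : ℕ, 0 < t ∧ opV t g ∈ eisVSpan}
  zero_mem' := ⟨1, one_pos, by rw [map_zero]; exact zero_mem _⟩
  add_mem' := by
    rintro g h ⟨t, ht, hg⟩ ⟨u, hu, hh⟩
    refine ⟨t * u, Nat.mul_pos ht hu, ?_⟩
    rw [map_add]
    refine add_mem ?_ ?_
    · rw [← opV_opV hu ht]; exact opV_mem_eisVSpan hu hg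
    · rw [mul_comm, ← opV_opV ht hu]; exact opV_mem_eisVSpan ht hh
  smul_mem' := by
    rintro c g ⟨t, ht, hg⟩
    exact ⟨t, ht, by rw [map_smul]; exact Submodule.smul_mem _ _ hg⟩

lemma opV_f_eisAux (c : PrimChar) : opV c.f (eisAux c.χ) ∈ eisVSpan := by
  have hg := gaussSum_ne_zero c.primitive
  have h : opV c.f (eisAux c.χ) = (-(2 * gaussSum c.χ ZMod.stdAddChar)) • eisV (c, 1) := by
    rw [eisV, PNat.one_coe, opV_one, eisChi_eq, smul_smul]
    have : -(2 * gaussSum c.χ ZMod.stdAddChar) * (-1 / (2 * gaussSum c.χ ZMod.stdAddChar)) = 1 := by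
      field_simp
    rw [this, one_smul]
  rw [h]
  exact Submodule.smul_mem _ _ (Submodule.subset_span ⟨_, rfl⟩)

/-- The distribution relations in both coordinates, applied to `γ_{d f}`. -/
lemma opV_sum_sum_mem (c : PrimChar) {d e : ℕ} (hd : 0 < d) (he : 0 < e) :
    ∑ i ∈ Finset.range (d * c.f), ∑ j ∈ Finset.range (e * c.f),
      (c.χ (i : ZMod c.f) * c.χ (j : ZMod c.f)) • heckePhi (i / (d * c.f)) (j / (e * c.f)) ∈
      eisVSat := by
  refine ⟨d * c.f, Nat.mul_pos hd c.f_pos, ?_⟩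
  rw [← opV_opV c.f_pos hd, opV_sum_sum c.χ c.f_pos hd he, opV_comm c.f_pos he]
  exact opV_mem_eisVSpan he (opV_f_eisAux c)

lemma heckePhi_add_int_left (x₁ x₂ : ℚ) (k : ℤ) : heckePhi (x₁ + k) x₂ = heckePhi x₁ x₂ := by
  simpa using heckePhi_add_int x₁ x₂ k 0

lemma heckePhi_add_int_right (x₁ x₂ : ℚ) (k : ℤ) : heckePhi x₁ (x₂ + k) = heckePhi x₁ x₂ := by
  simpa using heckePhi_add_int x₁ x₂ 0 k

lemma fullSums_le {M : Type*} [AddCommGroup M] [Module ℂ M] {f : ℕ} (χ : DirichletCharacter ℂ f)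
    (h : ℚ → M) {W : Submodule ℂ M} (hW : ∀ d : ℕ, 0 < d →
      ∑ i ∈ Finset.range (d * f), χ (i : ZMod f) • h (i / (d * f)) ∈ W) : fullSums χ h ≤ W := by
  refine Submodule.span_le.2 ?_
  rintro _ ⟨d, hd, rfl⟩
  exact hW d hd

/-- The one-variable statement `charSum_mem` is applied in each coordinate. -/
lemma charSum_phiZ_mem {n : ℕ} [NeZero n] (ψ : DirichletCharacter ℂ n) (a b : ZMod n) :
    ∑ α : (ZMod n)ˣ, ∑ β : (ZMod n)ˣ, (ψ α * ψ β) • phiZ n (a * α) (b * β) ∈ eisVSat := by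
  have hcond : 0 < ψ.conductor := Nat.pos_of_dvd_of_pos ψ.conductor_dvd_level
    (Nat.pos_of_ne_zero (NeZero.ne n))
  let c : PrimChar := ⟨ψ.conductor, ψ.primitiveCharacter, hcond, ψ.primitiveCharacter_isPrimitive⟩
  have h1 := charSum_mem (fun x => ∑ β : (ZMod n)ˣ, ψ β •
    heckePhi x ((b * β : ZMod n).val / n)) ψ (fun x k => by
      simp only [heckePhi_add_int_left]) a
  have e1 : ∑ α : (ZMod n)ˣ, ∑ β : (ZMod n)ˣ, (ψ α * ψ β) • phiZ n (a * α) (b * β) =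
      ∑ α : (ZMod n)ˣ, ψ α • ∑ β : (ZMod n)ˣ, ψ β •
        heckePhi ((a * α : ZMod n).val / n) ((b * β : ZMod n).val / n) := by
    refine Finset.sum_congr rfl fun α _ => ?_
    rw [Finset.smul_sum]
    exact Finset.sum_congr rfl fun β _ => by rw [smul_smul]; rfl
  rw [e1]
  refine fullSums_le _ _ (fun d hd => ?_) h1
  have h2 := charSum_mem (fun y => ∑ i ∈ Finset.range (d * c.f), c.χ (i : ZMod c.f) •
    heckePhi (i / (d * c.f)) y) ψ (fun x k => by
      simp only [heckePhi_add_int_right]) b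
  have e2 : ∑ i ∈ Finset.range (d * ψ.conductor), ψ.primitiveCharacter (i : ZMod ψ.conductor) •
      (∑ β : (ZMod n)ˣ, ψ β • heckePhi (i / (d * ψ.conductor)) ((b * β : ZMod n).val / n)) =
      ∑ β : (ZMod n)ˣ, ψ β • ∑ i ∈ Finset.range (d * c.f), c.χ (i : ZMod c.f) •
        heckePhi (i / (d * c.f)) ((b * β : ZMod n).val / n) := by
    simp only [Finset.smul_sum]
    rw [Finset.sum_comm]
    refine Finset.sum_congr rfl fun β _ => Finset.sum_congr rfl fun i _ => ?_
    rw [smul_comm]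
  rw [e2]
  refine fullSums_le _ _ (fun e he => ?_) h2
  have h3 := opV_sum_sum_mem c hd he
  rw [Finset.sum_comm] at h3
  convert! h3 using 1
  refine Finset.sum_congr rfl fun j _ => ?_
  rw [Finset.smul_sum]
  refine Finset.sum_congr rfl fun i _ => ?_
  rw [smul_smul, mul_comm]

/-- Orthogonality of characters isolates the pairs `(α, α⁻¹)`. -/
lemma sum_phiZ_mem {n : ℕ} [NeZero n] (a b : ZMod n) :
    ∑ α : (ZMod n)ˣ, phiZ n (a * α) (b * (α⁻¹ : (ZMod n)ˣ)) ∈ eisVSat := by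
  classical
  have hφ : (n.totient : ℂ) ≠ 0 := by
    exact_mod_cast (Nat.totient_pos.2 (Nat.pos_of_ne_zero (NeZero.ne n))).ne'
  have h1 : ∑ ψ : DirichletCharacter ℂ n, ∑ α : (ZMod n)ˣ, ∑ β : (ZMod n)ˣ,
      (ψ α * ψ β) • phiZ n (a * α) (b * β) ∈ eisVSat :=
    Submodule.sum_mem _ fun ψ _ => charSum_phiZ_mem ψ a b
  have h2 : ∀ α β : (ZMod n)ˣ, ∑ ψ : DirichletCharacter ℂ n, ψ α * ψ β =
      if β = α⁻¹ then (n.totient : ℂ) else 0 := by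
    intro α β
    have h3 := DirichletCharacter.sum_char_inv_mul_char_eq ℂ (α⁻¹ : (ZMod n)ˣ).isUnit (β : ZMod n)
    rw [ZMod.inv_coe_unit, inv_inv] at h3
    rw [h3]
    by_cases h : β = α⁻¹
    · rw [if_pos h, if_pos (by rw [h])]
    · rw [if_neg h, if_neg (fun h' => h (Units.ext h'.symm))]
  have h3 : ∑ ψ : DirichletCharacter ℂ n, ∑ α : (ZMod n)ˣ, ∑ β : (ZMod n)ˣ,
      (ψ α * ψ β) • phiZ n (a * α) (b * β) = (n.totient : ℂ) •
      ∑ α : (ZMod n)ˣ, phiZ n (a * α) (b * (α⁻¹ : (ZMod n)ˣ)) := by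
    rw [Finset.sum_comm, Finset.smul_sum]
    refine Finset.sum_congr rfl fun α _ => ?_
    rw [Finset.sum_comm]
    simp only [← Finset.sum_smul, h2]
    rw [Finset.sum_eq_single α⁻¹]
    · rw [if_pos rfl]
    · intro β _ hβ; rw [if_neg hβ, zero_smul]
    · simp
  rw [h3] at h1
  exact (Submodule.smul_mem_iff _ hφ).1 h1

/-- The span of Hecke's functions at the `n`-division points. -/
def phiSpan (n : ℕ) : Submodule ℂ (ℍ → ℂ) :=
  Submodule.span ℂ {g | ∃ a b : ZMod n, g = phiZ n a b}

lemma phiSpan_mono {n k : ℕ} (hn : 0 < n) (hk : 0 < k) : phiSpan n ≤ phiSpan (n * k) := by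
  refine Submodule.span_le.2 ?_
  rintro _ ⟨a, b, rfl⟩
  refine Submodule.subset_span ⟨((a.val * k : ℤ) : ZMod (n * k)), ((b.val * k : ℤ) : ZMod (n * k)),
    ?_⟩
  have hkQ : (k : ℚ) ≠ 0 := by exact_mod_cast hk.ne'
  rw [phiZ_intCast (Nat.mul_pos hn hk), phiZ]
  push_cast
  rw [mul_div_mul_right _ _ hkQ, mul_div_mul_right _ _ hkQ]

lemma exists_mem_phiSpan {g : ℍ → ℂ} (hg : g ∈ eisensteinAll) :
    ∃ n : ℕ, 0 < n ∧ g ∈ phiSpan n := by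
  refine eisensteinAll_induction (p := fun g => ∃ n : ℕ, 0 < n ∧ g ∈ phiSpan n) ?_ ?_ ?_ ?_ hg
  · intro x₁ x₂ _
    have h1 := x₁.den_pos
    have h2 := x₂.den_pos
    have h1Q : (x₁.den : ℚ) ≠ 0 := by exact_mod_cast h1.ne'
    have h2Q : (x₂.den : ℚ) ≠ 0 := by exact_mod_cast h2.ne'
    refine ⟨x₁.den * x₂.den, Nat.mul_pos h1 h2, Submodule.subset_span
      ⟨((x₁.num * x₂.den : ℤ) : ZMod _), ((x₂.num * x₁.den : ℤ) : ZMod _), ?_⟩⟩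
    rw [phiZ_intCast (Nat.mul_pos h1 h2)]
    congr 1
    · push_cast
      rw [mul_div_mul_right _ _ h2Q, Rat.num_div_den]
    · push_cast
      rw [mul_comm (x₁.den : ℚ), mul_div_mul_right _ _ h1Q, Rat.num_div_den]
  · exact ⟨1, one_pos, zero_mem _⟩
  · rintro g h ⟨n, hn, hg⟩ ⟨m, hm, hh⟩
    refine ⟨n * m, Nat.mul_pos hn hm, add_mem (phiSpan_mono hn hm hg) ?_⟩
    rw [mul_comm]
    exact phiSpan_mono hm hn hh
  · rintro c g ⟨n, hn, hg⟩
    exact ⟨n, hn, Submodule.smul_mem _ _ hg⟩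

/-- Every diagonal matrix of determinant one modulo `n` lifts to `SL₂(ℤ)`. -/
lemma exists_SL2_diag {n : ℕ} [NeZero n] (α : (ZMod n)ˣ) :
    ∃ γ : SL(2, ℤ), (n : ℤ) ∣ γ 0 1 ∧ (n : ℤ) ∣ γ 1 0 ∧ ((γ 0 0 : ℤ) : ZMod n) = α ∧
      ((γ 1 1 : ℤ) : ZMod n) = (α⁻¹ : (ZMod n)ˣ) := by
  have hcop : IsCoprime ((α : ZMod n).val : ℤ) ((n : ℤ) ^ 2) :=
    (Nat.isCoprime_iff_coprime.2 (ZMod.val_coe_unit_coprime α)).pow_right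
  obtain ⟨d, k, h⟩ := hcop
  refine ⟨⟨!![((α : ZMod n).val : ℤ), n; -(n * k), d], ?_⟩, dvd_rfl, ?_, ?_, ?_⟩
  · rw [Matrix.det_fin_two_of]; linear_combination h
  · exact (Dvd.intro k rfl).neg_right
  · simp
  · have h2 := congrArg (Int.cast : ℤ → ZMod n) h
    push_cast at h2
    rw [ZMod.natCast_zmod_val, ZMod.natCast_self, zero_pow two_ne_zero, mul_zero, add_zero] at h2
    change (d : ZMod n) = _
    rw [← mul_one (((α⁻¹ : (ZMod n)ˣ)) : ZMod n), ← h2, mul_comm (d : ZMod n), ← mul_assoc,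
      Units.inv_mul, one_mul]

/-- Averaging over matrices of `Γ₀(N)` that are diagonal modulo `n`. -/
lemma mem_eisVSat {N : ℕ} (hN : 0 < N) {g : ℍ → ℂ} (hg : g ∈ eisensteinAll)
    (hinv : IsGammaInv N g) : g ∈ eisVSat := by
  obtain ⟨n₀, hn₀, hmem⟩ := exists_mem_phiSpan hg
  obtain ⟨n, hn⟩ : ∃ n, n = n₀ * N := ⟨_, rfl⟩
  have hnpos : 0 < n := by rw [hn]; exact Nat.mul_pos hn₀ hN
  have hne : NeZero n := ⟨hnpos.ne'⟩
  have hmem' : g ∈ phiSpan n := by rw [hn]; exact phiSpan_mono hn₀ hN hmem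
  have hNn : (N : ℤ) ∣ n := by rw [hn]; push_cast; exact dvd_mul_left _ _
  choose γ h01 h10 h00 h11 using fun α : (ZMod n)ˣ => exists_SL2_diag α
  have h1 : phiSpan n ≤ eisVSat.comap (∑ α : (ZMod n)ˣ, slashSL (γ α)) := by
    refine Submodule.span_le.2 ?_
    rintro _ ⟨a, b, rfl⟩
    change (∑ α : (ZMod n)ˣ, slashSL (γ α)) (phiZ n a b) ∈ eisVSat
    rw [LinearMap.sum_apply]
    have e : ∀ α : (ZMod n)ˣ, slashSL (γ α) (phiZ n a b) =
        phiZ n (a * α) (b * (α⁻¹ : (ZMod n)ˣ)) := by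
      intro α
      rw [slashSL_apply, phiZ_slash hnpos, h00, h11,
        (ZMod.intCast_zmod_eq_zero_iff_dvd _ _).2 (h01 α),
        (ZMod.intCast_zmod_eq_zero_iff_dvd _ _).2 (h10 α), mul_zero, mul_zero, add_zero, zero_add]
    rw [Finset.sum_congr rfl fun α _ => e α]
    exact sum_phiZ_mem a b
  have h2 : (∑ α : (ZMod n)ˣ, slashSL (γ α)) g ∈ eisVSat := h1 hmem'
  have h3 : ∀ α, slashSL (γ α) g = g := fun α =>
    hinv _ ((mem_Gamma0_iff _ _).2 (hNn.trans (h10 α)))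
  rw [LinearMap.sum_apply, Finset.sum_congr rfl fun α _ => h3 α, Finset.sum_const,
    ← Nat.cast_smul_eq_nsmul ℂ] at h2
  refine (Submodule.smul_mem_iff _ ?_).1 h2
  have : 0 < (Finset.univ : Finset (ZMod n)ˣ).card := Finset.card_pos.2 ⟨1, Finset.mem_univ _⟩
  exact_mod_cast this.ne'

/-- A periodic function `g` with `g | γ_t` in the span of the `E_χ | γ_s` lies in this span:
the primes dividing `t` are removed by the operators `U_p`. -/
lemma mem_eisVSpan_of_periodic {g : ℍ → ℂ} (hper : IsPeriodic g) (hg : g ∈ eisVSat) :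
    g ∈ eisVSpan := by
  obtain ⟨t, ht, hg⟩ := hg
  induction t using Nat.recOnMul generalizing g with
  | zero => omega
  | one => rwa [opV_one] at hg
  | prime p hp =>
    have hU : eisVSpan ≤ eisVSpan.comap (opU p) := by
      refine Submodule.span_le.2 ?_
      rintro _ ⟨⟨c, s⟩, rfl⟩
      change opU p (eisV (c, s)) ∈ eisVSpan
      have hE : eisChi c.χ ∈ eisVSpan := Submodule.subset_span ⟨(c, 1), by
        rw [eisV, PNat.one_coe, opV_one]⟩
      by_cases hps : p ∣ (s : ℕ)
      · obtain ⟨k, hk⟩ := hps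
        have hk0 : 0 < k := Nat.pos_of_ne_zero (by rintro rfl; exact s.ne_zero (by rw [hk, mul_zero]))
        rw [eisV, hk, mul_comm, ← opV_opV hp.pos hk0, opU_opV_self hp.pos
          ((isPeriodic_eisChi c.χ).opV hk0)]
        exact Submodule.smul_mem _ _ (opV_mem_eisVSpan hk0 hE)
      · rw [eisV, opU_opV_of_coprime hp.pos s.pos ((hp.coprime_iff_not_dvd).2 hps)
          (isPeriodic_eisChi c.χ), opU_eisChi c.primitive hp]
        exact opV_mem_eisVSpan s.pos (sub_mem (Submodule.smul_mem _ _ hE)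
          (Submodule.smul_mem _ _ (opV_mem_eisVSpan hp.pos hE)))
    have h1 : opU p (opV p g) ∈ eisVSpan := hU hg
    rw [opU_opV_self hp.pos hper] at h1
    exact (Submodule.smul_mem_iff _ (by exact_mod_cast hp.ne_zero)).1 h1
  | mul a b iha ihb =>
    have ha : 0 < a := Nat.pos_of_mul_pos_right ht
    have hb : 0 < b := Nat.pos_of_mul_pos_left ht
    rw [mul_comm, ← opV_opV ha hb] at hg
    exact ihb hper hb (iha (hper.opV hb) ha hg)

/-- Up to the sign `χ(-1)`, the transformation `z ↦ -1 / z` exchanges the factors `s` and `r` of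
`f² s r`. -/
lemma opV_eisV_slash_S (c : PrimChar) (s r : ℕ+) :
    opV (c.f ^ 2 * s * r) (eisV (c, s) ∣[(2 : ℤ)] ModularGroup.S) = c.χ (-1) • eisV (c, r) := by
  have hf := c.f_pos
  have hu : 0 < c.f * (r : ℕ) := Nat.mul_pos hf r.pos
  have hd : 0 < c.f * (s : ℕ) := Nat.mul_pos hf s.pos
  have e1 : c.f ^ 2 * (s : ℕ) * r = (c.f * s) * (c.f * r) := by ring
  rw [eisV, eisV, eisChi_eq, map_smul, map_smul, opV_opV s.pos hf, opV_opV r.pos hf, e1,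
    ← slashSL_apply, map_smul, map_smul, slashSL_apply, opV_mul_slash_S hd hu, eisAux_slash_S,
    map_smul, smul_comm]

lemma isPeriodic_opV_slash_S {N : ℕ} (hN : 0 < N) {g : ℍ → ℂ} (hg : IsGammaInv N g) :
    IsPeriodic (opV N (g ∣[(2 : ℤ)] ModularGroup.S)) := by
  let γ : SL(2, ℤ) := ⟨!![1, 0; -N, 1], by simp [Matrix.det_fin_two_of]⟩
  let τ : SL(2, ℤ) := ⟨!![1, N; 0, 1], by simp [Matrix.det_fin_two_of]⟩
  have h1 : ModularGroup.S * τ = γ * ModularGroup.S := by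
    apply Subtype.ext
    rw [Matrix.SpecialLinearGroup.coe_mul, Matrix.SpecialLinearGroup.coe_mul, ModularGroup.coe_S]
    change !![0, -1; 1, 0] * !![1, (N : ℤ); 0, 1] = !![1, 0; -(N : ℤ), 1] * !![0, -1; 1, 0]
    ext i j
    fin_cases i <;> fin_cases j <;> simp
  have h2 : g ∣[(2 : ℤ)] γ = g :=
    hg γ ((mem_Gamma0_iff _ _).2 ⟨-1, by simp [γ]⟩)
  have h3 : (g ∣[(2 : ℤ)] ModularGroup.S) ∣[(2 : ℤ)] τ = g ∣[(2 : ℤ)] ModularGroup.S := by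
    rw [← SlashAction.slash_mul, h1, SlashAction.slash_mul, h2]
  intro z w h
  rw [opV_apply hN, opV_apply hN]
  congr 1
  have h4 := congrFun h3 (dil N z)
  rw [ModularForm.SL_slash_apply, ModularGroup.denom_apply] at h4
  have h5 : dil N w = τ • dil N z := by
    ext
    rw [coe_dil hN, UpperHalfPlane.coe_specialLinearGroup_apply, coe_dil hN, h]
    simp [τ, mul_add]
  rw [h5, ← h4]
  simp [τ]

/-- An Eisenstein series `g` for `Γ₀(N)` is a combination of the `E_χ | γ_s` by periodicity; the
periodicity of `(g | S) | γ_N` bounds the `s` that occur. -/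
theorem mem_span_eisV {N : ℕ} (hN : 0 < N) {g : ℍ → ℂ} (hg : g ∈ eisensteinAll)
    (hinv : IsGammaInv N g) :
    g ∈ Submodule.span ℂ {v | ∃ i : PrimChar × ℕ+, i.1.f ^ 2 * i.2 ∣ N ∧ v = eisV i} := by
  classical
  have h1 : g ∈ eisVSpan := mem_eisVSpan_of_periodic hinv.isPeriodic (mem_eisVSat hN hg hinv)
  obtain ⟨a, ha⟩ := Finsupp.mem_span_range_iff_exists_finsupp.1 h1
  rw [Finsupp.sum] at ha
  set t : ℕ := ∏ i ∈ a.support, (i.1.f ^ 2 * (i.2 : ℕ)) with ht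
  have htpos : 0 < t :=
    Finset.prod_pos fun i _ => Nat.mul_pos (pow_pos i.1.f_pos 2) i.2.pos
  have hr : ∀ i : PrimChar × ℕ+, ∃ r : ℕ+, i ∈ a.support → i.1.f ^ 2 * (i.2 : ℕ) * r = t := by
    intro i
    by_cases hi : i ∈ a.support
    · obtain ⟨k, hk⟩ := Finset.dvd_prod_of_mem
        (fun i : PrimChar × ℕ+ => i.1.f ^ 2 * (i.2 : ℕ)) hi
      have hk' : t = i.1.f ^ 2 * (i.2 : ℕ) * k := hk
      have hk0 : 0 < k := Nat.pos_of_ne_zero (by rintro rfl; rw [mul_zero] at hk'; omega)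
      exact ⟨⟨k, hk0⟩, fun _ => hk'.symm⟩
    · exact ⟨1, fun h => absurd h hi⟩
  choose r hr using hr
  let N' : ℕ+ := ⟨N, hN⟩
  let t' : ℕ+ := ⟨t, htpos⟩
  set h := opV N (g ∣[(2 : ℤ)] ModularGroup.S) with hh
  have hth : opV t h = ∑ i ∈ a.support, (a i * i.1.χ (-1)) • eisV (i.1, r i * N') := by
    rw [hh, opV_comm htpos hN, ← ha, ← slashSL_apply, map_sum, map_sum, map_sum]
    refine Finset.sum_congr rfl fun i hi => ?_
    rw [map_smul, map_smul, map_smul, slashSL_apply, ← hr i hi, opV_eisV_slash_S, map_smul,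
      opV_eisV hN, smul_smul]
  have hhmem : h ∈ eisVSpan := by
    refine mem_eisVSpan_of_periodic (isPeriodic_opV_slash_S hN hinv) ⟨t, htpos, ?_⟩
    rw [hth]
    exact Submodule.sum_mem _ fun i _ => Submodule.smul_mem _ _ (Submodule.subset_span ⟨_, rfl⟩)
  obtain ⟨b, hb⟩ := Finsupp.mem_span_range_iff_exists_finsupp.1 hhmem
  rw [Finsupp.sum] at hb
  have hth' : opV t h = ∑ j ∈ b.support, b j • eisV (j.1, j.2 * t') := by
    rw [← hb, map_sum]
    refine Finset.sum_congr rfl fun j _ => ?_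
    rw [map_smul, opV_eisV htpos]
  -- compare the two expansions of `h | γ_t`
  have hD : (∑ i ∈ a.support, Finsupp.single (i.1, r i * N') (a i * i.1.χ (-1))) =
      ∑ j ∈ b.support, Finsupp.single (j.1, j.2 * t') (b j) := by
    refine linearIndependent_eisV ?_
    simp only [map_sum, Finsupp.linearCombination_single]
    rw [← hth, hth']
  rw [← ha]
  refine Submodule.sum_mem _ fun i hi => Submodule.smul_mem _ _ (Submodule.subset_span
    ⟨i, ?_, rfl⟩)
  have hDi := DFunLike.congr_fun hD (i.1, r i * N')
  rw [Finsupp.finsetSum_apply, Finsupp.finsetSum_apply, Finset.sum_eq_single i] at hDi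
  · rw [Finsupp.single_eq_same] at hDi
    have hχ : i.1.χ (-1) ≠ 0 := by
      have : IsUnit (i.1.χ (-1)) := (isUnit_one.neg).map i.1.χ
      exact this.ne_zero
    have hne : ∑ j ∈ b.support, (Finsupp.single (j.1, j.2 * t') (b j)) (i.1, r i * N') ≠ 0 := by
      rw [← hDi]
      exact mul_ne_zero (Finsupp.mem_support_iff.1 hi) hχ
    obtain ⟨j, -, hj⟩ := Finset.exists_ne_zero_of_sum_ne_zero hne
    have hj' : (j.1, j.2 * t') = (i.1, r i * N') := by
      by_contra hcon
      exact hj (Finsupp.single_eq_of_ne (Ne.symm hcon))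
    have h2 : (j.2 : ℕ) * t = r i * N := by
      have := congrArg PNat.val (Prod.ext_iff.1 hj').2
      exact this
    rw [← hr i hi] at h2
    have h3 : (r i : ℕ) * N = r i * (i.1.f ^ 2 * i.2 * j.2) := by rw [← h2]; ring
    exact ⟨j.2, Nat.eq_of_mul_eq_mul_left (r i).pos h3⟩
  · intro k hk hki
    refine Finsupp.single_eq_of_ne fun heq => hki ?_
    have e1 : i.1 = k.1 := (Prod.ext_iff.1 heq).1
    have e2 : r i = r k := mul_right_cancel (Prod.ext_iff.1 heq).2
    have e3 := hr i hi
    rw [← hr k hk, e1, e2] at e3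
    have e4 := Nat.eq_of_mul_eq_mul_left (pow_pos k.1.f_pos 2)
      (Nat.eq_of_mul_eq_mul_right (r k).pos e3)
    exact Prod.ext e1.symm (PNat.eq e4.symm)
  · intro h'; exact absurd hi h'

/-! ### From the `g | γ_s` to products of Euler factors -/

/-- The composite of the operators `1 - c(p) γ_p` over the prime factors `p` of `n`. -/
def eulerProd (c : ℕ → ℂ) (n : ℕ) (g : ℍ → ℂ) : ℍ → ℂ := n.primeFactorsList.foldr (eulerOp c) g

lemma eulerProd_one (c : ℕ → ℂ) (g : ℍ → ℂ) : eulerProd c 1 g = g := by simp [eulerProd]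

lemma eulerOp_comm {p q : ℕ} (hp : 0 < p) (hq : 0 < q) (c c' : ℕ → ℂ) (g : ℍ → ℂ) :
    eulerOp c p (eulerOp c' q g) = eulerOp c' q (eulerOp c p g) := by
  simp only [eulerOp, map_sub, map_smul]
  rw [opV_comm hp hq]
  module

lemma eulerProd_mul {p n : ℕ} (hp : p.Prime) (hn : n ≠ 0) (c : ℕ → ℂ) (g : ℍ → ℂ) :
    eulerProd c (p * n) g = eulerOp c p (eulerProd c n g) := by
  have h := Nat.perm_primeFactorsList_mul hp.ne_zero hn
  rw [Nat.primeFactorsList_prime hp] at h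
  have hpos : ∀ q ∈ (p * n).primeFactorsList, 0 < q := fun q hq =>
    (Nat.prime_of_mem_primeFactorsList hq).pos
  exact List.Perm.foldr_eq' h (fun x hx y hy z => eulerOp_comm (hpos y hy) (hpos x hx) c c z) g

/-- Products of Euler factors commute, also for different coefficients. -/
lemma eulerOp_eulerProd {p : ℕ} (hp : 0 < p) (n : ℕ) (c c' : ℕ → ℂ) (g : ℍ → ℂ) :
    eulerOp c p (eulerProd c' n g) = eulerProd c' n (eulerOp c p g) := by
  have key : ∀ ps : List ℕ, (∀ q ∈ ps, 0 < q) →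
      eulerOp c p (ps.foldr (eulerOp c') g) = ps.foldr (eulerOp c') (eulerOp c p g) := by
    intro ps
    induction ps with
    | nil => intro _; rfl
    | cons q ps ih =>
      intro h
      rw [List.foldr_cons, List.foldr_cons, eulerOp_comm hp (h q (by simp)),
        ih fun r hr => h r (by simp [hr])]
  exact key _ fun q hq => (Nat.prime_of_mem_primeFactorsList hq).pos

/-- The span of the products of Euler factors `∏_{p ∣ l} (1 - c'(p) γ_p) ∏_{p ∣ m} (1 - c(p) γ_p)`
applied to `g`, where `l` and `m` divide `D` and `D ∣ m l ∣ D C`. -/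
def eulerSpan (c c' : ℕ → ℂ) (D C : ℕ) (g : ℍ → ℂ) : Submodule ℂ (ℍ → ℂ) :=
  Submodule.span ℂ {v | ∃ m l : ℕ, m ∣ D ∧ l ∣ D ∧ D ∣ m * l ∧ m * l ∣ D * C ∧
    v = eulerProd c' l (eulerProd c m g)}

/-- Over a prime `p`, the functions `v`, `v | γ_p` and (if `C` is divisible by `p`) `v | γ_p²`
are recovered from `v` with one Euler factor, with the other one, and with both. -/
lemma opV_mem_eulerSpan {c c' : ℕ → ℂ} {g : ℍ → ℂ} {D : ℕ} (hD : Squarefree D)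
    (hc : ∀ p : ℕ, p.Prime → p ∣ D → c p ≠ c' p ∧ c p ≠ 0 ∧ c' p ≠ 0) {C s : ℕ} (hC : C ∣ D)
    (hs : s ∣ D * C) : opV s g ∈ eulerSpan c c' D C g := by
  induction D using induction_on_primes generalizing C s with
  | zero => exact absurd hD not_squarefree_zero
  | one =>
    obtain rfl := Nat.dvd_one.1 hC
    obtain rfl := Nat.dvd_one.1 hs
    rw [opV_one]
    exact Submodule.subset_span ⟨1, 1, by simp, by simp, by simp, by simp, by
      rw [eulerProd_one, eulerProd_one]⟩
  | prime_mul p D hp ih =>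
    have hcop : Nat.Coprime p D := Nat.coprime_of_squarefree_mul hD
    have hD' : Squarefree D := hD.squarefree_of_dvd (Nat.dvd_mul_left _ _)
    have ih' := fun {C s : ℕ} => ih (C := C) (s := s) hD'
      fun q hq hqD => hc q hq (hqD.mul_left p)
    obtain ⟨hab, ha, hb⟩ := hc p hp (Nat.dvd_mul_right _ _)
    have hab' : c p - c' p ≠ 0 := sub_ne_zero.2 hab
    -- the Euler factors at `p` applied to a generator are generators
    have hA : ∀ m l : ℕ, m ∣ D → l ∣ D → eulerOp c p (eulerProd c' l (eulerProd c m g)) =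
        eulerProd c' l (eulerProd c (p * m) g) := fun m l hm hl => by
      rw [eulerOp_eulerProd hp.pos, eulerProd_mul hp (ne_zero_of_dvd_ne_zero hD'.ne_zero hm)]
    have hB : ∀ m l : ℕ, l ∣ D → eulerOp c' p (eulerProd c' l (eulerProd c m g)) =
        eulerProd c' (p * l) (eulerProd c m g) := fun m l hl => by
      rw [eulerProd_mul hp (ne_zero_of_dvd_ne_zero hD'.ne_zero hl)]
    have hV : ∀ v : ℍ → ℂ, opV p v = (c' p - c p)⁻¹ • (eulerOp c p v - eulerOp c' p v) := by
      intro v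
      have : c' p - c p ≠ 0 := sub_ne_zero.2 hab.symm
      rw [eq_inv_smul_iff₀ this, eulerOp, eulerOp]; module
    have hI : ∀ v : ℍ → ℂ, v = eulerOp c p v + c p • opV p v := by
      intro v; rw [eulerOp]; module
    have hVV : ∀ v : ℍ → ℂ, opV p (opV p v) = (c p * c' p)⁻¹ •
        (eulerOp c' p (eulerOp c p v) - v + (c p + c' p) • opV p v) := by
      intro v
      rw [eq_inv_smul_iff₀ (mul_ne_zero ha hb)]
      simp only [eulerOp, map_sub, map_smul]; module
    by_cases hpC : p ∣ C
    · obtain ⟨C', rfl⟩ := hpC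
      have hC' : C' ∣ D := Nat.dvd_of_mul_dvd_mul_left hp.pos hC
      have e1 : p * D * (p * C') = p ^ 2 * (D * C') := by ring
      rw [e1] at hs
      obtain ⟨k, s', hk, hs', rfl⟩ := Nat.dvd_mul.1 hs
      have hmem := ih' hC' hs'
      have hs0 : 0 < s' := Nat.pos_of_dvd_of_pos hs'
        (Nat.mul_pos hD'.ne_zero.bot_lt (Nat.pos_of_dvd_of_pos hC' hD'.ne_zero.bot_lt))
      have key : ∀ v ∈ eulerSpan c c' D C' g, v ∈ eulerSpan c c' (p * D) (p * C') g ∧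
          opV p v ∈ eulerSpan c c' (p * D) (p * C') g ∧
          opV p (opV p v) ∈ eulerSpan c c' (p * D) (p * C') g := by
        intro v hv
        induction hv using Submodule.span_induction with
        | zero => simp only [map_zero]; exact ⟨zero_mem _, zero_mem _, zero_mem _⟩
        | add x y _ _ hx hy =>
          simp only [map_add]
          exact ⟨add_mem hx.1 hy.1, add_mem hx.2.1 hy.2.1, add_mem hx.2.2 hy.2.2⟩
        | smul a x _ hx =>
          simp only [map_smul]
          exact ⟨Submodule.smul_mem _ _ hx.1, Submodule.smul_mem _ _ hx.2.1,
            Submodule.smul_mem _ _ hx.2.2⟩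
        | mem v hv =>
          obtain ⟨m, l, hm, hl, h1, h2, rfl⟩ := hv
          set v := eulerProd c' l (eulerProd c m g) with hv
          have mA : eulerOp c p v ∈ eulerSpan c c' (p * D) (p * C') g :=
            Submodule.subset_span ⟨p * m, l, mul_dvd_mul_left p hm, hl.mul_left p,
              by rw [mul_assoc]; exact mul_dvd_mul_left p h1,
              by rw [mul_assoc p m l, e1, pow_two, mul_assoc]
                 exact mul_dvd_mul_left p (h2.mul_left p), hA m l hm hl⟩
          have mB : eulerOp c' p v ∈ eulerSpan c c' (p * D) (p * C') g :=
            Submodule.subset_span ⟨m, p * l, hm.mul_left p, mul_dvd_mul_left p hl,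
              by rw [mul_left_comm]; exact mul_dvd_mul_left p h1,
              by rw [mul_left_comm m p l, e1, pow_two, mul_assoc]
                 exact mul_dvd_mul_left p (h2.mul_left p), hB m l hl⟩
          have mAB : eulerOp c' p (eulerOp c p v) ∈ eulerSpan c c' (p * D) (p * C') g :=
            Submodule.subset_span ⟨p * m, p * l, mul_dvd_mul_left p hm, mul_dvd_mul_left p hl,
              by rw [mul_assoc]; exact mul_dvd_mul_left p (h1.trans
                  (mul_dvd_mul_left m (Nat.dvd_mul_left l p))),
              by rw [mul_mul_mul_comm, e1, pow_two]; exact mul_dvd_mul_left _ h2,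
              by rw [hA m l hm hl, hB _ _ hl]⟩
          have m1 : opV p v ∈ eulerSpan c c' (p * D) (p * C') g := by
            rw [hV]; exact Submodule.smul_mem _ _ (sub_mem mA mB)
          have m0 : v ∈ eulerSpan c c' (p * D) (p * C') g := by
            rw [hI v]; exact add_mem mA (Submodule.smul_mem _ _ m1)
          refine ⟨m0, m1, ?_⟩
          rw [hVV]
          exact Submodule.smul_mem _ _ (add_mem (sub_mem mAB m0) (Submodule.smul_mem _ _ m1))
      obtain ⟨k0, k1, k2⟩ := key _ hmem
      obtain ⟨i, hi, rfl⟩ := (Nat.dvd_prime_pow hp).1 hk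
      interval_cases i
      · rwa [pow_zero, one_mul]
      · rwa [pow_one, mul_comm _ s', ← opV_opV hp.pos hs0]
      · rwa [pow_two, mul_comm _ s', ← mul_assoc, ← opV_opV hp.pos (Nat.mul_pos hs0 hp.pos),
          ← opV_opV hp.pos hs0]
    · have hC' : C ∣ D := (((Nat.Prime.coprime_iff_not_dvd hp).2 hpC).symm).dvd_of_dvd_mul_left hC
      rw [mul_assoc] at hs
      obtain ⟨k, s', hk, hs', rfl⟩ := Nat.dvd_mul.1 hs
      have hmem := ih' hC' hs'
      have hs0 : 0 < s' := Nat.pos_of_dvd_of_pos hs'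
        (Nat.mul_pos hD'.ne_zero.bot_lt (Nat.pos_of_dvd_of_pos hC' hD'.ne_zero.bot_lt))
      have key : ∀ v ∈ eulerSpan c c' D C g, v ∈ eulerSpan c c' (p * D) C g ∧
          opV p v ∈ eulerSpan c c' (p * D) C g := by
        intro v hv
        induction hv using Submodule.span_induction with
        | zero => simp only [map_zero]; exact ⟨zero_mem _, zero_mem _⟩
        | add x y _ _ hx hy =>
          simp only [map_add]
          exact ⟨add_mem hx.1 hy.1, add_mem hx.2 hy.2⟩
        | smul a x _ hx =>
          simp only [map_smul]
          exact ⟨Submodule.smul_mem _ _ hx.1, Submodule.smul_mem _ _ hx.2⟩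
        | mem v hv =>
          obtain ⟨m, l, hm, hl, h1, h2, rfl⟩ := hv
          set v := eulerProd c' l (eulerProd c m g) with hv
          have mA : eulerOp c p v ∈ eulerSpan c c' (p * D) C g :=
            Submodule.subset_span ⟨p * m, l, mul_dvd_mul_left p hm, hl.mul_left p,
              by rw [mul_assoc]; exact mul_dvd_mul_left p h1,
              by rw [mul_assoc p m l, mul_assoc p D C]; exact mul_dvd_mul_left p h2,
              hA m l hm hl⟩
          have mB : eulerOp c' p v ∈ eulerSpan c c' (p * D) C g :=
            Submodule.subset_span ⟨m, p * l, hm.mul_left p, mul_dvd_mul_left p hl,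
              by rw [mul_left_comm]; exact mul_dvd_mul_left p h1,
              by rw [mul_left_comm m p l, mul_assoc p D C]; exact mul_dvd_mul_left p h2,
              hB m l hl⟩
          have m1 : opV p v ∈ eulerSpan c c' (p * D) C g := by
            rw [hV]; exact Submodule.smul_mem _ _ (sub_mem mA mB)
          refine ⟨?_, m1⟩
          rw [hI v]; exact add_mem mA (Submodule.smul_mem _ _ m1)
      obtain ⟨k0, k1⟩ := key _ hmem
      rcases (Nat.dvd_prime hp).1 hk with rfl | rfl
      · rwa [one_mul]
      · rwa [mul_comm _ s', ← opV_opV hp.pos hs0]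

/-! ### The basis -/

variable {D C : ℕ}

namespace Triple

/-- The character of a triple, with its conductor. -/
def primChar (t : Triple D C) : PrimChar := ⟨t.f, t.χ, t.f_pos, t.primitive⟩

/-- The eigenvalue of the Hecke operator at the prime `l` on `E_{M, L, χ}`. -/
def eig (t : Triple D C) (l : ℕ) : ℂ :=
  if l ∣ t.M then (if l ∣ t.L then 0 else t.χ⁻¹ (l : ZMod t.f))
  else if l ∣ t.L then l * t.χ (l : ZMod t.f)
  else t.χ⁻¹ (l : ZMod t.f) + l * t.χ (l : ZMod t.f)

variable (t : Triple D C) {l : ℕ}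

lemma heckeT_eisSeries (hD : Squarefree D) (hC : C ∣ D) (hl : l.Prime) :
    heckeT (D * C) l (eisSeries t) = t.eig l • eisSeries t := by
  rw [eig]
  split_ifs with hM hL hL
  · exact heckeT_of_dvd (hM.trans t.M_dvd) (heckeEig_eisSeries_of_dvd_both t hD hl hM hL)
  · exact heckeT_of_dvd (hM.trans t.M_dvd) (heckeEig_eisSeries_of_dvd_M t hD hl hM hL)
  · exact heckeT_of_dvd (hL.trans t.L_dvd) (heckeEig_eisSeries_of_dvd_L t hD hl hM hL)
  · have h : ¬ l ∣ D := fun h => (hl.dvd_mul.1 (h.trans t.dvd_mul)).elim hM hL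
    exact heckeT_of_not_dvd hC hl h (heckeEig_eisSeries_of_not_dvd t hl h)

lemma eig_of_not_dvd (h : ¬ l ∣ D) : t.eig l = t.primChar.eig l := by
  rw [eig, if_neg fun h' => h (h'.trans t.M_dvd), if_neg fun h' => h (h'.trans t.L_dvd)]
  rfl

lemma norm_eig (hl : l.Prime) (h : l ∣ D) :
    ‖t.eig l‖ = if l ∣ t.M then (if l ∣ t.L then 0 else 1) else (l : ℝ) := by
  have hnorm : ¬ l ∣ t.f → ‖t.χ (l : ZMod t.f)‖ = 1 := fun h =>
    t.primChar.norm_eq_one (hl.coprime_iff_not_dvd.2 h)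
  rw [eig]
  split_ifs with hM hL hL
  · exact norm_zero
  · rw [← MulChar.star_apply', norm_star]
    exact hnorm fun h' => hL (h'.trans t.f_dvd_L)
  · rw [norm_mul, Complex.norm_natCast, hnorm fun h' => hM (h'.trans t.f_dvd_M), mul_one]
  · exact absurd (h.trans t.dvd_mul) (by rw [hl.dvd_mul]; tauto)

/-- The eigenvalues outside `D` determine `χ`; those at the primes dividing `D`, of absolute
values `0`, `1` or `l`, determine `M` and `L`. -/
lemma eq_of_eig_eq (hD : Squarefree D) {t t' : Triple D C}
    (h : ∀ l : ℕ, l.Prime → t.eig l = t'.eig l) : t = t' := by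
  have hc : t.primChar = t'.primChar := by
    by_contra hne
    obtain ⟨l, hl, hlD, -, -, h'⟩ := PrimChar.exists_prime_eig_ne hne hD.ne_zero.bot_lt
    have hlD' := hl.coprime_iff_not_dvd.1 hlD
    exact h' (by rw [← t.eig_of_not_dvd hlD', ← t'.eig_of_not_dvd hlD', h l hl])
  have key : ∀ l : ℕ, l.Prime → (l ∣ t.M ↔ l ∣ t'.M) ∧ (l ∣ t.L ↔ l ∣ t'.L) := by
    intro l hl
    by_cases hlD : l ∣ D
    · have h1 := congrArg norm (h l hl)
      rw [t.norm_eig hl hlD, t'.norm_eig hl hlD] at h1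
      have h2 : (2 : ℝ) ≤ l := by exact_mod_cast hl.two_le
      have h3 := hl.dvd_mul.1 (hlD.trans t.dvd_mul)
      have h4 := hl.dvd_mul.1 (hlD.trans t'.dvd_mul)
      split_ifs at h1 <;> first | tauto | (exfalso; linarith)
    · have hM := fun h' : l ∣ t.M => hlD (h'.trans t.M_dvd)
      have hM' := fun h' : l ∣ t'.M => hlD (h'.trans t'.M_dvd)
      have hL := fun h' : l ∣ t.L => hlD (h'.trans t.L_dvd)
      have hL' := fun h' : l ∣ t'.L => hlD (h'.trans t'.L_dvd)
      tauto
  have hM : t.M = t'.M := (Nat.Squarefree.ext_iff (hD.squarefree_of_dvd t.M_dvd)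
    (hD.squarefree_of_dvd t'.M_dvd)).2 fun l hl => (key l hl).1
  have hL : t.L = t'.L := (Nat.Squarefree.ext_iff (hD.squarefree_of_dvd t.L_dvd)
    (hD.squarefree_of_dvd t'.L_dvd)).2 fun l hl => (key l hl).2
  obtain ⟨M, L, f, χ, _, _, _, _, _, _, _, _⟩ := t
  obtain ⟨M', L', f', χ', _, _, _, _, _, _, _, _⟩ := t'
  obtain ⟨rfl, hχ⟩ := PrimChar.mk.inj hc
  obtain rfl := eq_of_heq hχ
  obtain rfl : M = M' := hM
  obtain rfl : L = L' := hL
  rfl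

end Triple

lemma eisSeries_ne_zero (t : Triple D C) : eisSeries t ≠ 0 := fun h => by
  have h1 := leadAt_eisSeries t
  rw [h] at h1
  exact one_ne_zero (h1.unique one_pos (leadAt_zero _))

/-- The series are eigenvectors of the Hecke operators with distinct systems of eigenvalues. -/
theorem linearIndependent_eisSeries (hD : Squarefree D) (hC : C ∣ D) :
    LinearIndependent ℂ (fun t : Triple D C => eisSeries t) := by
  rw [linearIndependent_iff']
  intro s a hsum t ht
  have h := eq_zero_of_sum_eigenvectors_eq_zero
    (fun l : {l : ℕ // l.Prime} => heckeLin (D * C) l.1) (fun t l => t.eig l.1) s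
    (fun t => a t • eisSeries t) (fun t _ l => ?_) (fun t _ t' _ hne => ?_) hsum t ht
  · exact (smul_eq_zero.1 h).resolve_right (eisSeries_ne_zero t)
  · rw [map_smul, heckeLin_apply, t.heckeT_eisSeries hD hC l.2, smul_comm]
  · by_contra! hcon
    exact hne (Triple.eq_of_eig_eq hD fun l hl => hcon ⟨l, hl⟩)

/-- Since `D` is square-free and `C ∣ D`, each prime of `f` divides both `D` and `C` exactly once. -/
lemma exists_eq_mul_of_sq_mul_dvd (hD : Squarefree D) (hC : C ∣ D) {f s : ℕ} (hf : 0 < f)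
    (h : f ^ 2 * s ∣ D * C) :
    ∃ D₀ C₀ : ℕ, D = f * D₀ ∧ C = f * C₀ ∧ Nat.Coprime f D₀ ∧ C₀ ∣ D₀ ∧ s ∣ D₀ * C₀ := by
  have h1 : f ^ 2 ∣ D ^ 2 := ((Nat.dvd_mul_right _ s).trans h).trans
    (by rw [pow_two]; exact mul_dvd_mul_left D hC)
  obtain ⟨D₀, rfl⟩ := (Nat.pow_dvd_pow_iff two_ne_zero).1 h1
  have hcop : Nat.Coprime f D₀ := Nat.coprime_of_squarefree_mul hD
  have h2 : f * s ∣ D₀ * C := by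
    refine Nat.dvd_of_mul_dvd_mul_left hf ?_
    rwa [← mul_assoc, ← pow_two, ← mul_assoc]
  obtain ⟨C₀, rfl⟩ := hcop.dvd_of_dvd_mul_left ((Nat.dvd_mul_right f s).trans h2)
  refine ⟨D₀, C₀, rfl, rfl, hcop, Nat.dvd_of_mul_dvd_mul_left hf hC, ?_⟩
  refine Nat.dvd_of_mul_dvd_mul_left hf ?_
  rwa [mul_left_comm]

/-- The function excluded by the condition `M ≠ 1`, that is `[D]⁻_1 (E_1)`. -/
def excluded (D : ℕ) : ℍ → ℂ :=
  eulerProd (cMinus (1 : DirichletCharacter ℂ 1)) D (eisChi (1 : DirichletCharacter ℂ 1))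

lemma eulerProd_mem_range_or_eq_excluded (c : PrimChar) {D₀ C₀ m l : ℕ} (hD : D = c.f * D₀)
    (hC : C = c.f * C₀) (hm : m ∣ D₀) (hl : l ∣ D₀) (h1 : D₀ ∣ m * l) (h2 : m * l ∣ D₀ * C₀) :
    eulerProd (cMinus c.χ) l (eulerProd (cPlus c.χ) m (eisChi c.χ)) ∈
      insert (excluded D) (Set.range fun t : Triple D C => eisSeries t) := by
  obtain ⟨f, χ, hf, hχ⟩ := c
  simp only at hD hC ⊢
  by_cases hM : f * m = 1
  · left
    obtain ⟨rfl, rfl⟩ := mul_eq_one.1 hM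
    rw [one_mul] at hD h1
    obtain rfl : l = D := by rw [hD]; exact Nat.dvd_antisymm hl h1
    obtain rfl : χ = 1 := χ.level_one
    rw [eulerProd_one, excluded]
  · right
    refine ⟨⟨f * m, f * l, f, χ, ?_, ?_, hM, ?_, ?_, hf, ?_, hχ⟩, ?_⟩
    · rw [hD]; exact mul_dvd_mul_left f hm
    · rw [hD]; exact mul_dvd_mul_left f hl
    · rw [hD, mul_assoc]
      exact mul_dvd_mul_left f (h1.trans (mul_dvd_mul_left m (Nat.dvd_mul_left l f)))
    · rw [hD, hC, mul_mul_mul_comm, mul_mul_mul_comm f D₀]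
      exact mul_dvd_mul_left _ h2
    · exact Nat.dvd_gcd (Nat.dvd_mul_right _ _) (Nat.dvd_mul_right _ _)
    · simp only [eisSeries, bracketPlus_eq, bracketMinus_eq, Nat.mul_div_cancel_left _ hf]
      rfl

lemma eisV_mem_span (hD : Squarefree D) (hC : C ∣ D) {i : PrimChar × ℕ+}
    (h : i.1.f ^ 2 * i.2 ∣ D * C) :
    eisV i ∈ Submodule.span ℂ
      (insert (excluded D) (Set.range fun t : Triple D C => eisSeries t)) := by
  obtain ⟨c, s⟩ := i
  obtain ⟨D₀, C₀, hD₀, hC₀, hcop, hCD, hs⟩ := exists_eq_mul_of_sq_mul_dvd hD hC c.f_pos h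
  have hc : ∀ p : ℕ, p.Prime → p ∣ D₀ → cPlus c.χ p ≠ cMinus c.χ p ∧ cPlus c.χ p ≠ 0 ∧
      cMinus c.χ p ≠ 0 := by
    intro p hp hpD
    have hpc : Nat.Coprime p c.f := (hcop.coprime_dvd_right hpD).symm
    have h1 : ‖cPlus c.χ p‖ = 1 := c.norm_eq_one hpc
    have h2 : ‖cMinus c.χ p‖ = (p : ℝ)⁻¹ := by
      rw [cMinus, norm_mul, norm_inv, Complex.norm_natCast, ← MulChar.star_apply', norm_star,
        c.norm_eq_one hpc, mul_one]
    have hp1 : (1 : ℝ) < p := by exact_mod_cast hp.one_lt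
    refine ⟨fun e => ?_, fun e => ?_, fun e => ?_⟩
    · rw [e, h2] at h1
      exact (inv_lt_one_of_one_lt₀ hp1).ne h1
    · rw [e, norm_zero] at h1; exact zero_ne_one h1
    · rw [e, norm_zero] at h2; exact (inv_pos.2 (zero_lt_one.trans hp1)).ne h2
  have h1 := opV_mem_eulerSpan (g := eisChi c.χ)
    (hD.squarefree_of_dvd (by rw [hD₀]; exact Nat.dvd_mul_left _ _)) hc hCD hs
  refine Submodule.span_mono ?_ h1
  rintro _ ⟨m, l, hm, hl, h1, h2, rfl⟩
  exact eulerProd_mem_range_or_eq_excluded c hD₀ hC₀ hm hl h1 h2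

/-- The `1 / y` term of `[D]⁻_1 (E_1)` does not vanish, since `∏_{p ∣ D} (1 - 1 / p) ≠ 0`. -/
lemma exists_eisMod_excluded (D : ℕ) : ∃ v : ℂ, v ≠ 0 ∧ EisMod (excluded D) v := by
  obtain ⟨v, hv, -, hmod⟩ := eisMod_eisChi
    (DirichletCharacter.isPrimitive_one_level_one : (1 : DirichletCharacter ℂ 1).IsPrimitive)
  refine ⟨_, mul_ne_zero (hv rfl) ?_, eisMod_foldr hmod (cMinus (1 : DirichletCharacter ℂ 1))
    (ps := D.primeFactorsList) fun p hp => (Nat.prime_of_mem_primeFactorsList hp).pos⟩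
  refine List.prod_ne_zero fun h => ?_
  obtain ⟨p, hp, h0⟩ := List.mem_map.1 h
  have h1 : (1 : DirichletCharacter ℂ 1) (p : ZMod 1) = 1 := by
    rw [Subsingleton.elim (p : ZMod 1) 1, map_one]
  rw [cMinus, inv_one, h1, mul_one, sub_eq_zero, eq_comm, inv_eq_one] at h0
  exact (Nat.prime_of_mem_primeFactorsList hp).one_lt.ne' (by exact_mod_cast h0)

/-- An Eisenstein series for `Γ₀(DC)` is a combination of the `E_{M, L, χ}` and the excluded function;
comparing the `1 / y` terms, the latter does not occur. -/
theorem span_eisSeries (hD : Squarefree D) (hC : C ∣ D) :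
    Submodule.span ℂ (Set.range fun t : Triple D C => eisSeries t) = eisensteinSpace (D * C) := by
  have hDC : D * C ≠ 0 := mul_ne_zero hD.ne_zero (ne_zero_of_dvd_ne_zero hD.ne_zero hC)
  have : NeZero (D * C) := ⟨hDC⟩
  have hle : Submodule.span ℂ (Set.range fun t : Triple D C => eisSeries t) ≤
      eisensteinSpace (D * C) := by
    rw [Submodule.span_le]
    rintro _ ⟨t, rfl⟩
    exact mem_eisensteinSpace_iff.2 ⟨isGammaInv_eisSeries hD t, eisSeries_mem t hD⟩
  refine le_antisymm hle fun g hg => ?_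
  obtain ⟨hinv, hall⟩ := mem_eisensteinSpace_iff.1 hg
  have h1 : g ∈ Submodule.span ℂ
      (insert (excluded D) (Set.range fun t : Triple D C => eisSeries t)) := by
    refine Submodule.span_le.2 ?_ (mem_span_eisV hDC.bot_lt hall hinv)
    rintro _ ⟨i, hi, rfl⟩
    exact eisV_mem_span hD hC hi
  obtain ⟨a, x, hx, rfl⟩ := Submodule.mem_span_insert.1 h1
  obtain ⟨v, hv, hmod⟩ := exists_eisMod_excluded D
  have h2 : a • excluded D ∈ eisensteinAll := by
    have := sub_mem hall (mem_eisensteinSpace_iff.1 (hle hx)).2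
    rwa [add_sub_cancel_right] at this
  have h3 : EisMod (a • excluded D) (a * v) := by
    have := Submodule.smul_mem _ a hmod
    rwa [smul_sub, smul_smul] at this
  have ha : a = 0 := (mul_eq_zero.1 (eq_zero_of_eisMod h3 h2)).resolve_right hv
  rwa [ha, zero_smul, zero_add]

end EisBasis

end

theorem proposition3p7 (D C : ℕ) (hD : Squarefree D) (hC : C ∣ D) :
    -- each series is normalized: its first Fourier coefficient at infinity is one
    (∀ t : EisBasis.Triple D C,
      (UpperHalfPlane.qExpansion 1 (EisBasis.eisSeries t)).coeff 1 = 1) ∧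
    -- each series is an eigenvector of every Hecke operator at a prime
    (∀ (t : EisBasis.Triple D C) (ℓ : ℕ), ℓ.Prime →
      (¬ ℓ ∣ D →
        EisBasis.heckeT (D * C) ℓ (EisBasis.eisSeries t)
          = (t.χ⁻¹ (ℓ : ZMod t.f) + (ℓ : ℂ) * t.χ (ℓ : ZMod t.f)) • EisBasis.eisSeries t) ∧
      (ℓ ∣ t.M / Nat.gcd t.M t.L →
        EisBasis.heckeT (D * C) ℓ (EisBasis.eisSeries t)
          = t.χ⁻¹ (ℓ : ZMod t.f) • EisBasis.eisSeries t) ∧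
      (ℓ ∣ t.L / Nat.gcd t.M t.L →
        EisBasis.heckeT (D * C) ℓ (EisBasis.eisSeries t)
          = ((ℓ : ℂ) * t.χ (ℓ : ZMod t.f)) • EisBasis.eisSeries t) ∧
      (ℓ ∣ Nat.gcd t.M t.L →
        EisBasis.heckeT (D * C) ℓ (EisBasis.eisSeries t) = 0)) ∧
    -- the series form a basis of the space of Eisenstein series
    LinearIndependent ℂ (fun t : EisBasis.Triple D C => EisBasis.eisSeries t) ∧
    Submodule.span ℂ (Set.range fun t : EisBasis.Triple D C => EisBasis.eisSeries t)
      = EisBasis.eisensteinSpace (D * C) := by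
  refine ⟨EisBasis.coeff_one_eisSeries hD, fun t ℓ hℓ => ?_,
    EisBasis.linearIndependent_eisSeries hD hC, EisBasis.span_eisSeries hD hC⟩
  rw [t.heckeT_eisSeries hD hC hℓ, EisBasis.Triple.eig]
  refine ⟨fun h => ?_, fun h => ?_, fun h => ?_, fun h => ?_⟩
  · rw [if_neg fun h' => h (h'.trans t.M_dvd), if_neg fun h' => h (h'.trans t.L_dvd)]
  · obtain ⟨hM, hL⟩ := EisBasis.dvd_div_gcd (hD.squarefree_of_dvd t.M_dvd) h hℓ
    rw [if_pos hM, if_neg hL]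
  · rw [Nat.gcd_comm] at h
    obtain ⟨hL, hM⟩ := EisBasis.dvd_div_gcd (hD.squarefree_of_dvd t.L_dvd) h hℓ
    rw [if_neg hM, if_pos hL]
  · rw [if_pos (h.trans (Nat.gcd_dvd_left _ _)), if_pos (h.trans (Nat.gcd_dvd_right _ _)),
      zero_smul]
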